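/- Let $\Gamma$ be a finite group and let $\gamma_0,\dots,\gamma_r$ be its irreducible complex characters, $\gamma_0$ trivial. Let $R_{\mathbb Z}(\Gamma)=\bigoplus_i\mathbb Z\gamma_i$ with the standard form $\langle\alpha,\beta\rangle=|\Gamma|^{-1}\sum_{x}\alpha(x)\beta(x^{-1})$ (trivial weight $\xi=\gamma_0$). **Groups.** Let $\Pi_n$ be the group of order $2^{n+1}$ generated by $a_1,\dots,a_n$ and a central element $z$ with $a_i^2=z$, $z^2=1$, $a_ia_j=za_ja_i$ $(i\ne j)$, and let $\widetilde\Gamma_n=(\Gamma^n\times\Pi_n)\rtimes S_n$, where $S_n$ permutes the factors of $\Gamma^n$ and the $a_i$. Let $p:\widetilde\Gamma_n\to\mathbb Z/2$ be the homomorphism with $p(a_i)=1$ and $p=0$ on $\Gamma^n$ and $S_n$. Let $R^-(\widetilde\Gamma_n)$ be the complex vector space of class functions $f$ on $\widetilde\Gamma_n$ with $f(zx)=-f(x)$ and $f(x)=0$ whenever $p(x)=1$. For $m=n+k$ let $\widetilde\Gamma_n\hat\times\widetilde\Gamma_k\subset\widetilde\Gamma_m$ be the subgroup generated by the copies of $\widetilde\Gamma_n$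 and $\widetilde\Gamma_k$ on the first $n$ and the last $k$ indices; for functions $f,g$ on the two factors that change sign under $z$ and vanish on odd elements, $f\otimes g$ is the function $ts\mapsto f(t)g(s)$ on it. **Basic spin characters.** Let $L_n$ be the Clifford algebra on $e_1,\dots,e_n$ with $e_ie_j+e_je_i=-2\delta_{ij}$, on which $a_i$ acts by left multiplication by $e_i$, $z$ by $-1$, and $s\in S_n$ by the automorphism $e_i\mapsto e_{s(i)}$. For a character $\beta$ of a $\Gamma$-module $V$ let $\chi_n(\beta)$ be the character of $\widetilde\Gamma_n$ on $V^{\otimes n}\otimes L_n$ ($\Gamma^n\rtimes S_n$ acting on both factors in the obvious way, $\Gamma^n$ trivially on $L_n$, $\Pi_n$ trivially on $V^{\otimes n}$). For a virtual character $\beta-\delta$ put $$\chi_n(\beta-\delta)=\sum_{m=0}^n(-1)^m\,\mathrm{Ind}\,[\chi_{n-m}(\beta)\otimes\chi_m(\delta)],$$ the induction being from $\widetilde\Gamma_{n-m}\hat\times\widetilde\Gamma_m$ to $\widetilde\Gamma_n$. **Operators.** For $n\ge0$ and $\alpha\in R_{\mathbb Z}(\Gamma)$ define operators on $R^-_{\widetilde\Gamma}=\bigoplus_{m\ge0}R^-(\widetilde\Gamma_m)$: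 $H_{-n}(\alpha)f=\mathrm{Ind}_{\widetilde\Gamma_n\hat\times\widetilde\Gamma_m}^{\widetilde\Gamma_{n+m}}(\chi_n(\alpha)\otimes f)$ for $f\in R^-(\widetilde\Gamma_m)$; $H_n(\alpha)f$ is obtained by restricting $f\in R^-(\widetilde\Gamma_m)$ to $\widetilde\Gamma_n\hat\times\widetilde\Gamma_{m-n}$ and pairing the first factor with $\chi_n(\alpha)$ by $\langle u,v\rangle=|\widetilde\Gamma_n|^{-1}\sum_xu(x)v(x^{-1})$, and is $0$ if $n>m$. Thus $H_0(\alpha)=1$. Put $H_+(\alpha,w)=\sum_{n\ge0}H_{-n}(\alpha)w^n$ and $H_-(\alpha,w)=\sum_{n\ge0}H_n(\alpha)w^{-n}$, where $w$ is a formal variable. **Lattice part.** Let $\varepsilon:R_{\mathbb Z}(\Gamma)\times R_{\mathbb Z}(\Gamma)\to\{\pm1\}$ be bimultiplicative with $\varepsilon(\gamma_i,\gamma_j)=1$ for $i\le j$ and $-1$ for $i>j$. Let $\hat R$ be the central extension of $R_{\mathbb Z}(\Gamma)/2R_{\mathbb Z}(\Gamma)$ by $\{\pm1\}$ with elements $\pm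 e_\alpha$ ($\alpha$ taken modulo $2$) and $e_\alpha e_\beta=\varepsilon(\alpha,\beta)e_{\alpha+\beta}$; its commutator form is $c_1(\alpha,\beta)=\langle\alpha,\beta\rangle+\langle\alpha,\alpha\rangle\langle\beta,\beta\rangle\bmod2$. Let $\Phi\subset R_{\mathbb Z}(\Gamma)$ be a maximal subgroup on which $c_1$ vanishes, and fix any irreducible $\hat R$-module structure on $\mathbb C[R_{\mathbb Z}(\Gamma)/\Phi]$ in which the central element $-1$ acts as $-1$. On $R^-_{\widetilde\Gamma}\otimes\mathbb C[R_{\mathbb Z}(\Gamma)/\Phi]$ define operators $X_n(\alpha)$, $n\in\mathbb Z$, by $$X(\alpha,w)=H_+(\alpha,w)H_-(\alpha,-w)\,e_\alpha=\sum_{n\in\mathbb Z}X_n(\alpha)w^{-n}.$$ **Theorem.** For all $0\le i,j\le r$ and $n,n'\in\mathbb Z$, with $\{A,B\}=AB+BA$, the operators $X_n(\pm\gamma_i)$ satisfy the Clifford algebra relations $$\{X_n(\gamma_i),X_{n'}(\gamma_j)\}=2(-1)^n\delta_{ij}\delta_{n,-n'},\qquad\{X_n(-\gamma_i),X_{n'}(-\gamma_j)\}=2(-1)^n\delta_{ij}\delta_{n,-n'},$$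 $$\{X_n(\gamma_i),X_{n'}(-\gamma_j)\}=2\delta_{ij}\delta_{n,-n'}.$$ -/

import Mathlib

open scoped TensorProduct DirectSum

noncomputable section

namespace SpinWreath

/-! ### Central extensions of `𝔽₂`-vector spaces by a sign -/

/-- The bilinear form on `𝔽₂^ι` with matrix `M`. -/
def bil {ι : Type} [Fintype ι] (M : ι → ι → ZMod 2) (x y : ι → ZMod 2) : ZMod 2 :=
  ∑ i, ∑ j, M i j * x i * y j

/-- The central extension of `𝔽₂^ι` by the two-element group given by the bilinear cocycle
`(-1) ^ bil M x y`.  The pair `(k, x)` is `(-1) ^ k` times the standard lift of `x`. -/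
@[ext]
structure SignExt {ι : Type} (M : ι → ι → ZMod 2) where
  sgn : ZMod 2
  vec : ι → ZMod 2

instance {ι : Type} (M : ι → ι → ZMod 2) : One (SignExt M) := ⟨⟨0, 0⟩⟩

@[simp] theorem SignExt.one_sgn {ι : Type} (M : ι → ι → ZMod 2) : (1 : SignExt M).sgn = 0 := rfl
@[simp] theorem SignExt.one_vec {ι : Type} (M : ι → ι → ZMod 2) : (1 : SignExt M).vec = 0 := rfl

theorem zmod2_add_self (a : ZMod 2) : a + a = 0 := CharTwo.add_self_eq_zero a

section SignExt

variable {ι : Type} [Fintype ι] {M : ι → ι → ZMod 2}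

theorem bil_add_left (x y z : ι → ZMod 2) : bil M (x + y) z = bil M x z + bil M y z := by
  simp [bil, mul_add, add_mul, Finset.sum_add_distrib]

theorem bil_add_right (x y z : ι → ZMod 2) : bil M x (y + z) = bil M x y + bil M x z := by
  simp [bil, mul_add, Finset.sum_add_distrib]

theorem bil_zero_left (x : ι → ZMod 2) : bil M 0 x = 0 := by simp [bil]

theorem bil_zero_right (x : ι → ZMod 2) : bil M x 0 = 0 := by simp [bil]

instance : Mul (SignExt M) := ⟨fun a b => ⟨a.sgn + b.sgn + bil M a.vec b.vec, a.vec + b.vec⟩⟩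
instance : Inv (SignExt M) := ⟨fun a => ⟨a.sgn + bil M a.vec a.vec, a.vec⟩⟩

@[simp] theorem SignExt.mul_sgn (a b : SignExt M) :
    (a * b).sgn = a.sgn + b.sgn + bil M a.vec b.vec := rfl
@[simp] theorem SignExt.mul_vec (a b : SignExt M) : (a * b).vec = a.vec + b.vec := rfl
@[simp] theorem SignExt.inv_sgn (a : SignExt M) : (a⁻¹).sgn = a.sgn + bil M a.vec a.vec := rfl
@[simp] theorem SignExt.inv_vec (a : SignExt M) : (a⁻¹).vec = a.vec := rfl

instance : Group (SignExt M) :=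
  Group.ofLeftAxioms
    (fun a b c => by
      ext1
      · simp only [SignExt.mul_sgn, SignExt.mul_vec, bil_add_left, bil_add_right]; ring
      · simp only [SignExt.mul_vec, add_assoc])
    (fun a => by ext1 <;> simp [bil_zero_left])
    (fun a => by
      ext1
      · simp only [SignExt.mul_sgn, SignExt.inv_sgn, SignExt.inv_vec, SignExt.one_sgn]
        have h1 := zmod2_add_self a.sgn
        have h2 := zmod2_add_self (bil M a.vec a.vec)
        linear_combination h1 + h2
      · funext i
        simpa using zmod2_add_self (a.vec i))

/-- A sign extension is in bijection with pairs (sign, vector). -/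
def SignExt.equivProd (M : ι → ι → ZMod 2) : SignExt M ≃ ZMod 2 × (ι → ZMod 2) where
  toFun a := (a.sgn, a.vec)
  invFun p := ⟨p.1, p.2⟩
  left_inv _ := rfl
  right_inv _ := rfl

instance [DecidableEq ι] : Fintype (SignExt M) := Fintype.ofEquiv _ (SignExt.equivProd M).symm

end SignExt

/-! ### The groups `Π_n` and `Γ̃_n` -/

/-- Matrix of the cocycle of `Π_n`: moving `a_J` past `a_I` costs one factor `z` for every pair
`i ∈ I`, `j ∈ J` with `j < i`, and one for every `i = j` since `a_i ^ 2 = z`. -/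
def cliffMatrix (n : ℕ) (i j : Fin n) : ZMod 2 := if j ≤ i then 1 else 0

/-- The group `Π_n` generated by `a_1, …, a_n` and the central element `z` subject to
`a_i ^ 2 = z`, `z ^ 2 = 1`, `a_i a_j = z a_j a_i` for `i ≠ j`.
The element `(k, x)` is `z ^ k a_I` with `a_I` the product of the `a_i`, `i ∈ I`, in increasing
order and `x` the indicator function of `I`. -/
abbrev PiGroup (n : ℕ) : Type := SignExt (cliffMatrix n)

/-- The number (mod 2) of inversions of `s` on the support of `x`. -/
def inversions {n : ℕ} (s : Equiv.Perm (Fin n)) (x : Fin n → ZMod 2) : ZMod 2 :=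
  ∑ i, ∑ j, if i < j ∧ s j < s i then x i * x j else 0

theorem inversions_add {n : ℕ} (s : Equiv.Perm (Fin n)) (x y : Fin n → ZMod 2) :
    inversions s (x + y) + bil (cliffMatrix n) x y =
      inversions s x + inversions s y
        + bil (cliffMatrix n) (x ∘ s.symm) (y ∘ s.symm) := by
  have h1 : bil (cliffMatrix n) (x ∘ s.symm) (y ∘ s.symm)
      = ∑ i, ∑ j, cliffMatrix n (s i) (s j) * x i * y j := by
    unfold bil
    rw [← Equiv.sum_comp s]
    refine Finset.sum_congr rfl fun i _ => ?_
    rw [← Equiv.sum_comp s]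
    simp
  have h2 : (∑ i, ∑ j, if i < j ∧ s j < s i then y i * x j else 0)
      = ∑ i, ∑ j, if j < i ∧ s i < s j then x i * y j else 0 := by
    rw [Finset.sum_comm]
    refine Finset.sum_congr rfl fun i _ => Finset.sum_congr rfl fun j _ => ?_
    rw [mul_comm]
  have h3 : inversions s (x + y) = inversions s x + inversions s y
      + (∑ i, ∑ j, if i < j ∧ s j < s i then x i * y j else 0)
      + (∑ i, ∑ j, if i < j ∧ s j < s i then y i * x j else 0) := by
    simp only [inversions, ← Finset.sum_add_distrib]
    refine Finset.sum_congr rfl fun i _ => Finset.sum_congr rfl fun j _ => ?_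
    split_ifs
    · simp only [Pi.add_apply]; ring
    · simp
  have h4 : (∑ i, ∑ j, if i < j ∧ s j < s i then x i * y j else 0)
      + (∑ i, ∑ j, if j < i ∧ s i < s j then x i * y j else 0)
      + bil (cliffMatrix n) x y
      = ∑ i, ∑ j, cliffMatrix n (s i) (s j) * x i * y j := by
    simp only [bil, ← Finset.sum_add_distrib]
    refine Finset.sum_congr rfl fun i _ => Finset.sum_congr rfl fun j _ => ?_
    have hc := zmod2_add_self (x i * y j)
    unfold cliffMatrix
    rcases lt_trichotomy i j with h | h | h
    · have hne : s i ≠ s j := fun hh => h.ne (s.injective hh)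
      rcases lt_or_gt_of_ne hne with h' | h'
      · simp [h, h.not_gt, h.not_ge, h', h'.not_gt, h'.not_ge]
      · simp [h, h.not_gt, h.not_ge, h', h'.not_gt, h'.le]
    · subst h; simp
    · have hne : s i ≠ s j := fun hh => h.ne' (s.injective hh)
      rcases lt_or_gt_of_ne hne with h' | h'
      · simp [h, h.not_gt, h.le, h', h'.not_gt, h'.not_ge, hc]
      · simp [h, h.not_gt, h.le, h', h'.not_gt, h'.le]
  rw [h1, h3, h2, ← h4]
  ring

theorem sum_symmetrize {n : ℕ} (F : Fin n → Fin n → ZMod 2) (hF : ∀ i, F i i = 0) :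
    ∑ i, ∑ j, F i j = ∑ i, ∑ j, if i < j then F i j + F j i else 0 := by
  have h1 : ∑ i, ∑ j, F i j = (∑ i, ∑ j, if i < j then F i j else 0)
      + ∑ i, ∑ j, if j < i then F i j else 0 := by
    simp only [← Finset.sum_add_distrib]
    refine Finset.sum_congr rfl fun i _ => Finset.sum_congr rfl fun j _ => ?_
    rcases lt_trichotomy i j with h | h | h
    · simp [h, h.not_gt]
    · subst h; simp [hF]
    · simp [h, h.not_gt]
  rw [h1, Finset.sum_comm (f := fun i j => if j < i then F i j else 0)]
  simp only [← Finset.sum_add_distrib]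
  refine Finset.sum_congr rfl fun i _ => Finset.sum_congr rfl fun j _ => ?_
  split_ifs <;> simp

theorem inversions_mul {n : ℕ} (t s : Equiv.Perm (Fin n)) (x : Fin n → ZMod 2) :
    inversions (t * s) x = inversions s x + inversions t (x ∘ s.symm) := by
  have h1 : inversions t (x ∘ s.symm)
      = ∑ i, ∑ j, if s i < s j ∧ t (s j) < t (s i) then x i * x j else 0 := by
    unfold inversions
    rw [← Equiv.sum_comp s]
    refine Finset.sum_congr rfl fun i _ => ?_
    rw [← Equiv.sum_comp s]
    simp
  rw [h1, sum_symmetrize _ (by simp)]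
  simp only [inversions, ← Finset.sum_add_distrib]
  refine Finset.sum_congr rfl fun i _ => Finset.sum_congr rfl fun j _ => ?_
  have hc := zmod2_add_self (x i * x j)
  rcases lt_or_ge i j with h | h
  · have hne : s i ≠ s j := fun hh => h.ne (s.injective hh)
    have hne' : t (s i) ≠ t (s j) := fun hh => hne (t.injective hh)
    have hc' : x i * x j + x j * x i = 0 := by rw [mul_comm (x j)]; exact hc
    rcases lt_or_gt_of_ne hne with h' | h' <;> rcases lt_or_gt_of_ne hne' with h'' | h'' <;>
      simp [h, h', h'', h'.not_gt, h''.not_gt, mul_comm (x j), hc]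
  · simp [h.not_gt]

theorem inversions_one {n : ℕ} (x : Fin n → ZMod 2) : inversions 1 x = 0 := by
  unfold inversions
  refine Finset.sum_eq_zero fun i _ => Finset.sum_eq_zero fun j _ => ?_
  rw [if_neg]
  rintro ⟨h, h'⟩
  exact lt_asymm h h'

variable (Γ : Type*) [Group Γ]

/-- The automorphism of `Γ^n × Π_n` given by a permutation `s`:
`s (g_1, …, g_n) = (g_{s⁻¹ 1}, …, g_{s⁻¹ n})` and `s (a_i) = a_{s i}`. -/
def permAut (n : ℕ) (s : Equiv.Perm (Fin n)) : (Fin n → Γ) × PiGroup n →* (Fin n → Γ) × PiGroup n where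
  toFun p := (p.1 ∘ s.symm, ⟨p.2.sgn + inversions s p.2.vec, p.2.vec ∘ s.symm⟩)
  map_one' := by
    refine Prod.ext (by funext i; simp) (SignExt.ext ?_ (by funext i; simp))
    simp [inversions]
  map_mul' p q := by
    refine Prod.ext (by funext i; simp) (SignExt.ext ?_ (by funext i; simp))
    have := inversions_add s p.2.vec q.2.vec
    simp only [Prod.snd_mul, SignExt.mul_sgn, SignExt.mul_vec]
    linear_combination this

theorem permAut_one (n : ℕ) (p : (Fin n → Γ) × PiGroup n) : permAut Γ n 1 p = p :=
  Prod.ext rfl (SignExt.ext (by simp [permAut, inversions_one]) rfl)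

theorem permAut_mul (n : ℕ) (t s : Equiv.Perm (Fin n)) (p : (Fin n → Γ) × PiGroup n) :
    permAut Γ n (t * s) p = permAut Γ n t (permAut Γ n s p) :=
  Prod.ext rfl (SignExt.ext (by simp [permAut, inversions_mul, add_assoc]) rfl)

/-- The action of `S_n` on `Γ^n × Π_n` by simultaneous permutations. -/
def permAction (n : ℕ) : Equiv.Perm (Fin n) →* MulAut ((Fin n → Γ) × PiGroup n) where
  toFun s := (permAut Γ n s).toMulEquiv (permAut Γ n s⁻¹)
    (MonoidHom.ext fun p => by simp [← permAut_mul, permAut_one])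
    (MonoidHom.ext fun p => by simp [← permAut_mul, permAut_one])
  map_one' := MulEquiv.ext fun p => permAut_one Γ n p
  map_mul' t s := MulEquiv.ext fun p => permAut_mul Γ n t s p

/-- The group `Γ̃_n`, the semidirect product of `S_n` and `Γ^n × Π_n`. -/
abbrev SpinGroup (n : ℕ) : Type _ :=
  SemidirectProduct ((Fin n → Γ) × PiGroup n) (Equiv.Perm (Fin n)) (permAction Γ n)

instance (n : ℕ) [Fintype Γ] : Fintype (SpinGroup Γ n) :=
  Fintype.ofEquiv _ (SemidirectProduct.equivProd (φ := permAction Γ n)).symm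

variable {Γ}

/-- The central element `z` of `Γ̃_n`. -/
def zElt (n : ℕ) : SpinGroup Γ n := ⟨(1, ⟨1, 0⟩), 1⟩

/-- The parity `p : Γ̃_n → ℤ/2`, with `p (a_i) = 1` and `p = 0` on `Γ^n` and `S_n`. -/
def parity {n : ℕ} (x : SpinGroup Γ n) : ZMod 2 := ∑ i, x.left.2.vec i

@[simp] theorem permAction_fst {n : ℕ} (s : Equiv.Perm (Fin n)) (p : (Fin n → Γ) × PiGroup n) :
    (permAction Γ n s p).1 = p.1 ∘ s.symm := rfl

@[simp] theorem permAction_vec {n : ℕ} (s : Equiv.Perm (Fin n)) (p : (Fin n → Γ) × PiGroup n) :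
    (permAction Γ n s p).2.vec = p.2.vec ∘ s.symm := rfl

@[simp] theorem permAction_sgn {n : ℕ} (s : Equiv.Perm (Fin n)) (p : (Fin n → Γ) × PiGroup n) :
    (permAction Γ n s p).2.sgn = p.2.sgn + inversions s p.2.vec := rfl

@[ext] theorem spinGroup_ext {n : ℕ} {x y : SpinGroup Γ n} (h1 : x.left.1 = y.left.1)
    (h2 : x.left.2.sgn = y.left.2.sgn) (h3 : x.left.2.vec = y.left.2.vec)
    (h4 : x.right = y.right) : x = y :=
  SemidirectProduct.ext (Prod.ext h1 (SignExt.ext h2 h3)) h4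

theorem parity_mul {n : ℕ} (x y : SpinGroup Γ n) : parity (x * y) = parity x + parity y := by
  simp only [parity, SemidirectProduct.mul_left, Prod.snd_mul, SignExt.mul_vec, permAction_vec,
    Pi.add_apply, Finset.sum_add_distrib, Function.comp_apply]
  rw [Equiv.sum_comp x.right.symm]

theorem parity_one {n : ℕ} : parity (1 : SpinGroup Γ n) = 0 := by simp [parity]

theorem parity_inv {n : ℕ} (x : SpinGroup Γ n) : parity x⁻¹ = parity x := by
  have h := parity_mul x⁻¹ x
  rw [inv_mul_cancel, parity_one] at h
  exact CharTwo.add_eq_zero.mp h.symm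

@[simp] theorem zElt_left_fst (n : ℕ) : (zElt n : SpinGroup Γ n).left.1 = 1 := rfl
@[simp] theorem zElt_left_sgn (n : ℕ) : (zElt n : SpinGroup Γ n).left.2.sgn = 1 := rfl
@[simp] theorem zElt_left_vec (n : ℕ) : (zElt n : SpinGroup Γ n).left.2.vec = 0 := rfl
@[simp] theorem zElt_right (n : ℕ) : (zElt n : SpinGroup Γ n).right = 1 := rfl

theorem inversions_zero {n : ℕ} (s : Equiv.Perm (Fin n)) : inversions s 0 = 0 := by
  simp [inversions]

theorem zElt_mul_comm {n : ℕ} (x : SpinGroup Γ n) : zElt n * x = x * zElt n := by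
  ext1
  · funext i; simp
  · simp [inversions_zero, bil_zero_left, bil_zero_right, add_comm]
  · funext i; simp
  · simp

/-! ### The embeddings of `Γ̃_n` in `Γ̃_m` for increasing maps of indices -/

/-- Extension of a function along an injection by a default value. -/
def ext {α : Type*} {n m : ℕ} (e : Fin n ↪o Fin m) (d : α) (f : Fin n → α) : Fin m → α :=
  Function.extend e f fun _ => d

theorem ext_apply {α : Type*} {n m : ℕ} (e : Fin n ↪o Fin m) (d : α) (f : Fin n → α) (i : Fin n) :
    ext e d f (e i) = f i := e.injective.extend_apply _ _ _

theorem ext_apply' {α : Type*} {n m : ℕ} (e : Fin n ↪o Fin m) (d : α) (f : Fin n → α) (b : Fin m)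
    (h : b ∉ Set.range e) : ext e d f b = d := Function.extend_apply' _ _ _ h

theorem sum_ext_aux {n m : ℕ} (e : Fin n ↪o Fin m) (F : Fin m → ZMod 2)
    (hF : ∀ b, b ∉ Set.range e → F b = 0) : ∑ b, F b = ∑ i, F (e i) := by
  classical
  have := Finset.sum_map Finset.univ e.toEmbedding F
  rw [show (∑ i, F (e i)) = ∑ x, F (e.toEmbedding x) from rfl, ← this]
  symm
  refine Finset.sum_subset (Finset.subset_univ _) fun b _ hb => hF b ?_
  simpa using hb

theorem bil_ext {n m : ℕ} (e : Fin n ↪o Fin m) (x y : Fin n → ZMod 2) :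
    bil (cliffMatrix m) (ext e 0 x) (ext e 0 y) = bil (cliffMatrix n) x y := by
  unfold bil
  rw [sum_ext_aux e]
  · refine Finset.sum_congr rfl fun i _ => ?_
    rw [sum_ext_aux e]
    · simp [ext_apply, cliffMatrix]
    · intro b hb; simp [ext_apply' e 0 y b hb]
  · intro b hb; simp [ext_apply' e 0 x b hb]

/-- A permutation of `Fin n` acting on the image of `e` and fixing everything else. -/
def permExt {n m : ℕ} (e : Fin n ↪o Fin m) : Equiv.Perm (Fin n) →* Equiv.Perm (Fin m) :=
  Equiv.Perm.viaEmbeddingHom e.toEmbedding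

theorem permExt_apply {n m : ℕ} (e : Fin n ↪o Fin m) (s : Equiv.Perm (Fin n)) (i : Fin n) :
    permExt e s (e i) = e (s i) := Equiv.Perm.viaEmbedding_apply s e.toEmbedding i

theorem permExt_apply' {n m : ℕ} (e : Fin n ↪o Fin m) (s : Equiv.Perm (Fin n)) (b : Fin m)
    (h : b ∉ Set.range e) : permExt e s b = b :=
  Equiv.Perm.viaEmbedding_apply_of_notMem s e.toEmbedding b h

theorem permExt_symm {n m : ℕ} (e : Fin n ↪o Fin m) (s : Equiv.Perm (Fin n)) :
    (permExt e s).symm = permExt e s.symm := (map_inv (permExt e) s).symm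

theorem inversions_ext {n m : ℕ} (e : Fin n ↪o Fin m) (s : Equiv.Perm (Fin n))
    (x : Fin n → ZMod 2) : inversions (permExt e s) (ext e 0 x) = inversions s x := by
  unfold inversions
  rw [sum_ext_aux e]
  · refine Finset.sum_congr rfl fun i _ => ?_
    rw [sum_ext_aux e]
    · simp [ext_apply, permExt_apply]
    · intro b hb; simp [ext_apply' e 0 x b hb]
  · intro b hb; simp [ext_apply' e 0 x b hb]

theorem ext_comp {α : Type*} {n m : ℕ} (e : Fin n ↪o Fin m) (d : α) (f : Fin n → α)
    (s : Equiv.Perm (Fin n)) : ext e d f ∘ (permExt e s).symm = ext e d (f ∘ s.symm) := by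
  funext b
  rw [permExt_symm]
  by_cases hb : b ∈ Set.range e
  · obtain ⟨i, rfl⟩ := hb
    simp [permExt_apply, ext_apply]
  · simp [permExt_apply' e _ b hb, ext_apply' e d _ b hb]

theorem ext_mul {n m : ℕ} (e : Fin n ↪o Fin m) (f g : Fin n → Γ) :
    ext e 1 (f * g) = ext e 1 f * ext e 1 g := by
  funext b
  by_cases hb : b ∈ Set.range e
  · obtain ⟨i, rfl⟩ := hb
    simp [ext_apply]
  · simp [ext_apply' e _ _ b hb]

theorem ext_add {n m : ℕ} (e : Fin n ↪o Fin m) (f g : Fin n → ZMod 2) :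
    ext e 0 (f + g) = ext e 0 f + ext e 0 g := by
  funext b
  by_cases hb : b ∈ Set.range e
  · obtain ⟨i, rfl⟩ := hb
    simp [ext_apply]
  · simp [ext_apply' e _ _ b hb]

/-- The homomorphism `Γ̃_n → Γ̃_m` induced by an increasing map `e : {1..n} → {1..m}`:
`g` is put in the positions `e i`, `a_i ↦ a_{e i}`, `z ↦ z`, and `S_n` permutes the `e i`. -/
def embed {n m : ℕ} (e : Fin n ↪o Fin m) : SpinGroup Γ n →* SpinGroup Γ m :=
  MonoidHom.mk'
    (fun x => ⟨(ext e 1 x.left.1, ⟨x.left.2.sgn, ext e 0 x.left.2.vec⟩), permExt e x.right⟩)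
    (fun x y => by
      ext1
      · simp [ext_mul, ext_comp]
      · simp [ext_comp, bil_ext, inversions_ext]
      · simp [ext_add, ext_comp]
      · simp)

theorem embed_zElt {n m : ℕ} (e : Fin n ↪o Fin m) : embed e (zElt n : SpinGroup Γ n) = zElt m := by
  ext1
  · funext b
    change ext e 1 (1 : Fin n → Γ) b = 1
    by_cases hb : b ∈ Set.range e
    · obtain ⟨i, rfl⟩ := hb
      simp [ext_apply]
    · simp [ext_apply' e _ _ b hb]
  · rfl
  · funext b
    change ext e 0 (0 : Fin n → ZMod 2) b = 0
    by_cases hb : b ∈ Set.range e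
    · obtain ⟨i, rfl⟩ := hb
      simp [ext_apply]
    · simp [ext_apply' e _ _ b hb]
  · exact map_one (permExt e)

theorem parity_embed {n m : ℕ} (e : Fin n ↪o Fin m) (x : SpinGroup Γ n) :
    parity (embed e x) = parity x := by
  change ∑ b, ext e 0 x.left.2.vec b = _
  rw [sum_ext_aux e _ fun b hb => ext_apply' e _ _ b hb]
  simp [ext_apply, parity]

/-- The inclusion of the first `l` indices in `m = l + p` indices. -/
def leftIdx {l p m : ℕ} (h : l + p = m) : Fin l ↪o Fin m := Fin.castLEOrderEmb (by omega)

/-- The inclusion of the last `p` indices in `m = l + p` indices. -/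
def rightIdx {l p m : ℕ} (h : l + p = m) : Fin p ↪o Fin m :=
  (Fin.natAddOrderEmb l).trans (Fin.castOrderIso h).toOrderEmbedding

theorem leftIdx_lt_rightIdx {l p m : ℕ} (h : l + p = m) (i : Fin l) (j : Fin p) :
    leftIdx h i < rightIdx h j := by
  simp only [leftIdx, rightIdx, Fin.lt_def]
  simp
  omega

/-- The embedding `Γ̃_l → Γ̃_m`, `m = l + p`, on the first `l` indices. -/
def embL {l p m : ℕ} (h : l + p = m) : SpinGroup Γ l →* SpinGroup Γ m := embed (leftIdx h)

/-- The embedding `Γ̃_p → Γ̃_m`, `m = l + p`, on the last `p` indices. -/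
def embR {l p m : ℕ} (h : l + p = m) : SpinGroup Γ p →* SpinGroup Γ m := embed (rightIdx h)

theorem inversions_disjoint {l p m : ℕ} (d : Fin l ↪o Fin m) (e : Fin p ↪o Fin m)
    (hd : ∀ i j, d i ≠ e j) (s : Equiv.Perm (Fin l)) (x : Fin p → ZMod 2) :
    inversions (permExt d s) (ext e 0 x) = 0 := by
  have hn : ∀ j, e j ∉ Set.range d := fun j ⟨i, hi⟩ => hd i j hi
  unfold inversions
  rw [sum_ext_aux e]
  · refine Finset.sum_eq_zero fun i _ => ?_
    rw [sum_ext_aux e]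
    · refine Finset.sum_eq_zero fun j _ => ?_
      rw [permExt_apply' d s _ (hn i), permExt_apply' d s _ (hn j), if_neg]
      rintro ⟨h, h'⟩
      exact lt_asymm h h'
    · intro b hb; simp [ext_apply' e 0 x b hb]
  · intro b hb; simp [ext_apply' e 0 x b hb]

theorem ext_comp_disjoint {α : Type*} {l p m : ℕ} (d : Fin l ↪o Fin m) (e : Fin p ↪o Fin m)
    (hd : ∀ i j, d i ≠ e j) (s : Equiv.Perm (Fin l)) (c : α) (x : Fin p → α) :
    ext e c x ∘ (permExt d s).symm = ext e c x := by
  funext b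
  rw [permExt_symm]
  by_cases hb : b ∈ Set.range d
  · obtain ⟨i, rfl⟩ := hb
    have hn : ∀ i, d i ∉ Set.range e := fun i ⟨j, hj⟩ => hd i j hj.symm
    simp [permExt_apply, ext_apply' e _ _ _ (hn _)]
  · simp [permExt_apply' d _ b hb]

theorem bil_lt {l p m : ℕ} (d : Fin l ↪o Fin m) (e : Fin p ↪o Fin m) (hd : ∀ i j, d i < e j)
    (x : Fin l → ZMod 2) (y : Fin p → ZMod 2) :
    bil (cliffMatrix m) (ext d 0 x) (ext e 0 y) = 0 := by
  unfold bil
  rw [sum_ext_aux d]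
  · refine Finset.sum_eq_zero fun i _ => ?_
    rw [sum_ext_aux e]
    · refine Finset.sum_eq_zero fun j _ => ?_
      simp [cliffMatrix, (hd i j).not_ge]
    · intro b hb; simp [ext_apply' e 0 y b hb]
  · intro b hb; simp [ext_apply' d 0 x b hb]

theorem bil_gt {l p m : ℕ} (d : Fin l ↪o Fin m) (e : Fin p ↪o Fin m) (hd : ∀ i j, d i < e j)
    (x : Fin l → ZMod 2) (y : Fin p → ZMod 2) :
    bil (cliffMatrix m) (ext e 0 y) (ext d 0 x) = (∑ i, x i) * ∑ j, y j := by
  unfold bil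
  rw [sum_ext_aux e]
  · rw [mul_comm, Finset.sum_mul]
    refine Finset.sum_congr rfl fun j _ => ?_
    rw [sum_ext_aux d]
    · rw [Finset.mul_sum]
      refine Finset.sum_congr rfl fun i _ => ?_
      simp [cliffMatrix, (hd i j).le, ext_apply]
    · intro b hb; simp [ext_apply' d 0 x b hb]
  · intro b hb; simp [ext_apply' e 0 y b hb]

theorem permExt_commute {l p m : ℕ} (d : Fin l ↪o Fin m) (e : Fin p ↪o Fin m)
    (hd : ∀ i j, d i ≠ e j) (s : Equiv.Perm (Fin l)) (t : Equiv.Perm (Fin p)) :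
    permExt d s * permExt e t = permExt e t * permExt d s := by
  have h1 : ∀ j, e j ∉ Set.range d := fun j ⟨i, hi⟩ => hd i j hi
  have h2 : ∀ i, d i ∉ Set.range e := fun i ⟨j, hj⟩ => hd i j hj.symm
  refine Equiv.ext fun b => ?_
  by_cases hb : b ∈ Set.range d
  · obtain ⟨i, rfl⟩ := hb
    simp [permExt_apply, permExt_apply' e t _ (h2 _)]
  · by_cases hb' : b ∈ Set.range e
    · obtain ⟨j, rfl⟩ := hb'
      simp [permExt_apply, permExt_apply' d s _ (h1 _)]
    · simp [permExt_apply' d s b hb, permExt_apply' e t b hb']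

/-- Elements of the two factors commute up to the sign `z ^ (p(x) p(y))`; we only need the case
where one of them is even. -/
theorem embL_commute {l p m : ℕ} (h : l + p = m) (x : SpinGroup Γ l) (y : SpinGroup Γ p)
    (hx : parity x = 0) : embL h x * embR h y = embR h y * embL h x := by
  have hlt := leftIdx_lt_rightIdx h
  have hne : ∀ i j, leftIdx h i ≠ rightIdx h j := fun i j => (hlt i j).ne
  have hne' : ∀ j i, rightIdx h j ≠ leftIdx h i := fun j i => (hlt i j).ne'
  set d := leftIdx h
  set e := rightIdx h
  have hgx : ext e 1 y.left.1 ∘ (permExt d x.right).symm = ext e 1 y.left.1 :=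
    ext_comp_disjoint d e hne _ _ _
  have hgy : ext d 1 x.left.1 ∘ (permExt e y.right).symm = ext d 1 x.left.1 :=
    ext_comp_disjoint e d hne' _ _ _
  have hvx : ext e 0 y.left.2.vec ∘ (permExt d x.right).symm = ext e 0 y.left.2.vec :=
    ext_comp_disjoint d e hne _ _ _
  have hvy : ext d 0 x.left.2.vec ∘ (permExt e y.right).symm = ext d 0 x.left.2.vec :=
    ext_comp_disjoint e d hne' _ _ _
  ext1
  · change ext d 1 x.left.1 * (ext e 1 y.left.1 ∘ (permExt d x.right).symm)
      = ext e 1 y.left.1 * (ext d 1 x.left.1 ∘ (permExt e y.right).symm)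
    rw [hgx, hgy]
    funext b
    by_cases hb : b ∈ Set.range d
    · have hb' : b ∉ Set.range e := by
        obtain ⟨i, rfl⟩ := hb
        rintro ⟨j, hj⟩
        exact hne i j hj.symm
      simp [ext_apply' e _ _ b hb']
    · simp [ext_apply' d _ _ b hb]
  · change x.left.2.sgn + (y.left.2.sgn + inversions (permExt d x.right) (ext e 0 y.left.2.vec))
        + bil (cliffMatrix m) (ext d 0 x.left.2.vec)
          (ext e 0 y.left.2.vec ∘ (permExt d x.right).symm)
      = y.left.2.sgn + (x.left.2.sgn + inversions (permExt e y.right) (ext d 0 x.left.2.vec))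
        + bil (cliffMatrix m) (ext e 0 y.left.2.vec)
          (ext d 0 x.left.2.vec ∘ (permExt e y.right).symm)
    rw [hvx, hvy, inversions_disjoint d e hne, inversions_disjoint e d hne', bil_lt d e hlt,
      bil_gt d e hlt, show ∑ i, x.left.2.vec i = 0 from hx]
    ring
  · change ext d 0 x.left.2.vec + (ext e 0 y.left.2.vec ∘ (permExt d x.right).symm)
      = ext e 0 y.left.2.vec + (ext d 0 x.left.2.vec ∘ (permExt e y.right).symm)
    rw [hvx, hvy, add_comm]
  · exact permExt_commute d e hne _ _

/-! ### Spin super class functions, induction and restriction -/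

variable (Γ) in
/-- The space `R⁻(Γ̃_n)` of spin super class functions on `Γ̃_n`: class functions `f` with
`f (z x) = - f x` which vanish on odd elements. -/
def SpinFun (n : ℕ) : Submodule ℂ (SpinGroup Γ n → ℂ) where
  carrier := {f | (∀ x y, f (y * x * y⁻¹) = f x) ∧ (∀ x, f (zElt n * x) = - f x) ∧
    ∀ x, parity x = 1 → f x = 0}
  add_mem' := by
    rintro f g ⟨hf1, hf2, hf3⟩ ⟨hg1, hg2, hg3⟩
    refine ⟨fun x y => ?_, fun x => ?_, fun x hx => ?_⟩
    · simp [hf1, hg1]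
    · simp [hf2, hg2]; ring
    · simp [hf3 x hx, hg3 x hx]
  zero_mem' := ⟨fun x y => rfl, fun x => by simp, fun x _ => rfl⟩
  smul_mem' := by
    rintro c f ⟨hf1, hf2, hf3⟩
    refine ⟨fun x y => ?_, fun x => ?_, fun x hx => ?_⟩
    · simp [hf1]
    · simp [hf2]
    · simp [hf3 x hx]

/-- The spin product `Γ̃_l ×̂ Γ̃_p`, as a subgroup of `Γ̃_m`, `m = l + p`. -/
def spinProd {l p m : ℕ} (h : l + p = m) : Subgroup (SpinGroup Γ m) :=
  (embL h).range ⊔ (embR h).range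

open Classical in
/-- Induction of a function `F` from a subgroup `H` of a finite group `G`. -/
def induced {G : Type*} [Group G] [Fintype G] (H : Subgroup G) (F : G → ℂ) (x : G) : ℂ :=
  (Nat.card H : ℂ)⁻¹ * ∑ y : G, if y * x * y⁻¹ ∈ H then F (y * x * y⁻¹) else 0

theorem parity_conj {n : ℕ} (x y : SpinGroup Γ n) : parity (y * x * y⁻¹) = parity x := by
  rw [parity_mul, parity_mul, parity_inv]
  linear_combination zmod2_add_self (parity y)

theorem zmod2_cases (a : ZMod 2) : a = 0 ∨ a = 1 := by
  revert a; decide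

theorem zElt_mul_mem {l p m : ℕ} (h : l + p = m) (x : SpinGroup Γ m) :
    zElt m * x ∈ spinProd h ↔ x ∈ spinProd h := by
  have hz : zElt m ∈ (spinProd h : Subgroup (SpinGroup Γ m)) :=
    Subgroup.mem_sup_left ⟨zElt l, embed_zElt _⟩
  exact Subgroup.mul_mem_cancel_left _ hz

section Fintype

variable [Fintype Γ]

open Classical in
/-- The outer tensor product of (spin) functions on `Γ̃_l` and `Γ̃_p`: the function
`(t, s) ↦ f t * g s` on `Γ̃_l ×̂ Γ̃_p`.  Each element of the spin product is the image of exactly two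
pairs `(t, s)`, `(z t, z s)`, and the value is the average over the two. -/
def outerTensor {l p m : ℕ} (h : l + p = m) (f : SpinGroup Γ l → ℂ) (g : SpinGroup Γ p → ℂ)
    (w : SpinGroup Γ m) : ℂ :=
  (2 : ℂ)⁻¹ * ∑ t, ∑ s, if embL h t * embR h s = w then f t * g s else 0

/-- `Ind (f ⊗ g)`, the induction from `Γ̃_l ×̂ Γ̃_p` to `Γ̃_m`, `m = l + p`, of an outer tensor
product. -/
def indProd {l p m : ℕ} (h : l + p = m) (f : SpinGroup Γ l → ℂ) (g : SpinGroup Γ p → ℂ) :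
    SpinGroup Γ m → ℂ :=
  induced (spinProd h) (outerTensor h f g)

theorem outerTensor_zElt {l p m : ℕ} (h : l + p = m) (f : SpinGroup Γ l → ℂ)
    (g : SpinGroup Γ p → ℂ) (hg : ∀ s, g (zElt p * s) = - g s) (w : SpinGroup Γ m) :
    outerTensor h f g (zElt m * w) = - outerTensor h f g w := by
  classical
  unfold outerTensor
  rw [← mul_neg, ← Finset.sum_neg_distrib]
  congr 1
  refine Finset.sum_congr rfl fun t _ => ?_
  rw [← Finset.sum_neg_distrib, ← Equiv.sum_comp (Equiv.mulLeft (zElt p))]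
  refine Finset.sum_congr rfl fun s _ => ?_
  have hz : embR h (zElt p : SpinGroup Γ p) = zElt m := embed_zElt _
  have key : embL h t * embR h (zElt p * s) = zElt m * w ↔ embL h t * embR h s = w := by
    rw [map_mul, hz, ← mul_assoc, ← zElt_mul_comm, mul_assoc, mul_right_inj]
  simp only [Equiv.coe_mulLeft, key, hg]
  split_ifs <;> simp

theorem outerTensor_odd {l p m : ℕ} (h : l + p = m) (f : SpinGroup Γ l → ℂ)
    (g : SpinGroup Γ p → ℂ) (hf : ∀ t, parity t = 1 → f t = 0) (hg : ∀ s, parity s = 1 → g s = 0)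
    (w : SpinGroup Γ m) (hw : parity w = 1) : outerTensor h f g w = 0 := by
  classical
  unfold outerTensor
  rw [mul_eq_zero]
  right
  refine Finset.sum_eq_zero fun t _ => Finset.sum_eq_zero fun s _ => ?_
  split_ifs with hts
  · have hp : parity t + parity s = 1 := by
      rw [← hw, ← hts, parity_mul, embL, embR, parity_embed, parity_embed]
    rcases zmod2_cases (parity t) with h0 | h1
    · rw [hg s (by simpa [h0] using hp), mul_zero]
    · rw [hf t h1, zero_mul]
  · rfl

theorem indProd_odd {l p m : ℕ} (h : l + p = m) (f : SpinGroup Γ l → ℂ)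
    (g : SpinGroup Γ p → ℂ) (hf : ∀ t, parity t = 1 → f t = 0) (hg : ∀ s, parity s = 1 → g s = 0)
    (w : SpinGroup Γ m) (hw : parity w = 1) : indProd h f g w = 0 := by
  unfold indProd induced
  rw [mul_eq_zero]
  right
  refine Finset.sum_eq_zero fun y _ => ?_
  rw [outerTensor_odd h f g hf hg _ (by rw [parity_conj, hw]), ite_self]

theorem indProd_mem {l p m : ℕ} (h : l + p = m) (f : SpinGroup Γ l → ℂ)
    (hf : ∀ t, parity t = 1 → f t = 0) (g : SpinFun Γ p) :
    indProd h f g ∈ SpinFun Γ m := by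
  refine ⟨fun x u => ?_, fun x => ?_, fun x hx => indProd_odd h f g hf g.2.2.2 x hx⟩
  · unfold indProd induced
    congr 1
    refine Fintype.sum_equiv (Equiv.mulRight u) _ _ fun y => ?_
    have e : y * (u * x * u⁻¹) * y⁻¹ = y * u * x * (y * u)⁻¹ := by
      simp only [mul_inv_rev, mul_assoc]
    rw [e]
    rfl
  · unfold indProd induced
    rw [← mul_neg, ← Finset.sum_neg_distrib]
    congr 1
    refine Finset.sum_congr rfl fun y _ => ?_
    have e : y * (zElt m * x) * y⁻¹ = zElt m * (y * x * y⁻¹) := by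
      rw [← mul_assoc, ← zElt_mul_comm]; simp only [mul_assoc]
    have hz := zElt_mul_mem h (y * x * y⁻¹)
    rw [e, outerTensor_zElt h f g g.2.2.1]
    by_cases hm : y * x * y⁻¹ ∈ spinProd h
    · rw [if_pos hm, if_pos (hz.mpr hm)]
    · rw [if_neg hm, if_neg (fun hh => hm (hz.mp hh)), neg_zero]

/-- For `χ ∈ R⁻(Γ̃_l)` and `f ∈ R⁻(Γ̃_m)`, `m = l + p`: restrict `f` to `Γ̃_l ×̂ Γ̃_p` and pair the
first tensor factor with `χ` by the standard form
`⟨χ, u⟩ = |Γ̃_l|⁻¹ ∑_x χ (x) u (x⁻¹)`, which is the weighted form for the trivial weight. -/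
def resPair {l p m : ℕ} (h : l + p = m) (χ : SpinGroup Γ l → ℂ) (f : SpinGroup Γ m → ℂ)
    (y : SpinGroup Γ p) : ℂ :=
  (Fintype.card (SpinGroup Γ l) : ℂ)⁻¹ * ∑ x, χ x * f (embL h x⁻¹ * embR h y)

theorem resPair_mem {l p m : ℕ} (h : l + p = m) (χ : SpinGroup Γ l → ℂ)
    (hχ : ∀ t, parity t = 1 → χ t = 0) (f : SpinFun Γ m) :
    resPair h χ f ∈ SpinFun Γ p := by
  obtain ⟨f, hf1, hf2, hf3⟩ := f
  refine ⟨fun y w => ?_, fun y => ?_, fun y hy => ?_⟩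
  · unfold resPair
    congr 1
    refine Finset.sum_congr rfl fun x _ => ?_
    rcases zmod2_cases (parity x) with h0 | h1
    · congr 1
      have hc := embL_commute h x⁻¹ w (by rw [parity_inv, h0])
      have e : embL h x⁻¹ * embR h (w * y * w⁻¹)
          = embR h w * (embL h x⁻¹ * embR h y) * (embR h w)⁻¹ := by
        rw [map_mul, map_mul, map_inv (embR (Γ := Γ) h), ← mul_assoc, ← mul_assoc, hc]
        simp only [mul_assoc]
      change f _ = f _
      rw [e, hf1]
    · rw [hχ x h1, zero_mul, zero_mul]
  · unfold resPair
    rw [← mul_neg, ← Finset.sum_neg_distrib]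
    congr 1
    refine Finset.sum_congr rfl fun x _ => ?_
    have hz : embR h (zElt p : SpinGroup Γ p) = zElt m := embed_zElt _
    have e : embL h x⁻¹ * embR h (zElt p * y) = zElt m * (embL h x⁻¹ * embR h y) := by
      rw [map_mul, hz, ← mul_assoc, ← zElt_mul_comm, mul_assoc]
    change χ x * f _ = -(χ x * f _)
    rw [e, hf2, mul_neg]
  · unfold resPair
    rw [mul_eq_zero]
    right
    refine Finset.sum_eq_zero fun x _ => ?_
    rcases zmod2_cases (parity x) with h0 | h1
    · have : f (embL h x⁻¹ * embR h y) = 0 := by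
        apply hf3
        rw [parity_mul, embL, embR, parity_embed, parity_embed, parity_inv, h0, hy, zero_add]
      change χ x * f _ = 0
      rw [this, mul_zero]
    · rw [hχ x h1, zero_mul]

end Fintype

/-! ### The basic spin characters -/

variable (Γ) in
/-- A complete list `γ_0, …, γ_r` of the irreducible complex representations of `Γ` up to
isomorphism, with `γ_0` trivial. -/
structure IrrepList (r : ℕ) where
  dim : Fin (r + 1) → ℕ
  rep : ∀ i, Representation ℂ Γ (Fin (dim i) → ℂ)
  irreducible : ∀ i, (rep i).IsIrreducible
  distinct : ∀ i j, i ≠ j → IsEmpty ((rep i).Equiv (rep j))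
  complete : ∀ (d : ℕ) (σ : Representation ℂ Γ (Fin d → ℂ)), σ.IsIrreducible →
    ∃ i, Nonempty (σ.Equiv (rep i))
  dim_zero : dim 0 = 1
  rep_zero : ∀ g, rep 0 g = LinearMap.id

namespace IrrepList

variable {r : ℕ} (I : IrrepList Γ r)

/-- The space of the representation `⨁_i β_i γ_i`. -/
abbrev SumSpace (β : Fin (r + 1) → ℕ) : Type := ∀ i, Fin (β i) → Fin (I.dim i) → ℂ

/-- The representation `⨁_i β_i γ_i` of `Γ`. -/
def sumRep (β : Fin (r + 1) → ℕ) (g : Γ) : I.SumSpace β →ₗ[ℂ] I.SumSpace β :=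
  LinearMap.piMap fun i => LinearMap.piMap fun _ => I.rep i g

/-- The action of `(g, s) ∈ Γ^n ⋊ S_n` on `V^{⊗ n}`:
`v_1 ⊗ ⋯ ⊗ v_n ↦ g_1 v_{s⁻¹ 1} ⊗ ⋯ ⊗ g_n v_{s⁻¹ n}`, where `V = ⨁_i β_i γ_i`. -/
def tensorOp (β : Fin (r + 1) → ℕ) {n : ℕ} (g : Fin n → Γ) (s : Equiv.Perm (Fin n)) :
    (⨂[ℂ] _ : Fin n, I.SumSpace β) →ₗ[ℂ] (⨂[ℂ] _ : Fin n, I.SumSpace β) :=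
  PiTensorProduct.map (fun i => I.sumRep β (g i)) ∘ₗ
    (PiTensorProduct.reindex ℂ (fun _ : Fin n => I.SumSpace β) s).toLinearMap

end IrrepList

/-- The quadratic form of the Clifford algebra `L_n`, for which `e_i ^ 2 = -1`. -/
def cliffForm (n : ℕ) : QuadraticForm ℂ (Fin n → ℂ) :=
  QuadraticMap.weightedSumSquares ℂ fun _ : Fin n => (-1 : ℂ)

/-- The Clifford algebra `L_n` on `e_1, …, e_n` with `e_i e_j + e_j e_i = -2 δ_ij`. -/
abbrev Cliff (n : ℕ) : Type := CliffordAlgebra (cliffForm n)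

/-- The generator `e_i` of the Clifford algebra. -/
def cliffGen {n : ℕ} (i : Fin n) : Cliff n := CliffordAlgebra.ι (cliffForm n) (Pi.single i 1)

/-- The product `e_I` of the `e_i`, `i ∈ I`, in increasing order. -/
def cliffMon {n : ℕ} (x : Fin n → ZMod 2) : Cliff n :=
  ((List.finRange n).map fun i => if x i = 1 then cliffGen i else 1).prod

/-- The isometry of `ℂ^n` permuting the standard basis by `s`. -/
def permIsometry {n : ℕ} (s : Equiv.Perm (Fin n)) : (cliffForm n).Isometry (cliffForm n) where
  toLinearMap := LinearMap.funLeft ℂ ℂ s.symm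
  map_app' v := by
    simp only [cliffForm, QuadraticMap.weightedSumSquares_apply]
    exact Equiv.sum_comp s.symm fun i => (-1 : ℂ) • (v i * v i)

/-- The action of `z ^ k a_I s` on `L_n`: `z` acts by `-1`, `a_I` by left multiplication by `e_I`,
and `s` by the algebra automorphism `e_i ↦ e_{s i}`. -/
def cliffOp {n : ℕ} (k : ZMod 2) (x : Fin n → ZMod 2) (s : Equiv.Perm (Fin n)) :
    Cliff n →ₗ[ℂ] Cliff n :=
  (-1 : ℂ) ^ k.val •
    (LinearMap.mulLeft ℂ (cliffMon x) ∘ₗ (CliffordAlgebra.map (permIsometry s)).toLinearMap)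

/-- The grading involution of the Clifford algebra. -/
def cliffInv (n : ℕ) : Cliff n →ₗ[ℂ] Cliff n := CliffordAlgebra.involute.toLinearMap

theorem cliffInv_sq (n : ℕ) : cliffInv n ∘ₗ cliffInv n = LinearMap.id :=
  LinearMap.ext fun x => CliffordAlgebra.involute_involute x

theorem list_prod_involute {n : ℕ} (x : Fin n → ZMod 2) (L : List (Fin n)) :
    CliffordAlgebra.involute (L.map fun i => if x i = 1 then cliffGen i else 1).prod =
      (-1 : ℂ) ^ (L.map x).sum.val • (L.map fun i => if x i = 1 then cliffGen i else 1).prod := by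
  induction L with
  | nil => simp
  | cons a L ih =>
    simp only [List.map_cons, List.prod_cons, List.sum_cons, map_mul, ih]
    rcases zmod2_cases (x a) with h | h
    · simp [h]
    · have h2 : (-1 : ℂ) ^ (1 + (L.map x).sum).val = - (-1 : ℂ) ^ ((L.map x).sum).val := by
        rcases zmod2_cases (L.map x).sum with h' | h' <;> rw [h']
        · simp [ZMod.val_one]
        · simp [ZMod.val_one]; rfl
      rw [if_pos h, h, h2]
      simp [cliffGen]

theorem cliffOp_odd {n : ℕ} (k : ZMod 2) (x : Fin n → ZMod 2) (s : Equiv.Perm (Fin n))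
    (hx : ∑ i, x i = 1) :
    cliffInv n ∘ₗ cliffOp k x s = (-1 : ℂ) • (cliffOp k x s ∘ₗ cliffInv n) := by
  have h1 : CliffordAlgebra.involute (cliffMon x) = - cliffMon x := by
    have := list_prod_involute x (List.finRange n)
    rw [show ((List.finRange n).map x).sum = 1 by rw [← hx, Fin.sum_univ_def]] at this
    simpa [cliffMon, ZMod.val_one] using this
  have h2 : (CliffordAlgebra.involute : Cliff n →ₐ[ℂ] Cliff n).comp
      (CliffordAlgebra.map (permIsometry s))
      = (CliffordAlgebra.map (permIsometry s)).comp CliffordAlgebra.involute := by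
    ext v; simp
  refine LinearMap.ext fun v => ?_
  have h3 := DFunLike.congr_fun h2 v
  simp only [AlgHom.comp_apply] at h3
  simp [cliffInv, cliffOp, h1, h3]

variable {r : ℕ} (I : IrrepList Γ r)

/-- The character of the basic spin supermodule `V^{⊗ n} ⊗ L_n` of `Γ̃_n`, `V = ⨁_i β_i γ_i`. -/
def basicChar (β : Fin (r + 1) → ℕ) (n : ℕ) (x : SpinGroup Γ n) : ℂ :=
  LinearMap.trace ℂ ((⨂[ℂ] _ : Fin n, I.SumSpace β) ⊗[ℂ] Cliff n)
    (TensorProduct.map (I.tensorOp β x.left.1 x.right)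
      (cliffOp x.left.2.sgn x.left.2.vec x.right))

theorem basicChar_odd (β : Fin (r + 1) → ℕ) (n : ℕ) (x : SpinGroup Γ n) (hx : parity x = 1) :
    basicChar I β n x = 0 := by
  set A := I.tensorOp β x.left.1 x.right
  set C := cliffOp x.left.2.sgn x.left.2.vec x.right
  let J : ((⨂[ℂ] _ : Fin n, I.SumSpace β) ⊗[ℂ] Cliff n) →ₗ[ℂ]
      ((⨂[ℂ] _ : Fin n, I.SumSpace β) ⊗[ℂ] Cliff n) := TensorProduct.map LinearMap.id (cliffInv n)
  have hJ : J * J = 1 := by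
    change J ∘ₗ J = LinearMap.id
    rw [← TensorProduct.map_comp, cliffInv_sq, LinearMap.id_comp, TensorProduct.map_id]
  have hA : J * TensorProduct.map A C = (-1 : ℂ) • (TensorProduct.map A C * J) := by
    change J ∘ₗ _ = (-1 : ℂ) • (_ ∘ₗ J)
    rw [← TensorProduct.map_comp, ← TensorProduct.map_comp, cliffOp_odd _ _ _ hx,
      LinearMap.id_comp, LinearMap.comp_id, TensorProduct.map_smul_right]
  have h1 : LinearMap.trace ℂ _ (TensorProduct.map A C)
      = - LinearMap.trace ℂ _ (TensorProduct.map A C) := by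
    conv_lhs => rw [← mul_one (TensorProduct.map A C), ← hJ, ← mul_assoc,
      LinearMap.trace_mul_comm, ← mul_assoc, hA, smul_mul_assoc, mul_assoc, hJ, mul_one, map_smul]
    simp
  exact self_eq_neg.mp h1

section Fintype

variable [Fintype Γ]

/-- The spin character `χ_n(α)` for a virtual character `α = ∑_i α_i γ_i`, `α_i ∈ ℤ`:
with `α = β - δ` the difference of the positive and the negative part of `α`,
`χ_n(β - δ) = ∑_m (-1)^m Ind (χ_{n-m}(β) ⊗ χ_m(δ))`. -/
def spinChar (α : Fin (r + 1) → ℤ) (n : ℕ) (x : SpinGroup Γ n) : ℂ :=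
  ∑ m : Fin (n + 1), (-1 : ℂ) ^ (m : ℕ) *
    indProd (l := n - m) (p := m) (m := n) (by omega)
      (basicChar I (fun i => (α i).toNat) (n - m)) (basicChar I (fun i => (-α i).toNat) m) x

theorem spinChar_odd (α : Fin (r + 1) → ℤ) (n : ℕ) (x : SpinGroup Γ n) (hx : parity x = 1) :
    spinChar I α n x = 0 :=
  Finset.sum_eq_zero fun m _ => by
    rw [indProd_odd _ _ _ (basicChar_odd I _ _) (basicChar_odd I _ _) x hx, mul_zero]

/-! ### The operators `H_{±n}(γ)` -/

/-- `f ↦ Ind (χ_l(α) ⊗ f)` from `R⁻(Γ̃_p)` to `R⁻(Γ̃_m)`, `m = l + p`. -/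
def createComp (α : Fin (r + 1) → ℤ) {l p m : ℕ} (h : l + p = m) :
    SpinFun Γ p →ₗ[ℂ] SpinFun Γ m where
  toFun f := ⟨indProd h (spinChar I α l) f, indProd_mem h _ (spinChar_odd I α l) f⟩
  map_add' f g := by
    classical
    refine Subtype.ext (funext fun x => ?_)
    change indProd h (spinChar I α l) (f + g : SpinFun Γ p) x
      = indProd h (spinChar I α l) f x + indProd h (spinChar I α l) g x
    simp only [indProd, induced, ← mul_add, ← Finset.sum_add_distrib]
    congr 1
    refine Finset.sum_congr rfl fun y _ => ?_
    split_ifs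
    · simp only [outerTensor, ← mul_add, ← Finset.sum_add_distrib]
      congr 1
      refine Finset.sum_congr rfl fun t _ => Finset.sum_congr rfl fun s _ => ?_
      split_ifs
      · simp [mul_add]
      · simp
    · simp
  map_smul' c f := by
    classical
    refine Subtype.ext (funext fun x => ?_)
    change indProd h (spinChar I α l) (c • f : SpinFun Γ p) x
      = c * indProd h (spinChar I α l) f x
    simp only [indProd, induced, mul_left_comm c]
    congr 1
    rw [Finset.mul_sum]
    refine Finset.sum_congr rfl fun y _ => ?_
    split_ifs
    · simp only [outerTensor, mul_left_comm c]
      congr 1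
      simp only [Finset.mul_sum]
      refine Finset.sum_congr rfl fun t _ => Finset.sum_congr rfl fun s _ => ?_
      split_ifs
      · simp [mul_left_comm]
      · simp
    · simp

/-- `f ↦ ⟨χ_l(α), Res f⟩` from `R⁻(Γ̃_m)` to `R⁻(Γ̃_p)`, `m = l + p`. -/
def annihComp (α : Fin (r + 1) → ℤ) {l p m : ℕ} (h : l + p = m) :
    SpinFun Γ m →ₗ[ℂ] SpinFun Γ p where
  toFun f := ⟨resPair h (spinChar I α l) f, resPair_mem h _ (spinChar_odd I α l) f⟩
  map_add' f g := by
    refine Subtype.ext (funext fun y => ?_)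
    change resPair h (spinChar I α l) (f + g : SpinFun Γ m) y
      = resPair h (spinChar I α l) f y + resPair h (spinChar I α l) g y
    simp [resPair, mul_add, Finset.sum_add_distrib]
  map_smul' c f := by
    refine Subtype.ext (funext fun y => ?_)
    change resPair h (spinChar I α l) (c • f : SpinFun Γ m) y
      = c * resPair h (spinChar I α l) f y
    simp [resPair, Finset.mul_sum, mul_left_comm]

variable (Γ) in
/-- The space `⨁_n R⁻(Γ̃_n)`. -/
abbrev FockR : Type _ := ⨁ n : ℕ, SpinFun Γ n

/-- The operator `H_{-n}(α)` on `⨁_n R⁻(Γ̃_n)`. -/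
def Hcreate (α : Fin (r + 1) → ℤ) (n : ℕ) : FockR Γ →ₗ[ℂ] FockR Γ :=
  DirectSum.toModule ℂ ℕ _ fun m =>
    DirectSum.lof ℂ ℕ (fun k => SpinFun Γ k) (n + m) ∘ₗ createComp I α (l := n) (p := m) rfl

/-- The operator `H_n(α)` on `⨁_n R⁻(Γ̃_n)`. -/
def Hannih (α : Fin (r + 1) → ℤ) (n : ℕ) : FockR Γ →ₗ[ℂ] FockR Γ :=
  DirectSum.toModule ℂ ℕ _ fun m =>
    if h : n ≤ m then
      DirectSum.lof ℂ ℕ (fun k => SpinFun Γ k) (m - n) ∘ₗ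
        annihComp I α (l := n) (p := m - n) (m := m) (by omega)
    else 0

/-- The coefficient of `z ^ (-n)` in
`H_+(α, z) H_-(α, -z) = (∑_{k ≥ 0} H_{-k}(α) z ^ k) (∑_{l ≥ 0} H_l(α) (-z) ^ (-l))`, that is
`∑_{l ≥ 0, l ≥ n} (-1) ^ l H_{-(l - n)}(α) H_l(α)`.  On `R⁻(Γ̃_m)` only `l ≤ m` contributes. -/
def Hcoeff (α : Fin (r + 1) → ℤ) (n : ℤ) : FockR Γ →ₗ[ℂ] FockR Γ :=
  DirectSum.toModule ℂ ℕ _ fun m =>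
    ∑ l ∈ Finset.range (m + 1),
      if n ≤ (l : ℤ) then
        (-1 : ℂ) ^ l • (Hcreate I α ((l : ℤ) - n).toNat ∘ₗ Hannih I α l ∘ₗ
          DirectSum.lof ℂ ℕ (fun k => SpinFun Γ k) m)
      else 0

/-! ### The lattice, its central extension, and the twisted vertex operators -/

/-- The bilinear form `⟨α, β⟩ = |Γ|⁻¹ ∑_x α(x) β(x⁻¹)` on the lattice
`R_ℤ(Γ) = ⨁_i ℤ γ_i = ℤ^{r+1}` of virtual characters. -/
def latticeForm (α β : Fin (r + 1) → ℤ) : ℂ :=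
  (Fintype.card Γ : ℂ)⁻¹ * ∑ x : Γ,
    (∑ i, (α i : ℂ) * (I.rep i).character x) * (∑ i, (β i : ℂ) * (I.rep i).character x⁻¹)

/-- The alternating form `c_1(α, β) = ⟨α, β⟩ + ⟨α, α⟩ ⟨β, β⟩ mod 2` vanishes on `Φ`. -/
def IsIsotropic (Φ : AddSubgroup (Fin (r + 1) → ℤ)) : Prop :=
  ∀ α ∈ Φ, ∀ β ∈ Φ, ∃ k : ℤ,
    latticeForm I α β + latticeForm I α α * latticeForm I β β = 2 * (k : ℂ)

end Fintype

/-- Exponents of the cocycle `ε(γ_i, γ_j) = 1` for `i ≤ j` and `ε(γ_i, γ_j) = -1` for `i > j`. -/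
def epsMatrix (r : ℕ) (i j : Fin (r + 1)) : ZMod 2 := if j < i then 1 else 0

/-- The central extension of `R_ℤ(Γ) / 2 R_ℤ(Γ) = 𝔽₂^{r+1}` by `⟨±1⟩` with the bimultiplicative
cocycle `ε`.  For the trivial weight the form `c_1` has the matrix `(1 - δ_ij)`, so that
`a b a⁻¹ b⁻¹ = (-1) ^ c_1(a, b)` in this group. -/
abbrev LatticeExt (r : ℕ) : Type := SignExt (epsMatrix r)

/-- The element `-1` of the central extension. -/
def negOneElt (r : ℕ) : LatticeExt r := ⟨1, 0⟩

/-- The element `e_α` of the central extension, depending on `α` modulo `2`. -/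
def eElt {r : ℕ} (α : Fin (r + 1) → ℤ) : LatticeExt r := ⟨0, fun i => (α i : ZMod 2)⟩

/-- The space `ℂ[R_ℤ(Γ) / Φ]`. -/
abbrev LatticeSpace {r : ℕ} (Φ : AddSubgroup (Fin (r + 1) → ℤ)) : Type :=
  AddMonoidAlgebra ℂ ((Fin (r + 1) → ℤ) ⧸ Φ)

variable [Fintype Γ]

/-- The component `X_n(α)` of the twisted vertex operator
`X(α, z) = H_+(α, z) H_-(α, -z) e_α = ∑_n X_n(α) z ^ (-n)`, acting on
`(⨁_n R⁻(Γ̃_n)) ⊗ ℂ[R_ℤ(Γ) / Φ]`, where `ρ` is the action of the central extension. -/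
def vertexOp {Φ : AddSubgroup (Fin (r + 1) → ℤ)}
    (ρ : Representation ℂ (LatticeExt r) (LatticeSpace Φ)) (α : Fin (r + 1) → ℤ) (n : ℤ) :
    Module.End ℂ (FockR Γ ⊗[ℂ] LatticeSpace Φ) :=
  TensorProduct.map (Hcoeff I α n) (ρ (eElt α))

/-- The anticommutator. -/
def anticomm {A : Type*} [Semiring A] (a b : A) : A := a * b + b * a

end SpinWreath

end

noncomputable section

namespace SpinWreath

/-! ### Families of functions on the wreath products `Γ^n ⋊ S_n` -/

/-! A spin class function is determined by its values on the elements of $\Gamma^n\rtimes S_n$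
(`spinFun_eq_zero`). Indeed, if the Clifford part of an element is $a_I$ and its permutation is $s$,
then either the indicator of $I$ has the form $u+s(u)$ over $\mathbb F_2$, and the element is
conjugate, up to $z$, to one with $I$ empty; or some $s$-stable set meets $I$ in an odd number of
indices, and the function vanishes there. All operator relations can therefore be checked on
functions of pairs $(g,s)$ (`fockWreath_injective`).

On such functions creation is a convolution: $\mathrm{Ind}(\chi\otimes f)(g,s)$ is the sum, over
$s$-stable sets $T$ of the right size, of $\chi$ on $T$ times $f$ on the complement
(`indProd_wElt`). As an $S_n$-module $L_n$ is an exterior algebra, with trace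
$\sum_T\mathrm{sgn}(s|_T)$. Moreover $L_n$ is induced from the line $\mathbb C\cdot1$, so by
Frobenius reciprocity pairing with $\chi_l(\gamma)$ is pairing with the character of $V^{\otimes l}$
alone over $\Gamma^l\rtimes S_l$ (`resPair_wElt`). The families involved are multiplicative for
disjoint unions of index sets (`WreathFun.IsMult`).

Write $C_k=H_{-k}(\gamma_i)$ and $D_l=H_l(\gamma_i)$. First, $\sum_{p+q=N}(-1)^pC_pC_q=0$ for $N>0$,
and likewise for $D$: the sum runs over stable sets $T$ with sign $(-1)^{|T|}$, and toggling one
orbit of odd length cancels it, while an orbit of even length makes the spin function itself vanish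
(`sum_conv_grade_grade`, `sum_annihWreath_annihWreath`). Secondly, with $C'_k=H_{-k}(\gamma_j)$, a
Mackey decomposition gives $D_lC'_k=\sum_a c_aC'_{k-a}D_{l-a}$, where
$c_a=\langle\chi_a(\gamma_i),\chi_a(\gamma_j)\rangle$ is $1$ for $a=0$ and $2\delta_{ij}$ for $a>0$
(`annihWreath_conv`, by Schur orthogonality and a count of invariants in the exterior algebra).

The rest is formal calculus. For $i=j$, normal ordering both products in the anticommutator gives
the two expansions of $(1+x)/(1-x)$, whose sum is twice the formal delta function; the quadratic
relations for $C$ and $D$ then leave a scalar (`modeSum_anticommutator`). For $i\ne j$ the Fock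
space factors commute and $e_{\gamma_i},e_{\gamma_j}$ anticommute. Finally
$\chi_n(-\gamma_i)=(-1)^n\chi_n(\gamma_i)$, so $X_n(-\gamma_i)=(-1)^nX_n(\gamma_i)$, and the
relations with minus signs follow. -/

/-- A family of functions on the sets `Γ^n × S_n`. -/
abbrev WreathFun (Γ : Type*) : Type _ := ∀ n : ℕ, (Fin n → Γ) → Equiv.Perm (Fin n) → ℂ

section WreathFun

variable {Γ : Type*} {A B : Type}

/-- Invariance under relabelling of the indices. -/
def WreathFun.IsClass (F : WreathFun Γ) : Prop :=
  ∀ n g s (π : Equiv.Perm (Fin n)), F n (g ∘ π.symm) (π * s * π⁻¹) = F n g s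

/-- A finite set is stable under a permutation. -/
def Stable (s : Equiv.Perm A) (S : Finset A) : Prop := ∀ a, s a ∈ S ↔ a ∈ S

theorem coe_subtypePerm {s : Equiv.Perm A} {S : Finset A} (h : Stable s S) (x : S) :
    ((s.subtypePerm h x : S) : A) = s x := rfl

open Classical in
/-- The value of `F` on the restriction of `(g, s)` to the set `S` of indices, and `0` if `S` is
not stable under `s`. -/
def evOn (F : WreathFun Γ) (g : A → Γ) (s : Equiv.Perm A) (S : Finset A) : ℂ :=
  if h : Stable s S then
    F S.card (fun i => g (S.equivFin.symm i)) (S.equivFin.permCongr (s.subtypePerm h))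
  else 0

theorem evOn_of_not_stable (F : WreathFun Γ) (g : A → Γ) (s : Equiv.Perm A) (S : Finset A)
    (h : ¬ Stable s S) : evOn F g s S = 0 := dif_neg h

theorem stable_of_range {n : ℕ} {s : Equiv.Perm A} {S : Finset A} (e : Fin n → A)
    (hS : ∀ a, a ∈ S ↔ ∃ i, e i = a) (s' : Equiv.Perm (Fin n)) (hs : ∀ i, e (s' i) = s (e i)) :
    Stable s S := by
  intro a
  rw [hS, hS]
  constructor
  · rintro ⟨i, hi⟩
    refine ⟨s'.symm i, s.injective ?_⟩
    rw [← hs, Equiv.apply_symm_apply, hi]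
  · rintro ⟨i, rfl⟩
    exact ⟨s' i, hs i⟩

/-- Class invariance removes the dependence of `evOn` on the arbitrary bijection `S.equivFin`, so
any enumeration `e` of `S` that intertwines `s'` with `s` may be used in its place. -/
theorem evOn_eq {F : WreathFun Γ} (hF : F.IsClass) {n : ℕ} {g : A → Γ} {s : Equiv.Perm A}
    {S : Finset A} (e : Fin n → A) (he : Function.Injective e) (hS : ∀ a, a ∈ S ↔ ∃ i, e i = a)
    (g' : Fin n → Γ) (hg : ∀ i, g' i = g (e i)) (s' : Equiv.Perm (Fin n))
    (hs : ∀ i, e (s' i) = s (e i)) : evOn F g s S = F n g' s' := by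
  have hst : Stable s S := stable_of_range e hS s' hs
  have hn : S.card = n := by
    classical
    have : S = Finset.univ.image e := by ext a; simp [hS]
    rw [this, Finset.card_image_of_injective _ he, Finset.card_univ, Fintype.card_fin]
  subst hn
  have hmem : ∀ i, e i ∈ S := fun i => (hS _).mpr ⟨i, rfl⟩
  -- `π` compares the enumeration `e` with the one built into `evOn`; invariance under `π`
  -- identifies the two values.
  let π : Equiv.Perm (Fin S.card) := Equiv.ofBijective (fun i => S.equivFin ⟨e i, hmem i⟩)
    (Finite.injective_iff_bijective.mp fun i j hij => he (by simpa using hij))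
  have hπ : ∀ i, (S.equivFin.symm (π i) : A) = e i := fun i => by
    change ((S.equivFin.symm (S.equivFin ⟨e i, hmem i⟩) : S) : A) = e i
    rw [Equiv.symm_apply_apply]
  rw [evOn, dif_pos hst, ← hF _ g' s' π]
  congr 1
  · funext i
    obtain ⟨j, rfl⟩ := π.surjective i
    simp [hπ, hg]
  · ext1 i
    obtain ⟨j, rfl⟩ := π.surjective i
    have h1 : (π * s' * π⁻¹) (π j) = π (s' j) := by simp
    rw [h1, Equiv.permCongr_apply, ← Equiv.eq_symm_apply]
    apply Subtype.ext
    rw [hπ, hs, coe_subtypePerm hst, hπ]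

theorem Stable.map_iff {s : Equiv.Perm A} {s' : Equiv.Perm B} {S : Finset B} (e : B ↪ A)
    (hs : ∀ b, e (s' b) = s (e b)) : Stable s (S.map e) ↔ Stable s' S := by
  constructor
  · intro h b
    have := h (e b)
    rw [← hs] at this
    simpa using this
  · intro h a
    simp only [Finset.mem_map]
    constructor
    · rintro ⟨b, hb, hab⟩
      refine ⟨s'.symm b, (h _).mp (by simpa using hb), s.injective ?_⟩
      rw [← hs, Equiv.apply_symm_apply, hab]
    · rintro ⟨b, hb, rfl⟩
      exact ⟨s' b, (h b).mpr hb, hs b⟩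

/-- Stability is transported along `e` too, so the default value 0 occurs on both sides together and
no stability has to be assumed. -/
theorem evOn_map {F : WreathFun Γ} (hF : F.IsClass) {g : A → Γ} {s : Equiv.Perm A}
    {g' : B → Γ} {s' : Equiv.Perm B} (S : Finset B) (e : B ↪ A)
    (hg : ∀ b, g' b = g (e b)) (hs : ∀ b, e (s' b) = s (e b)) :
    evOn F g s (S.map e) = evOn F g' s' S := by
  by_cases h : Stable s' S
  · conv_rhs => rw [evOn, dif_pos h]
    refine evOn_eq hF (fun i => e (S.equivFin.symm i)) ?_ ?_ _ ?_ _ ?_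
    · exact e.injective.comp (Subtype.val_injective.comp (Equiv.injective _))
    · intro a
      simp only [Finset.mem_map]
      constructor
      · rintro ⟨b, hb, rfl⟩
        exact ⟨S.equivFin ⟨b, hb⟩, by simp⟩
      · rintro ⟨i, rfl⟩
        exact ⟨_, (S.equivFin.symm i).2, rfl⟩
    · intro i; exact hg _
    · intro i; simp [hs, coe_subtypePerm]
  · rw [evOn_of_not_stable _ _ _ _ h, evOn_of_not_stable]
    rwa [Stable.map_iff e hs]

theorem evOn_univ {F : WreathFun Γ} (hF : F.IsClass) {n : ℕ} (g : Fin n → Γ)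
    (s : Equiv.Perm (Fin n)) : evOn F g s Finset.univ = F n g s :=
  evOn_eq hF id Function.injective_id (by simp) g (fun _ => rfl) s fun _ => rfl

theorem Stable.sdiff [DecidableEq A] {s : Equiv.Perm A} {S T : Finset A} (hS : Stable s S)
    (hT : Stable s T) : Stable s (S \ T) := fun a => by
  rw [Finset.mem_sdiff, Finset.mem_sdiff, hS a, hT a]

theorem Stable.union [DecidableEq A] {s : Equiv.Perm A} {S T : Finset A} (hS : Stable s S)
    (hT : Stable s T) : Stable s (S ∪ T) := fun a => by
  rw [Finset.mem_union, Finset.mem_union, hS a, hT a]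

theorem stable_univ [Fintype A] (s : Equiv.Perm A) : Stable s Finset.univ := fun a => by simp

theorem stable_disjSum {s : Equiv.Perm A} {t : Equiv.Perm B} {S : Finset A} {T : Finset B} :
    Stable (Equiv.sumCongr s t) (S.disjSum T) ↔ Stable s S ∧ Stable t T := by
  constructor
  · intro h
    exact ⟨fun a => by simpa using h (.inl a), fun b => by simpa using h (.inr b)⟩
  · rintro ⟨h1, h2⟩ (a | b)
    · simpa using h1 a
    · simpa using h2 b

/-- The convolution product of two families, which corresponds to induction. -/
def conv (F G : WreathFun Γ) : WreathFun Γ := fun _ g s =>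
  ∑ T : Finset _, evOn F g s T * evOn G g s Tᶜ

theorem conv_isClass {F G : WreathFun Γ} (hF : F.IsClass) (hG : G.IsClass) :
    (conv F G).IsClass := by
  intro n g s π
  unfold conv
  rw [← Equiv.sum_comp (Equiv.finsetCongr π)]
  refine Finset.sum_congr rfl fun T _ => ?_
  have hc : (T.map π.toEmbedding)ᶜ = Tᶜ.map π.toEmbedding := by
    ext a
    simp
  rw [Equiv.finsetCongr_apply, hc]
  rw [evOn_map hF T π.toEmbedding (g' := g) (s' := s) (by simp) (by simp),
    evOn_map hG Tᶜ π.toEmbedding (g' := g) (s' := s) (by simp) (by simp)]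

/-- Subsets of the renumbered set correspond to subsets of `A` contained in `S`. With this formula
iterated convolutions become sums over chains of subsets of one fixed index set. -/
theorem evOn_conv [DecidableEq A] {F G : WreathFun Γ} (hF : F.IsClass) (hG : G.IsClass)
    (g : A → Γ) (s : Equiv.Perm A) (S : Finset A) :
    evOn (conv F G) g s S = ∑ T ∈ S.powerset, evOn F g s T * evOn G g s (S \ T) := by
  by_cases h : Stable s S
  · rw [evOn, dif_pos h]
    unfold conv
    let e : Fin S.card ↪ A := S.equivFin.symm.toEmbedding.trans (Function.Embedding.subtype _)
    have hes : ∀ i, e (S.equivFin.permCongr (s.subtypePerm h) i) = s (e i) := fun i => by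
      simp [e, coe_subtypePerm]
    have hu : Finset.univ.map e = S := by
      ext a
      simp only [Finset.mem_map, Finset.mem_univ, true_and]
      constructor
      · rintro ⟨i, rfl⟩; exact (S.equivFin.symm i).2
      · intro ha; exact ⟨S.equivFin ⟨a, ha⟩, by simp [e]⟩
    refine Finset.sum_bij (fun T _ => T.map e) ?_ ?_ ?_ ?_
    · intro T _
      rw [Finset.mem_powerset]
      exact (Finset.map_subset_map.mpr (Finset.subset_univ _)).trans hu.le
    · intro T _ T' _ hT
      exact Finset.map_injective e hT
    · intro T hT
      have hT' := (Finset.mem_powerset.mp hT).trans hu.ge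
      rw [Finset.subset_map_iff] at hT'
      obtain ⟨U, -, rfl⟩ := hT'
      exact ⟨U, Finset.mem_univ _, rfl⟩
    · intro T _
      have h2 : S \ T.map e = Tᶜ.map e := by
        rw [Finset.compl_eq_univ_sdiff, Finset.map_sdiff, hu]
      change _ = evOn F g s (T.map e) * evOn G g s (S \ T.map e)
      rw [h2, evOn_map hF T e (fun _ => rfl) hes, evOn_map hG Tᶜ e (fun _ => rfl) hes]
      rfl
  · rw [evOn_of_not_stable _ _ _ _ h]
    symm
    refine Finset.sum_eq_zero fun T hT => ?_
    rw [Finset.mem_powerset] at hT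
    -- If `T` and `S \ T` were both stable, their union `S` would be; so every term has a zero
    -- factor.
    by_cases h1 : Stable s T
    · by_cases h2 : Stable s (S \ T)
      · exact absurd (by simpa [Finset.union_sdiff_of_subset hT] using h1.union h2) h
      · rw [evOn_of_not_stable _ _ _ _ h2, mul_zero]
    · rw [evOn_of_not_stable _ _ _ _ h1, zero_mul]

/-- The part of a family in degree `k`. -/
def grade (k : ℕ) (F : WreathFun Γ) : WreathFun Γ := fun n g s => if n = k then F n g s else 0

theorem grade_isClass {F : WreathFun Γ} (hF : F.IsClass) (k : ℕ) : (grade k F).IsClass := by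
  intro n g s π
  unfold grade
  rw [hF]

theorem evOn_grade (F : WreathFun Γ) (k : ℕ) (g : A → Γ) (s : Equiv.Perm A) (S : Finset A) :
    evOn (grade k F) g s S = if S.card = k then evOn F g s S else 0 := by
  unfold evOn grade
  split_ifs <;> rfl

/-- Both sides run over ordered pairs of disjoint subsets $T,U$ of $S$, with the remainder going to
`k`. -/
theorem sum_powerset_swap [DecidableEq A] (S : Finset A) (f h k : Finset A → ℂ) :
    ∑ T ∈ S.powerset, f T * ∑ U ∈ (S \ T).powerset, h U * k ((S \ T) \ U) =
      ∑ U ∈ S.powerset, h U * ∑ T ∈ (S \ U).powerset, f T * k ((S \ U) \ T) := by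
  simp only [Finset.mul_sum]
  rw [Finset.sum_comm' (t' := S.powerset) (s' := fun U => (S \ U).powerset)]
  · refine Finset.sum_congr rfl fun U _ => Finset.sum_congr rfl fun T _ => ?_
    rw [sdiff_sdiff_comm]
    ring
  · intro T U
    simp only [Finset.mem_powerset, Finset.subset_sdiff]
    constructor
    · rintro ⟨h1, h2, h3⟩; exact ⟨⟨h1, h3.symm⟩, h2⟩
    · rintro ⟨⟨h1, h2⟩, h3⟩; exact ⟨h1, h3, h2.symm⟩

theorem conv_left_comm {F G H : WreathFun Γ} (hF : F.IsClass) (hG : G.IsClass) (hH : H.IsClass) :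
    conv F (conv G H) = conv G (conv F H) := by
  funext n g s
  simp only [← evOn_univ (conv_isClass hF (conv_isClass hG hH)),
    ← evOn_univ (conv_isClass hG (conv_isClass hF hH)), evOn_conv hF (conv_isClass hG hH),
    evOn_conv hG (conv_isClass hF hH), evOn_conv hG hH, evOn_conv hF hH]
  exact sum_powerset_swap _ _ _ _

end WreathFun

end SpinWreath

end

noncomputable section

namespace SpinWreath

/-! ### The structure of `Γ̃_l ×̂ Γ̃_p` -/

section SpinProd

variable {Γ : Type*} [Group Γ]

/-- The element of `Γ̃_n` given by an element of `Γ^n ⋊ S_n`. -/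
def wElt {n : ℕ} (g : Fin n → Γ) (s : Equiv.Perm (Fin n)) : SpinGroup Γ n := ⟨(g, ⟨0, 0⟩), s⟩

@[simp] theorem wElt_fst {n : ℕ} (g : Fin n → Γ) (s : Equiv.Perm (Fin n)) :
    (wElt g s).left.1 = g := rfl
@[simp] theorem wElt_sgn {n : ℕ} (g : Fin n → Γ) (s : Equiv.Perm (Fin n)) :
    (wElt g s).left.2.sgn = 0 := rfl
@[simp] theorem wElt_vec {n : ℕ} (g : Fin n → Γ) (s : Equiv.Perm (Fin n)) :
    (wElt g s).left.2.vec = 0 := rfl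
@[simp] theorem wElt_right {n : ℕ} (g : Fin n → Γ) (s : Equiv.Perm (Fin n)) :
    (wElt g s).right = s := rfl

theorem wElt_mul {n : ℕ} (g g' : Fin n → Γ) (s s' : Equiv.Perm (Fin n)) :
    wElt g s * wElt g' s' = wElt (g * g' ∘ s.symm) (s * s') := by
  ext1 <;> simp [inversions_zero, bil_zero_left]

theorem wElt_one {n : ℕ} : wElt (1 : Fin n → Γ) 1 = 1 := rfl

theorem wElt_inv {n : ℕ} (g : Fin n → Γ) (s : Equiv.Perm (Fin n)) :
    (wElt g s)⁻¹ = wElt (fun i => (g (s i))⁻¹) s⁻¹ := by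
  refine inv_eq_of_mul_eq_one_right ?_
  rw [wElt_mul, ← wElt_one]
  congr 1
  · funext i
    simp
  · simp

theorem wElt_conj {n : ℕ} (π : Equiv.Perm (Fin n)) (g : Fin n → Γ) (s : Equiv.Perm (Fin n)) :
    wElt 1 π * wElt g s * (wElt 1 π)⁻¹ = wElt (g ∘ π.symm) (π * s * π⁻¹) := by
  rw [mul_inv_eq_iff_eq_mul, wElt_mul, wElt_mul]
  congr 1
  · funext i; simp
  · simp

theorem parity_wElt {n : ℕ} (g : Fin n → Γ) (s : Equiv.Perm (Fin n)) : parity (wElt g s) = 0 := by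
  simp [parity]

section

variable {l p m : ℕ} (h : l + p = m)

theorem leftIdx_ne_rightIdx (i : Fin l) (j : Fin p) : leftIdx h i ≠ rightIdx h j :=
  (leftIdx_lt_rightIdx h i j).ne

theorem leftIdx_or_rightIdx (b : Fin m) : (∃ i, leftIdx h i = b) ∨ ∃ j, rightIdx h j = b := by
  rcases lt_or_ge b.val l with hb | hb
  · exact .inl ⟨⟨b, hb⟩, rfl⟩
  · refine .inr ⟨⟨b - l, by omega⟩, Fin.ext ?_⟩
    simp only [rightIdx]
    simp
    omega

theorem notMem_range_leftIdx (j : Fin p) : rightIdx h j ∉ Set.range (leftIdx h) :=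
  fun ⟨i, hi⟩ => leftIdx_ne_rightIdx h i j hi

theorem notMem_range_rightIdx (i : Fin l) : leftIdx h i ∉ Set.range (rightIdx h) :=
  fun ⟨j, hj⟩ => leftIdx_ne_rightIdx h i j hj.symm

/-- The set of the first `l` indices. -/
def leftSet : Finset (Fin m) := Finset.univ.map (leftIdx h).toEmbedding

theorem mem_leftSet {a : Fin m} : a ∈ leftSet h ↔ ∃ i, leftIdx h i = a := by
  simp [leftSet]

theorem mem_leftSet_compl {a : Fin m} : a ∈ (leftSet h)ᶜ ↔ ∃ i, rightIdx h i = a := by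
  rw [Finset.mem_compl, mem_leftSet]
  rcases leftIdx_or_rightIdx h a with ⟨i, rfl⟩ | ⟨j, rfl⟩
  · simp only [exists_apply_eq_apply, not_true, false_iff]
    exact notMem_range_rightIdx h i
  · simp only [exists_apply_eq_apply, iff_true]
    exact notMem_range_leftIdx h j

theorem card_leftSet : (leftSet h).card = l := by simp [leftSet]

theorem ext_leftIdx_mul {α : Type*} [MulOneClass α] (x : Fin l → α) (y : Fin p → α) (i : Fin l) :
    (ext (leftIdx h) 1 x * ext (rightIdx h) 1 y) (leftIdx h i) = x i := by
  simp [ext_apply, ext_apply' _ _ _ _ (notMem_range_rightIdx h i)]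

theorem ext_rightIdx_mul {α : Type*} [MulOneClass α] (x : Fin l → α) (y : Fin p → α) (i : Fin p) :
    (ext (leftIdx h) 1 x * ext (rightIdx h) 1 y) (rightIdx h i) = y i := by
  simp [ext_apply, ext_apply' _ _ _ _ (notMem_range_leftIdx h i)]

theorem ext_leftIdx_add {α : Type*} [AddZeroClass α] (x : Fin l → α) (y : Fin p → α) (i : Fin l) :
    (ext (leftIdx h) 0 x + ext (rightIdx h) 0 y) (leftIdx h i) = x i := by
  simp [ext_apply, ext_apply' _ _ _ _ (notMem_range_rightIdx h i)]

theorem ext_rightIdx_add {α : Type*} [AddZeroClass α] (x : Fin l → α) (y : Fin p → α)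
    (i : Fin p) : (ext (leftIdx h) 0 x + ext (rightIdx h) 0 y) (rightIdx h i) = y i := by
  simp [ext_apply, ext_apply' _ _ _ _ (notMem_range_leftIdx h i)]

theorem permExt_mul_leftIdx (s : Equiv.Perm (Fin l)) (t : Equiv.Perm (Fin p)) (i : Fin l) :
    (permExt (leftIdx h) s * permExt (rightIdx h) t) (leftIdx h i) = leftIdx h (s i) := by
  simp [permExt_apply, permExt_apply' _ _ _ (notMem_range_rightIdx h i)]

theorem permExt_mul_rightIdx (s : Equiv.Perm (Fin l)) (t : Equiv.Perm (Fin p)) (i : Fin p) :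
    (permExt (leftIdx h) s * permExt (rightIdx h) t) (rightIdx h i) = rightIdx h (t i) := by
  simp [permExt_apply, permExt_apply' _ _ _ (notMem_range_leftIdx h _)]

/-- No sign arises in this order: every left index precedes every right one, so the cocycle vanishes
(`bil_lt`), and a permutation of the left block creates no inversion among right indices. -/
theorem embL_mul_embR (t : SpinGroup Γ l) (u : SpinGroup Γ p) :
    embL h t * embR h u = ⟨(ext (leftIdx h) 1 t.left.1 * ext (rightIdx h) 1 u.left.1,
      ⟨t.left.2.sgn + u.left.2.sgn,
        ext (leftIdx h) 0 t.left.2.vec + ext (rightIdx h) 0 u.left.2.vec⟩),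
      permExt (leftIdx h) t.right * permExt (rightIdx h) u.right⟩ := by
  have hne := leftIdx_ne_rightIdx h
  have h1 := ext_comp_disjoint (leftIdx h) (rightIdx h) hne t.right 1 u.left.1
  have h2 := ext_comp_disjoint (leftIdx h) (rightIdx h) hne t.right 0 u.left.2.vec
  ext1
  · exact congrArg (ext (leftIdx h) 1 t.left.1 * ·) h1
  · change t.left.2.sgn + (u.left.2.sgn +
        inversions (permExt (leftIdx h) t.right) (ext (rightIdx h) 0 u.left.2.vec))
        + bil (cliffMatrix m) (ext (leftIdx h) 0 t.left.2.vec)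
          (ext (rightIdx h) 0 u.left.2.vec ∘ (permExt (leftIdx h) t.right).symm) = _
    rw [h2, inversions_disjoint _ _ hne, bil_lt _ _ (leftIdx_lt_rightIdx h), add_zero, add_zero]
  · exact congrArg (ext (leftIdx h) 0 t.left.2.vec + ·) h2
  · rfl

/-- In the opposite order the cocycle counts all pairs of a left and a right index (`bil_gt`), which
gives the product of the parities: the Koszul sign. -/
theorem embL_mul_embR_comm (x : SpinGroup Γ l) (y : SpinGroup Γ p) :
    embL h x * embR h y = (if parity x = 1 ∧ parity y = 1 then zElt m else 1) *
      (embR h y * embL h x) := by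
  have hne' : ∀ j i, rightIdx h j ≠ leftIdx h i := fun j i => (leftIdx_ne_rightIdx h i j).symm
  have h1 := ext_comp_disjoint (rightIdx h) (leftIdx h) hne' y.right 1 x.left.1
  have h2 := ext_comp_disjoint (rightIdx h) (leftIdx h) hne' y.right 0 x.left.2.vec
  have key : embR h y * embL h x = ⟨(ext (rightIdx h) 1 y.left.1 * ext (leftIdx h) 1 x.left.1,
      ⟨y.left.2.sgn + x.left.2.sgn + parity x * parity y,
        ext (rightIdx h) 0 y.left.2.vec + ext (leftIdx h) 0 x.left.2.vec⟩),
      permExt (rightIdx h) y.right * permExt (leftIdx h) x.right⟩ := by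
    ext1
    · exact congrArg (ext (rightIdx h) 1 y.left.1 * ·) h1
    · change y.left.2.sgn + (x.left.2.sgn +
          inversions (permExt (rightIdx h) y.right) (ext (leftIdx h) 0 x.left.2.vec))
          + bil (cliffMatrix m) (ext (rightIdx h) 0 y.left.2.vec)
            (ext (leftIdx h) 0 x.left.2.vec ∘ (permExt (rightIdx h) y.right).symm) = _
      rw [h2, inversions_disjoint _ _ hne', bil_gt _ _ (leftIdx_lt_rightIdx h), add_zero]
      rfl
    · exact congrArg (ext (rightIdx h) 0 y.left.2.vec + ·) h2
    · rfl
  have hg : ext (leftIdx h) 1 x.left.1 * ext (rightIdx h) 1 y.left.1 =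
      ext (rightIdx h) 1 y.left.1 * ext (leftIdx h) 1 x.left.1 := by
    funext b
    rcases leftIdx_or_rightIdx h b with ⟨i, rfl⟩ | ⟨j, rfl⟩
    · simp [ext_apply' _ _ _ _ (notMem_range_rightIdx h i)]
    · simp [ext_apply' _ _ _ _ (notMem_range_leftIdx h j)]
  rw [embL_mul_embR, key]
  rcases zmod2_cases (parity x) with hx | hx <;> rcases zmod2_cases (parity y) with hy | hy <;>
    ext1 <;>
    simp [hx, hy, hg, bil_zero_left, add_comm, add_left_comm,
      permExt_commute _ _ (leftIdx_ne_rightIdx h)]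
  exact zmod2_add_self 1

/-- The product remembers only the sum of the two central signs, so its fibres are the orbits of
multiplication by $(z,z)$. -/
theorem embL_mul_embR_inj (t t' : SpinGroup Γ l) (u u' : SpinGroup Γ p) :
    embL h t * embR h u = embL h t' * embR h u' ↔
      (t = t' ∧ u = u') ∨ (t = zElt l * t' ∧ u = zElt p * u') := by
  constructor
  · intro H
    rw [embL_mul_embR, embL_mul_embR] at H
    have H1 := congrArg (fun x : SpinGroup Γ m => x.left.1) H
    have H2 : t.left.2.sgn + u.left.2.sgn = t'.left.2.sgn + u'.left.2.sgn :=
      congrArg (fun x : SpinGroup Γ m => x.left.2.sgn) H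
    have H3 := congrArg (fun x : SpinGroup Γ m => x.left.2.vec) H
    have H4 := congrArg (fun x : SpinGroup Γ m => x.right) H
    dsimp only at H1 H3 H4
    have a1 : t.left.1 = t'.left.1 := funext fun i => by
      have := congrFun H1 (leftIdx h i)
      rwa [ext_leftIdx_mul, ext_leftIdx_mul] at this
    have a2 : u.left.1 = u'.left.1 := funext fun i => by
      have := congrFun H1 (rightIdx h i)
      rwa [ext_rightIdx_mul, ext_rightIdx_mul] at this
    have a3 : t.left.2.vec = t'.left.2.vec := funext fun i => by
      have := congrFun H3 (leftIdx h i)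
      rwa [ext_leftIdx_add, ext_leftIdx_add] at this
    have a4 : u.left.2.vec = u'.left.2.vec := funext fun i => by
      have := congrFun H3 (rightIdx h i)
      rwa [ext_rightIdx_add, ext_rightIdx_add] at this
    have a5 : t.right = t'.right := Equiv.ext fun i => by
      have := DFunLike.congr_fun H4 (leftIdx h i)
      rw [permExt_mul_leftIdx, permExt_mul_leftIdx] at this
      exact (leftIdx h).injective this
    have a6 : u.right = u'.right := Equiv.ext fun i => by
      have := DFunLike.congr_fun H4 (rightIdx h i)
      rw [permExt_mul_rightIdx, permExt_mul_rightIdx] at this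
      exact (rightIdx h).injective this
    by_cases hs : t.left.2.sgn = t'.left.2.sgn
    · rw [hs, add_right_inj] at H2
      exact .inl ⟨spinGroup_ext a1 hs a3 a5, spinGroup_ext a2 H2 a4 a6⟩
    · have hd : ∀ a b c d : ZMod 2, a + b = c + d → a ≠ c → a = 1 + c ∧ b = 1 + d := by decide
      obtain ⟨b1, b2⟩ := hd _ _ _ _ H2 hs
      refine .inr ⟨spinGroup_ext ?_ ?_ ?_ ?_, spinGroup_ext ?_ ?_ ?_ ?_⟩ <;>
        simp [a1, a2, a3, a4, a5, a6, b1, b2, bil_zero_left]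
  · rintro (⟨rfl, rfl⟩ | ⟨rfl, rfl⟩)
    · rfl
    · have hzl : embL h (zElt l : SpinGroup Γ l) = zElt m := embed_zElt _
      have hzr : embR h (zElt p : SpinGroup Γ p) = zElt m := embed_zElt _
      have hz2 : (zElt m * zElt m : SpinGroup Γ m) = 1 := by
        ext1
        · simp
        · simp [bil_zero_left]
          exact zmod2_add_self 1
        · simp
        · simp
      rw [map_mul, map_mul, hzl, hzr, ← mul_assoc, mul_assoc (zElt m), ← zElt_mul_comm,
        ← mul_assoc, hz2, one_mul]

theorem exists_perm_of_stable {n m : ℕ} (e : Fin n ↪o Fin m) (s : Equiv.Perm (Fin m))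
    (S : Finset (Fin m)) (hS : ∀ a, a ∈ S ↔ ∃ i, e i = a) (hs : Stable s S) :
    ∃ s' : Equiv.Perm (Fin n), ∀ i, e (s' i) = s (e i) := by
  have : ∀ i, ∃ j, e j = s (e i) := fun i => (hS _).mp ((hs _).mpr ((hS _).mpr ⟨i, rfl⟩))
  choose f hf using this
  refine ⟨Equiv.ofBijective f (Finite.injective_iff_bijective.mp fun i j hij => ?_), hf⟩
  apply e.injective
  apply s.injective
  rw [← hf, ← hf, hij]

theorem Stable.compl {A : Type} [Fintype A] [DecidableEq A] {s : Equiv.Perm A} {S : Finset A}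
    (h : Stable s S) : Stable s Sᶜ := fun a => by
  rw [Finset.mem_compl, Finset.mem_compl, h a]

theorem exists_perms_of_stable (s : Equiv.Perm (Fin m)) (hs : Stable s (leftSet h)) :
    ∃ (s₁ : Equiv.Perm (Fin l)) (s₂ : Equiv.Perm (Fin p)),
      (∀ i, leftIdx h (s₁ i) = s (leftIdx h i)) ∧ (∀ i, rightIdx h (s₂ i) = s (rightIdx h i)) ∧
      permExt (leftIdx h) s₁ * permExt (rightIdx h) s₂ = s := by
  obtain ⟨s₁, h1⟩ := exists_perm_of_stable (leftIdx h) s _ (fun _ => mem_leftSet h) hs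
  obtain ⟨s₂, h2⟩ :=
    exists_perm_of_stable (rightIdx h) s _ (fun _ => mem_leftSet_compl h) hs.compl
  refine ⟨s₁, s₂, h1, h2, Equiv.ext fun b => ?_⟩
  rcases leftIdx_or_rightIdx h b with ⟨i, rfl⟩ | ⟨j, rfl⟩
  · rw [permExt_mul_leftIdx, h1]
  · rw [permExt_mul_rightIdx, h2]

theorem ext_mul_ext_comp {α : Type*} [MulOneClass α] (x : Fin m → α) :
    ext (leftIdx h) 1 (fun i => x (leftIdx h i)) * ext (rightIdx h) 1 (fun i => x (rightIdx h i))
      = x := by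
  funext b
  rcases leftIdx_or_rightIdx h b with ⟨i, rfl⟩ | ⟨j, rfl⟩
  · rw [ext_leftIdx_mul]
  · rw [ext_rightIdx_mul]

theorem ext_add_ext_comp {α : Type*} [AddZeroClass α] (x : Fin m → α) :
    ext (leftIdx h) 0 (fun i => x (leftIdx h i)) + ext (rightIdx h) 0 (fun i => x (rightIdx h i))
      = x := by
  funext b
  rcases leftIdx_or_rightIdx h b with ⟨i, rfl⟩ | ⟨j, rfl⟩
  · rw [ext_leftIdx_add]
  · rw [ext_rightIdx_add]

theorem exists_embL_mul_embR (x : SpinGroup Γ m) (hx : Stable x.right (leftSet h)) :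
    ∃ (t : SpinGroup Γ l) (u : SpinGroup Γ p), x = embL h t * embR h u ∧ u.left.2.sgn = 0 ∧
      t.left.2.vec = fun i => x.left.2.vec (leftIdx h i) := by
  obtain ⟨s₁, s₂, -, -, h3⟩ := exists_perms_of_stable h x.right hx
  refine ⟨⟨(fun i => x.left.1 (leftIdx h i), ⟨x.left.2.sgn, fun i => x.left.2.vec (leftIdx h i)⟩),
    s₁⟩, ⟨(fun i => x.left.1 (rightIdx h i), ⟨0, fun i => x.left.2.vec (rightIdx h i)⟩), s₂⟩,
    ?_, rfl, rfl⟩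
  rw [embL_mul_embR]
  exact spinGroup_ext (ext_mul_ext_comp h _).symm (add_zero _).symm (ext_add_ext_comp h _).symm
    h3.symm

theorem stable_embL_mul_embR (t : SpinGroup Γ l) (u : SpinGroup Γ p) :
    Stable (embL h t * embR h u).right (leftSet h) := by
  rw [embL_mul_embR]
  exact stable_of_range (leftIdx h) (fun _ => mem_leftSet h) t.right
    fun i => (permExt_mul_leftIdx h _ _ i).symm

/-- The elements whose permutation preserves the left block form a subgroup containing both factors;
conversely each of them is a product by `exists_embL_mul_embR`. The join of subgroups becomes a
combinatorial condition. -/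
theorem mem_spinProd (x : SpinGroup Γ m) :
    x ∈ spinProd h ↔ Stable x.right (leftSet h) := by
  constructor
  · let K : Subgroup (SpinGroup Γ m) :=
      { carrier := {x | Stable x.right (leftSet h)}
        mul_mem' := fun {a b} ha hb i => by
          rw [SemidirectProduct.mul_right, Equiv.Perm.mul_apply, ha, hb]
        one_mem' := fun i => Iff.rfl
        inv_mem' := fun {a} ha i => by
          have := ha (a.right⁻¹ i)
          rw [SemidirectProduct.inv_right, ← this, ← Equiv.Perm.mul_apply, mul_inv_cancel,
            Equiv.Perm.one_apply] }
    have hK : spinProd h ≤ K := by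
      refine sup_le ?_ ?_
      · rintro _ ⟨t, rfl⟩
        have := stable_embL_mul_embR h t (1 : SpinGroup Γ p)
        rwa [map_one, mul_one] at this
      · rintro _ ⟨t, rfl⟩
        have := stable_embL_mul_embR h (1 : SpinGroup Γ l) t
        rwa [map_one, one_mul] at this
    exact fun hx => hK hx
  · intro hx
    obtain ⟨t, u, rfl, -⟩ := exists_embL_mul_embR h x hx
    exact mul_mem (Subgroup.mem_sup_left ⟨t, rfl⟩) (Subgroup.mem_sup_right ⟨u, rfl⟩)

end

end SpinProd

end SpinWreath

end

noncomputable section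

namespace SpinWreath

/-! ### Permutations carrying one finite set to another -/

section Counting

variable {A : Type} [Fintype A] [DecidableEq A]

theorem exists_perm_map_eq {S T : Finset A} (h : S.card = T.card) :
    ∃ π : Equiv.Perm A, S.map π.toEmbedding = T := by
  let e : S ≃ T := Finset.equivOfCardEq h
  refine ⟨e.extendSubtype, Finset.eq_of_subset_of_card_le ?_ (by simp [h])⟩
  intro a ha
  simp only [Finset.mem_map, Equiv.coe_toEmbedding] at ha
  obtain ⟨b, hb, rfl⟩ := ha
  exact e.extendSubtype_mem b hb

omit [Fintype A] [DecidableEq A] in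
theorem map_mul_perm (S : Finset A) (π σ : Equiv.Perm A) :
    S.map (π * σ).toEmbedding = (S.map σ.toEmbedding).map π.toEmbedding := by
  rw [Finset.map_map]
  rfl

/-- Left translation identifies the fibres over all targets of the same size; there are binomially
many of them and together they exhaust the symmetric group. -/
theorem card_filter_perm_map {S T : Finset A} (h : S.card = T.card) :
    (Finset.univ.filter fun π : Equiv.Perm A => S.map π.toEmbedding = T).card =
      S.card.factorial * (Fintype.card A - S.card).factorial := by
  have hconst : ∀ U ∈ Finset.univ.powersetCard S.card,
      (Finset.univ.filter fun π : Equiv.Perm A => S.map π.toEmbedding = U).card =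
        (Finset.univ.filter fun π : Equiv.Perm A => S.map π.toEmbedding = T).card := by
    intro U hU
    obtain ⟨σ, hσ⟩ := exists_perm_map_eq (S := U) (T := T)
      ((Finset.mem_powersetCard.mp hU).2.trans h)
    refine Finset.card_bij (fun π _ => σ * π) ?_ ?_ ?_
    · intro π hπ
      rw [Finset.mem_filter] at hπ ⊢
      exact ⟨Finset.mem_univ _, by rw [map_mul_perm, hπ.2, hσ]⟩
    · intro π _ π' _ hh
      exact mul_left_cancel hh
    · intro π hπ
      refine ⟨σ⁻¹ * π, ?_, mul_inv_cancel_left _ _⟩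
      rw [Finset.mem_filter] at hπ ⊢
      refine ⟨Finset.mem_univ _, ?_⟩
      rw [map_mul_perm, hπ.2, ← hσ, ← map_mul_perm, inv_mul_cancel]
      exact Finset.map_refl
  have hsum := Finset.card_eq_sum_card_fiberwise (s := (Finset.univ : Finset (Equiv.Perm A)))
    (t := Finset.univ.powersetCard S.card) (f := fun π => S.map π.toEmbedding)
    (fun π _ => by simp [Finset.mem_powersetCard])
  rw [Finset.sum_congr rfl hconst, Finset.sum_const, Finset.card_powersetCard, Finset.card_univ,
    Finset.card_univ, Fintype.card_perm, smul_eq_mul] at hsum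
  have hle : S.card ≤ Fintype.card A := Finset.card_le_univ S
  have hch := Nat.choose_mul_factorial_mul_factorial hle
  rw [mul_assoc, hsum] at hch
  exact (Nat.eq_of_mul_eq_mul_left (Nat.choose_pos hle) hch).symm

/-- This turns the average over conjugating permutations in the formula for an induced function into
a sum over subsets. -/
theorem sum_perm_map (S : Finset A) (E : Finset A → ℂ) :
    ∑ π : Equiv.Perm A, E (S.map π.toEmbedding) =
      (S.card.factorial * (Fintype.card A - S.card).factorial : ℕ) *
        ∑ T : Finset A, if T.card = S.card then E T else 0 := by
  have h := Finset.sum_fiberwise_of_maps_to (s := (Finset.univ : Finset (Equiv.Perm A)))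
    (t := Finset.univ.powersetCard S.card) (g := fun π => S.map π.toEmbedding)
    (fun π _ => by simp [Finset.mem_powersetCard]) (fun π => E (S.map π.toEmbedding))
  rw [← h, ← Finset.sum_filter, Finset.mul_sum]
  have hf : (Finset.univ.filter fun T : Finset A => T.card = S.card) =
      Finset.univ.powersetCard S.card := by
    ext T; simp [Finset.mem_powersetCard]
  rw [hf]
  refine Finset.sum_congr rfl fun T hT => ?_
  rw [← card_filter_perm_map (Finset.mem_powersetCard.mp hT).2.symm, ← nsmul_eq_mul,
    ← Finset.sum_const]
  exact Finset.sum_congr rfl fun π hπ => by rw [(Finset.mem_filter.mp hπ).2]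

end Counting

theorem evOn_conj {Γ : Type*} {A : Type} {F : WreathFun Γ} (hF : F.IsClass) (x : A → Γ)
    (s π : Equiv.Perm A) (S : Finset A) :
    evOn F (x ∘ π.symm) (π * s * π⁻¹) S = evOn F x s (S.map (π⁻¹).toEmbedding) := by
  have hmap : S = (S.map (π⁻¹).toEmbedding).map π.toEmbedding := by
    rw [← map_mul_perm, mul_inv_cancel]
    exact Finset.map_refl.symm
  conv_lhs => rw [hmap]
  exact evOn_map hF _ _ (by simp) (by simp)

/-! ### Induction from the spin product as convolution -/

section Induction

variable {Γ : Type*} [Group Γ]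

/-- The restriction of a family of spin functions to the groups `Γ^n ⋊ S_n`. -/
def toWreath (f : ∀ n, SpinFun Γ n) : WreathFun Γ := fun n g s => (f n : SpinGroup Γ n → ℂ) (wElt g s)

theorem toWreath_isClass (f : ∀ n, SpinFun Γ n) : (toWreath f).IsClass := by
  intro n g s π
  unfold toWreath
  rw [← wElt_conj, (f n).2.1]

variable [Fintype Γ] {l p m : ℕ} (h : l + p = m)

omit [Fintype Γ] in
theorem zElt_mul_ne {n : ℕ} (t : SpinGroup Γ n) : t ≠ zElt n * t := fun hh => by
  have := congrArg (fun x : SpinGroup Γ n => x.left.2.sgn) hh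
  simp [bil_zero_left] at this

open Classical in
theorem filter_embL_mul_embR (t : SpinGroup Γ l) (u : SpinGroup Γ p) :
    (Finset.univ.filter fun x : SpinGroup Γ l × SpinGroup Γ p =>
      embL h x.1 * embR h x.2 = embL h t * embR h u) = {(t, u), (zElt l * t, zElt p * u)} := by
  ext ⟨t', u'⟩
  simp only [Finset.mem_filter, Finset.mem_univ, true_and, embL_mul_embR_inj, Finset.mem_insert,
    Finset.mem_singleton, Prod.mk.injEq]

theorem two_mul_card_spinProd : 2 * Nat.card (spinProd h : Subgroup (SpinGroup Γ m)) =
    Fintype.card (SpinGroup Γ l) * Fintype.card (SpinGroup Γ p) := by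
  classical
  have h1 := Finset.card_eq_sum_card_fiberwise
    (s := (Finset.univ : Finset (SpinGroup Γ l × SpinGroup Γ p)))
    (t := Finset.univ.filter fun x : SpinGroup Γ m => x ∈ spinProd h)
    (f := fun x => embL h x.1 * embR h x.2)
    (fun x _ => by
      simp only [Finset.coe_filter, Finset.mem_univ, true_and, Set.mem_ofPred_eq]
      exact (mem_spinProd h _).mpr (stable_embL_mul_embR h _ _))
  rw [Finset.sum_congr rfl (g := fun _ => 2), Finset.sum_const, Finset.card_univ,
    Fintype.card_prod, smul_eq_mul] at h1
  · rw [h1, mul_comm, Nat.card_eq_fintype_card, Fintype.card_subtype]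
  · intro w hw
    rw [Finset.mem_filter, mem_spinProd] at hw
    obtain ⟨t, u, rfl, -⟩ := exists_embL_mul_embR h w hw.2
    rw [filter_embL_mul_embR, Finset.card_pair]
    exact fun hh => zElt_mul_ne t (congrArg Prod.fst hh)

/-- The two preimages differ by $(z,z)$ and contribute equally, because both functions change sign;
the factor $1/2$ in `outerTensor` compensates. -/
theorem outerTensor_apply (f : SpinFun Γ l) (g : SpinFun Γ p) (t : SpinGroup Γ l)
    (u : SpinGroup Γ p) : outerTensor h f g (embL h t * embR h u) =
      (f : SpinGroup Γ l → ℂ) t * (g : SpinGroup Γ p → ℂ) u := by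
  classical
  unfold outerTensor
  rw [← Fintype.sum_prod_type' (f := fun t' u' => if embL h t' * embR h u' =
    embL h t * embR h u then (f : SpinGroup Γ l → ℂ) t' * (g : SpinGroup Γ p → ℂ) u' else 0),
    ← Finset.sum_filter, filter_embL_mul_embR, Finset.sum_pair]
  · simp only [f.2.2.1, g.2.2.1]
    ring
  · exact fun hh => zElt_mul_ne t (congrArg Prod.fst hh)

theorem outerTensor_of_not_stable (f : SpinGroup Γ l → ℂ) (g : SpinGroup Γ p → ℂ)
    (w : SpinGroup Γ m) (hw : ¬ Stable w.right (leftSet h)) : outerTensor h f g w = 0 := by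
  classical
  unfold outerTensor
  rw [mul_eq_zero]
  refine .inr (Finset.sum_eq_zero fun t _ => Finset.sum_eq_zero fun u _ => if_neg ?_)
  rintro rfl
  exact hw (stable_embL_mul_embR h t u)

omit [Fintype Γ] in
theorem zElt_sq (n : ℕ) : (zElt n * zElt n : SpinGroup Γ n) = 1 := by
  ext1
  · simp
  · simp [bil_zero_left]
    exact zmod2_add_self 1
  · simp
  · simp

omit [Fintype Γ] in
theorem parity_zElt_mul {n : ℕ} (x : SpinGroup Γ n) : parity (zElt n * x) = parity x := by
  rw [parity_mul]
  simp [parity]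

/-- Moving the image of $a^{-1}$ past that of `u` costs a factor $z$ only when both are odd. Then
`g` vanishes at `u`, so the sign is harmless. -/
theorem outerTensor_conj_embL (f : SpinFun Γ l) (g : SpinFun Γ p) (a t : SpinGroup Γ l)
    (u : SpinGroup Γ p) :
    outerTensor h f g (embL h a * (embL h t * embR h u) * (embL h a)⁻¹) =
      outerTensor h f g (embL h t * embR h u) := by
  obtain ⟨c, hc, hcu⟩ : ∃ c : SpinGroup Γ p, embL h a * (embL h t * embR h u) * (embL h a)⁻¹ =
      embL h (a * t * a⁻¹) * embR h (c * u) ∧ (c = 1 ∨ c = zElt p ∧ parity u = 1) := by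
    have hzr : embR h (zElt p : SpinGroup Γ p) = zElt m := embed_zElt _
    have hcomm := embL_mul_embR_comm h a⁻¹ u
    have e1 : embL h a * (embL h t * embR h u) * (embL h a)⁻¹ =
        embL h (a * t) * (embR h u * embL h a⁻¹) := by
      simp only [map_mul, map_inv, mul_assoc]
    have e2 : ∀ c : SpinGroup Γ p, embL h (a * t * a⁻¹) * embR h (c * u) =
        embL h (a * t) * (embL h a⁻¹ * embR h (c * u)) := by
      intro c; simp only [map_mul, mul_assoc]
    by_cases hp : parity a⁻¹ = 1 ∧ parity u = 1
    · refine ⟨zElt p, ?_, .inr ⟨rfl, hp.2⟩⟩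
      have e3 : embL h a⁻¹ * embR h (zElt p * u) = embR h u * embL h a⁻¹ := by
        rw [zElt_mul_comm, map_mul, ← mul_assoc (embL h a⁻¹), hcomm, if_pos hp, hzr,
          ← zElt_mul_comm, ← mul_assoc, zElt_sq, one_mul]
      rw [e1, e2, e3]
    · refine ⟨1, ?_, .inl rfl⟩
      rw [e1, e2, one_mul, hcomm, if_neg hp, one_mul]
  rw [hc, outerTensor_apply, outerTensor_apply, f.2.1]
  rcases hcu with rfl | ⟨rfl, hu⟩
  · rw [one_mul]
  · rw [g.2.2.2 _ hu, g.2.2.2 _ (by rwa [parity_zElt_mul])]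

theorem outerTensor_conj_embR (f : SpinFun Γ l) (g : SpinFun Γ p) (t : SpinGroup Γ l)
    (a u : SpinGroup Γ p) :
    outerTensor h f g (embR h a * (embL h t * embR h u) * (embR h a)⁻¹) =
      outerTensor h f g (embL h t * embR h u) := by
  obtain ⟨c, hc, hcu⟩ : ∃ c : SpinGroup Γ l, embR h a * (embL h t * embR h u) * (embR h a)⁻¹ =
      embL h (c * t) * embR h (a * u * a⁻¹) ∧ (c = 1 ∨ c = zElt l ∧ parity t = 1) := by
    have hzr : embL h (zElt l : SpinGroup Γ l) = zElt m := embed_zElt _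
    have hcomm := embL_mul_embR_comm h t a
    have e1 : embR h a * (embL h t * embR h u) * (embR h a)⁻¹ =
        (embR h a * embL h t) * embR h (u * a⁻¹) := by
      simp only [map_mul, map_inv, mul_assoc]
    have e2 : ∀ c : SpinGroup Γ l, embL h (c * t) * embR h (a * u * a⁻¹) =
        embL h c * (embL h t * embR h a) * embR h (u * a⁻¹) := by
      intro c; simp only [map_mul, mul_assoc]
    by_cases hp : parity t = 1 ∧ parity a = 1
    · refine ⟨zElt l, ?_, .inr ⟨rfl, hp.1⟩⟩
      rw [e1, e2, hcomm, if_pos hp, hzr, ← mul_assoc (zElt m) (zElt m), zElt_sq, one_mul]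
    · refine ⟨1, ?_, .inl rfl⟩
      rw [e1, e2, map_one, one_mul, hcomm, if_neg hp, one_mul]
  rw [hc, outerTensor_apply, outerTensor_apply, g.2.1]
  rcases hcu with rfl | ⟨rfl, hu⟩
  · rw [one_mul]
  · rw [f.2.2.2 _ hu, f.2.2.2 _ (by rwa [parity_zElt_mul])]

/-- Write `y` as an element of $\Gamma^m\times\Pi_m$ times a permutation. The former lies in the
spin product, so conjugating by it preserves membership and, by the two preceding lemmas, the value.
-/
theorem outerTensor_conj (f : SpinFun Γ l) (g : SpinFun Γ p) (y w : SpinGroup Γ m) :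
    outerTensor h f g (y * w * y⁻¹) =
      outerTensor h f g (wElt 1 y.right * w * (wElt 1 y.right)⁻¹) := by
  obtain ⟨a, b, hab, -⟩ := exists_embL_mul_embR h (⟨y.left, 1⟩ : SpinGroup Γ m) fun i => Iff.rfl
  have hy : y = embL h a * embR h b * wElt 1 y.right := by
    rw [← hab]
    ext1 <;> simp [bil_zero_right]
  set π : SpinGroup Γ m := wElt 1 y.right
  set v := π * w * π⁻¹
  have e : y * w * y⁻¹ = embL h a * (embR h b * v * (embR h b)⁻¹) * (embL h a)⁻¹ := by
    rw [hy]
    simp only [v, mul_inv_rev, mul_assoc]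
  by_cases hv : Stable v.right (leftSet h)
  · obtain ⟨t, u, htu, -⟩ := exists_embL_mul_embR h v hv
    have hst : Stable (embR h b * v * (embR h b)⁻¹).right (leftSet h) := by
      rw [← mem_spinProd] at hv ⊢
      have hb : embR h b ∈ (spinProd h : Subgroup (SpinGroup Γ m)) :=
        Subgroup.mem_sup_right ⟨b, rfl⟩
      exact mul_mem (mul_mem hb hv) (inv_mem hb)
    obtain ⟨t', u', htu', -⟩ := exists_embL_mul_embR h _ hst
    rw [e, htu', outerTensor_conj_embL, ← htu', htu, outerTensor_conj_embR]
  · rw [outerTensor_of_not_stable h _ _ v hv, outerTensor_of_not_stable]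
    rw [← mem_spinProd] at hv ⊢
    have ha : embL h a ∈ (spinProd h : Subgroup (SpinGroup Γ m)) :=
      Subgroup.mem_sup_left ⟨a, rfl⟩
    have hb : embR h b ∈ (spinProd h : Subgroup (SpinGroup Γ m)) :=
      Subgroup.mem_sup_right ⟨b, rfl⟩
    rw [e]
    intro hh
    refine hv ?_
    have := mul_mem (mul_mem (inv_mem hb) (mul_mem (mul_mem (inv_mem ha) hh) ha)) hb
    simpa only [mul_assoc, inv_mul_cancel_left, inv_mul_cancel, mul_one] using this

omit [Fintype Γ] in
theorem wElt_eq_embL_mul_embR (x : Fin m → Γ) (s : Equiv.Perm (Fin m))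
    (s₁ : Equiv.Perm (Fin l)) (s₂ : Equiv.Perm (Fin p))
    (hs : permExt (leftIdx h) s₁ * permExt (rightIdx h) s₂ = s) :
    wElt x s = embL h (wElt (fun i => x (leftIdx h i)) s₁) *
      embR h (wElt (fun i => x (rightIdx h i)) s₂) := by
  rw [embL_mul_embR]
  exact spinGroup_ext (ext_mul_ext_comp h x).symm (add_zero _).symm
    (ext_add_ext_comp h (0 : Fin m → ZMod 2)).symm hs.symm

theorem outerTensor_wElt (f g : ∀ n, SpinFun Γ n) (x : Fin m → Γ) (s : Equiv.Perm (Fin m)) :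
    outerTensor h (f l) (g p) (wElt x s) =
      evOn (toWreath f) x s (leftSet h) * evOn (toWreath g) x s (leftSet h)ᶜ := by
  by_cases hs : Stable s (leftSet h)
  · obtain ⟨s₁, s₂, h1, h2, h3⟩ := exists_perms_of_stable h s hs
    rw [evOn_eq (toWreath_isClass f) (leftIdx h) (leftIdx h).injective (fun _ => mem_leftSet h) _
        (fun _ => rfl) s₁ h1,
      evOn_eq (toWreath_isClass g) (rightIdx h) (rightIdx h).injective
        (fun _ => mem_leftSet_compl h) _ (fun _ => rfl) s₂ h2,
      wElt_eq_embL_mul_embR h x s s₁ s₂ h3, outerTensor_apply]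
    rfl
  · rw [evOn_of_not_stable _ _ _ _ hs, zero_mul, outerTensor_of_not_stable]
    exact hs

theorem card_spinGroup (n : ℕ) : Fintype.card (SpinGroup Γ n) =
    Fintype.card ((Fin n → Γ) × PiGroup n) * n.factorial := by
  classical
  rw [Fintype.card_congr SemidirectProduct.equivProd, Fintype.card_prod, Fintype.card_perm,
    Fintype.card_fin]

omit [Group Γ] in
theorem card_base (n : ℕ) : Fintype.card ((Fin n → Γ) × PiGroup n) =
    Fintype.card Γ ^ n * (2 * 2 ^ n) := by
  classical
  rw [Fintype.card_prod, Fintype.card_congr (SignExt.equivProd (cliffMatrix n)), Fintype.card_prod]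
  simp

theorem card_spinProd : Nat.card (spinProd h : Subgroup (SpinGroup Γ m)) =
    Fintype.card ((Fin m → Γ) × PiGroup m) * (l.factorial * p.factorial) := by
  have h2 := two_mul_card_spinProd (Γ := Γ) h
  rw [card_spinGroup, card_spinGroup, card_base, card_base] at h2
  have hm : Fintype.card Γ ^ m * (2 * 2 ^ m) =
      Fintype.card Γ ^ l * Fintype.card Γ ^ p * (2 * (2 ^ l * 2 ^ p)) := by
    rw [← h, pow_add, pow_add]
  rw [card_base, hm]
  have : ∀ a b : ℕ, 2 * a = 2 * b → a = b := by omega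
  refine this _ _ (h2.trans ?_)
  ring

/-- Each summand of the induction formula depends only on the permutation part of the conjugating
element, through the image $T$ of the left block. The order of $\Gamma^m\times\Pi_m$ and the
$l!\,p!$ permutations leading to each $T$ cancel against the order of the spin product. -/
theorem indProd_wElt (f g : ∀ n, SpinFun Γ n) (x : Fin m → Γ) (s : Equiv.Perm (Fin m)) :
    indProd h (f l) (g p) (wElt x s) =
      conv (grade l (toWreath f)) (toWreath g) m x s := by
  classical
  have e1 : ∀ y : SpinGroup Γ m, (if y * wElt x s * y⁻¹ ∈ spinProd h then
      outerTensor h (f l) (g p) (y * wElt x s * y⁻¹) else 0) =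
      (fun T => evOn (toWreath f) x s T * evOn (toWreath g) x s Tᶜ)
        ((leftSet h).map (y.right⁻¹).toEmbedding) := by
    intro y
    have e2 : (if y * wElt x s * y⁻¹ ∈ spinProd h then
      outerTensor h (f l) (g p) (y * wElt x s * y⁻¹) else 0) =
        outerTensor h (f l) (g p) (y * wElt x s * y⁻¹) := by
      split_ifs with hy
      · rfl
      · rw [mem_spinProd] at hy
        rw [outerTensor_of_not_stable h _ _ _ hy]
    rw [e2, outerTensor_conj, wElt_conj, outerTensor_wElt]
    have hc : ((leftSet h).map (y.right⁻¹).toEmbedding)ᶜ =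
        (leftSet h)ᶜ.map (y.right⁻¹).toEmbedding := by
      ext a
      simp
    dsimp only
    rw [hc]
    rw [evOn_conj (toWreath_isClass f), evOn_conj (toWreath_isClass g)]
  unfold indProd induced
  rw [Finset.sum_congr rfl fun y _ => e1 y]
  rw [← Equiv.sum_comp (SemidirectProduct.equivProd (φ := permAction Γ m)).symm,
    Fintype.sum_prod_type]
  simp only [SemidirectProduct.equivProd, Equiv.coe_fn_symm_mk, Finset.sum_const, Finset.card_univ]
  -- The block is moved by the inverse permutation, so the summation variable is inverted before
  -- `sum_perm_map` is applied.
  rw [← Equiv.sum_comp (Equiv.inv (Equiv.Perm (Fin m)))]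
  simp only [Equiv.inv_apply, inv_inv]
  rw [sum_perm_map (leftSet h) (fun T => evOn (toWreath f) x s T * evOn (toWreath g) x s Tᶜ),
    card_leftSet, Fintype.card_fin, card_spinProd, show m - l = p by omega, nsmul_eq_mul,
    ← mul_assoc]
  push_cast
  rw [← mul_assoc]
  have hN : (Fintype.card ((Fin m → Γ) × PiGroup m) : ℂ) ≠ 0 :=
    Nat.cast_ne_zero.mpr Fintype.card_ne_zero
  have hl : (l.factorial : ℂ) ≠ 0 := Nat.cast_ne_zero.mpr l.factorial_ne_zero
  have hp : (p.factorial : ℂ) ≠ 0 := Nat.cast_ne_zero.mpr p.factorial_ne_zero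
  have hone : ∀ a b c : ℂ, a ≠ 0 → b ≠ 0 → c ≠ 0 →
      (a * (b * c))⁻¹ * a * (b * c) = 1 := by
    intro a b c ha hb hc
    field_simp
  rw [hone _ _ _ hN hl hp, one_mul]
  unfold conv
  refine Finset.sum_congr rfl fun T _ => ?_
  rw [evOn_grade]
  split_ifs <;> simp

end Induction

end SpinWreath

end

noncomputable section

namespace SpinWreath

/-! ### Spin functions are determined by their values on `Γ^n ⋊ S_n` -/

/-- The sign `(-1) ^ k`. -/
def zsign (k : ZMod 2) : ℂ := (-1) ^ k.val

@[simp] theorem zsign_zero : zsign 0 = 1 := by simp [zsign]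
@[simp] theorem zsign_one : zsign 1 = -1 := by simp [zsign, ZMod.val_one]

theorem zsign_add (a b : ZMod 2) : zsign (a + b) = zsign a * zsign b := by
  have h2 : (1 + 1 : ZMod 2) = 0 := zmod2_add_self 1
  rcases zmod2_cases a with rfl | rfl <;> rcases zmod2_cases b with rfl | rfl <;>
    simp [h2]

theorem zsign_mul_self (a : ZMod 2) : zsign a * zsign a = 1 := by
  rcases zmod2_cases a with rfl | rfl <;> simp

theorem zsign_sum {ι : Type*} (S : Finset ι) (f : ι → ZMod 2) :
    zsign (∑ i ∈ S, f i) = ∏ i ∈ S, zsign (f i) := by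
  classical
  induction S using Finset.induction_on with
  | empty => simp
  | insert a S ha ih => rw [Finset.sum_insert ha, Finset.prod_insert ha, zsign_add, ih]

/-- The indicator function of a set. -/
def indicator {A : Type} [DecidableEq A] (C : Finset A) : A → ZMod 2 := fun i => if i ∈ C then 1 else 0

/-- The sign characters. -/
def signFun (Γ : Type*) : WreathFun Γ := fun _ _ s => ((Equiv.Perm.sign s : ℤ) : ℂ)

theorem signFun_isClass (Γ : Type*) : (signFun Γ).IsClass := by
  intro n g s π
  simp only [signFun]
  rw [Equiv.Perm.sign_mul, Equiv.Perm.sign_mul, Equiv.Perm.sign_inv, mul_right_comm,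
    Int.units_mul_self, one_mul]

theorem zsign_inversions_one {n : ℕ} (s : Equiv.Perm (Fin n)) :
    zsign (inversions s 1) = ((Equiv.Perm.sign s : ℤ) : ℂ) := by
  rw [Equiv.Perm.sign_eq_prod_prod_Ioi]
  push_cast
  unfold inversions
  rw [zsign_sum]
  refine Finset.prod_congr rfl fun i _ => ?_
  rw [zsign_sum, ← Finset.filter_lt_eq_Ioi, Finset.prod_filter]
  refine Finset.prod_congr rfl fun j _ => ?_
  by_cases hij : i < j
  · have hne : s i ≠ s j := fun hh => hij.ne (s.injective hh)
    rcases lt_or_gt_of_ne hne with h | h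
    · simp [hij, h, h.not_gt]
    · simp [hij, h, h.not_gt]
  · simp [hij]

/-- In the increasing enumeration of `C` the inversions of `s` inside `C` are those of its
restriction, and their parity is the sign. Here `Γ` and `g` are dummies that fit the value into
`evOn`. -/
theorem zsign_inversions {Γ : Type*} {n : ℕ} (g : Fin n → Γ) (s : Equiv.Perm (Fin n))
    (C : Finset (Fin n)) (hC : Stable s C) :
    zsign (inversions s (indicator C)) = evOn (signFun Γ) g s C := by
  -- The enumeration must be increasing here: inversions, unlike the sign, depend on the order.
  let e : Fin C.card ↪o Fin n := C.orderEmbOfFin rfl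
  have he : ∀ a, a ∈ C ↔ ∃ i, e i = a := fun a => by
    rw [← Set.mem_range, Finset.range_orderEmbOfFin C rfl, Finset.mem_coe]
  have hind : ∀ b, b ∉ Set.range e → indicator C b = 0 := fun b hb => by
    rw [indicator, if_neg]
    rwa [he]
  have hind1 : ∀ i, indicator C (e i) = 1 := fun i => if_pos ((he _).mpr ⟨i, rfl⟩)
  obtain ⟨s', hs'⟩ := exists_perm_of_stable e s C he hC
  rw [evOn_eq (signFun_isClass Γ) e e.injective he _ (fun _ => rfl) s' hs', signFun,
    ← zsign_inversions_one]
  congr 1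
  unfold inversions
  rw [sum_ext_aux e]
  · refine Finset.sum_congr rfl fun i _ => ?_
    rw [sum_ext_aux e]
    · simp [hind1, ← hs']
    · intro b hb; simp [hind b hb]
  · intro b hb; simp [hind b hb]

theorem exists_restrict {A : Type} {s : Equiv.Perm A} {S : Finset A} (h : Stable s S) :
    ∃ (e : Fin S.card ↪ A) (s' : Equiv.Perm (Fin S.card)), (∀ i, e (s' i) = s (e i)) ∧
      Finset.univ.map e = S := by
  refine ⟨S.equivFin.symm.toEmbedding.trans (Function.Embedding.subtype _),
    S.equivFin.permCongr (s.subtypePerm h), fun i => by simp [coe_subtypePerm], ?_⟩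
  ext a
  simp only [Finset.mem_map, Finset.mem_univ, true_and]
  constructor
  · rintro ⟨i, rfl⟩; exact (S.equivFin.symm i).2
  · intro ha; exact ⟨S.equivFin ⟨a, ha⟩, by simp⟩

/-- The Fredholm alternative over $\mathbb F_2$: if `v` is not in the image of $1+s$, some
functional kills that image but not `v`. Killing the image means that its coefficients are constant
along `s`, so its support is stable. -/
theorem exists_sum_eq_or_odd {n : ℕ} (s : Equiv.Perm (Fin n)) (v : Fin n → ZMod 2) :
    (∃ u, v = u + u ∘ s.symm) ∨ ∃ S : Finset (Fin n), Stable s S ∧ ∑ i ∈ S, v i = 1 := by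
  have : Fact (Nat.Prime 2) := ⟨Nat.prime_two⟩
  let D : (Fin n → ZMod 2) →ₗ[ZMod 2] (Fin n → ZMod 2) :=
    LinearMap.id + LinearMap.funLeft (ZMod 2) (ZMod 2) s.symm
  by_cases hv : v ∈ LinearMap.range D
  · obtain ⟨u, hu⟩ := hv
    exact .inl ⟨u, hu.symm⟩
  · right
    obtain ⟨φ, hφ, hker⟩ := Submodule.exists_le_ker_of_notMem hv
    have hval : ∀ u, φ u = ∑ i, u i * φ (Pi.single i 1) := fun u => by
      conv_lhs => rw [← Finset.univ_sum_single u, map_sum]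
      refine Finset.sum_congr rfl fun i _ => ?_
      rw [← smul_eq_mul, ← map_smul, ← Pi.single_smul, smul_eq_mul, mul_one]
    refine ⟨Finset.univ.filter fun i => φ (Pi.single i 1) = 1, fun i => ?_, ?_⟩
    · have h1 : φ (D (Pi.single i 1)) = 0 := hker ⟨_, rfl⟩
      have h2 : D (Pi.single i 1) = Pi.single i 1 + Pi.single (s i) 1 := by
        change Pi.single i (1 : ZMod 2) + (Pi.single i (1 : ZMod 2)) ∘ s.symm = _
        congr 1
        funext j
        simp [Pi.single_apply, Equiv.symm_apply_eq]
      rw [h2, map_add, CharTwo.add_eq_zero] at h1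
      simp [h1]
    · have h1 : φ v = 1 := (zmod2_cases _).resolve_left hφ
      rw [hval] at h1
      rw [Finset.sum_filter]
      refine Eq.trans ?_ h1
      refine Finset.sum_congr rfl fun i _ => ?_
      rcases zmod2_cases (φ (Pi.single i 1)) with h | h <;> simp [h]

section

variable {Γ : Type*} [Group Γ]

/-- After conjugation `S` is the left block and `x` is a product $tu$ with $t$ odd. If $u$ is even,
`x` is odd; if $u$ is odd, conjugation by $t$ multiplies $tu$ by $z$. Either way `f` vanishes. -/
theorem spinFun_eq_zero_of_odd {m : ℕ} (f : SpinFun Γ m) (x : SpinGroup Γ m) (S : Finset (Fin m))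
    (hS : Stable x.right S) (hodd : ∑ i ∈ S, x.left.2.vec i = 1) :
    (f : SpinGroup Γ m → ℂ) x = 0 := by
  have h : S.card + (m - S.card) = m := by
    have := Finset.card_le_univ S
    rw [Fintype.card_fin] at this
    omega
  obtain ⟨π, hπ⟩ := exists_perm_map_eq (S := S) (T := leftSet h) (card_leftSet h).symm
  set y : SpinGroup Γ m := wElt 1 π
  have hx : (f : SpinGroup Γ m → ℂ) x = (f : SpinGroup Γ m → ℂ) (y * x * y⁻¹) := (f.2.1 x y).symm
  have hvec : (y * x * y⁻¹).left.2.vec = x.left.2.vec ∘ π.symm := by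
    rw [wElt_inv]
    funext i
    simp [y]
  have hst : Stable (y * x * y⁻¹).right (leftSet h) := by
    rw [← hπ]
    refine (Stable.map_iff π.toEmbedding ?_).mpr hS
    intro b
    simp [y]
  obtain ⟨t, u, htu, -, ht⟩ := exists_embL_mul_embR h _ hst
  have hpt : parity t = 1 := by
    rw [← hodd, parity, ht, hvec]
    have e := Finset.sum_map S π.toEmbedding fun i => x.left.2.vec (π.symm i)
    rw [hπ, leftSet, Finset.sum_map] at e
    simpa using e
  rw [hx, htu]
  rcases zmod2_cases (parity u) with hu | hu
  · apply f.2.2.2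
    rw [parity_mul, embL, embR, parity_embed, parity_embed, hpt, hu, add_zero]
  · have hc := embL_mul_embR_comm h t u
    rw [if_pos ⟨hpt, hu⟩] at hc
    have h1 := f.2.1 (embL h t * embR h u) (embL h t)
    have h2 : embL h t * (embL h t * embR h u) * (embL h t)⁻¹ =
        zElt m * (embL h t * embR h u) := by
      conv_lhs => rw [hc]
      simp only [mul_assoc, mul_inv_cancel, mul_one]
      rw [← mul_assoc, ← zElt_mul_comm, mul_assoc]
    rw [h2, f.2.2.1] at h1
    exact self_eq_neg.mp h1.symm

/-- The two cases of `exists_sum_eq_or_odd` are a conjugate of an element of $\Gamma^n\rtimes S_n$,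
up to $z$, and an element at which every spin function vanishes. -/
theorem spinFun_eq_zero {n : ℕ} (f : SpinFun Γ n)
    (hf : ∀ g s, (f : SpinGroup Γ n → ℂ) (wElt g s) = 0) : f = 0 := by
  refine Subtype.ext (funext fun x => ?_)
  change (f : SpinGroup Γ n → ℂ) x = 0
  rcases exists_sum_eq_or_odd x.right x.left.2.vec with ⟨u, hu⟩ | ⟨S, hS, hodd⟩
  -- Conjugating by $a_u$ creates exactly the vector $u+s(u)$; the central sign may still differ
  -- from that of `x`, and is treated by cases below.
  · set y : SpinGroup Γ n := ⟨(1, ⟨0, u⟩), 1⟩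
    set w := y * wElt x.left.1 x.right * y⁻¹
    have hw : (f : SpinGroup Γ n → ℂ) w = 0 := by rw [f.2.1, hf]
    have h1 : x.left.1 = w.left.1 := by
      funext i; simp [w, y]
    have h3 : x.left.2.vec = w.left.2.vec := by
      rw [hu]; funext i; simp [w, y]
    have h4 : x.right = w.right := by simp [w, y]
    by_cases h2 : x.left.2.sgn = w.left.2.sgn
    · rw [spinGroup_ext h1 h2 h3 h4, hw]
    · have hd : ∀ a b : ZMod 2, a ≠ b → a = 1 + b := by decide
      have : x = zElt n * w := by
        refine spinGroup_ext ?_ ?_ ?_ ?_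
        · simp [h1]
        · simpa [bil_zero_left] using hd _ _ h2
        · simp [h3]
        · simp [h4]
      rw [this, f.2.2.1, hw, neg_zero]
  · exact spinFun_eq_zero_of_odd f x S hS hodd

/-- The element $a_C$ commutes with $(g,s)$ up to the sign of `s` on `C`. When that sign is $-1$,
$(g,s)$ is conjugate to $z(g,s)$. -/
theorem spinFun_wElt_eq_zero {n : ℕ} (f : SpinFun Γ n) (g : Fin n → Γ) (s : Equiv.Perm (Fin n))
    (C : Finset (Fin n)) (hC : Stable s C) (hodd : evOn (signFun Γ) g s C = -1) :
    (f : SpinGroup Γ n → ℂ) (wElt g s) = 0 := by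
  rw [← zsign_inversions g s C hC] at hodd
  have hinv : inversions s (indicator C) = 1 := by
    rcases zmod2_cases (inversions s (indicator C)) with h | h
    · rw [h, zsign_zero] at hodd
      norm_num at hodd
    · exact h
  have hind : indicator C ∘ s.symm = indicator C := by
    funext i
    have := hC (s.symm i)
    rw [Equiv.apply_symm_apply] at this
    simp [indicator, this]
  set y : SpinGroup Γ n := ⟨(1, ⟨0, indicator C⟩), 1⟩
  have h1 : y * wElt g s * y⁻¹ = zElt n * wElt g s := by
    rw [mul_inv_eq_iff_eq_mul]
    ext1
    · simp [y]
    · simp [y, bil_zero_left, bil_zero_right, hinv]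
      exact (zmod2_add_self 1).symm
    · simp [y, hind]
    · simp [y]
  have h2 := f.2.1 (wElt g s) y
  rw [h1, f.2.2.1] at h2
  exact self_eq_neg.mp h2.symm

theorem evOn_toWreath_eq_zero (f : ∀ n, SpinFun Γ n) {A : Type} (g : A → Γ) (s : Equiv.Perm A)
    (S C : Finset A) (hCS : C ⊆ S) (hodd : evOn (signFun Γ) g s C = -1) :
    evOn (toWreath f) g s S = 0 := by
  by_cases hS : Stable s S
  · obtain ⟨e, s', hs', he⟩ := exists_restrict hS
    have hCS' := hCS.trans he.ge
    rw [Finset.subset_map_iff] at hCS'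
    obtain ⟨C', -, rfl⟩ := hCS'
    rw [evOn_map (signFun_isClass Γ) C' e (g' := fun i => g (e i)) (fun _ => rfl) hs'] at hodd
    have h1 := evOn_map (toWreath_isClass f) Finset.univ e (g := g) (g' := fun i => g (e i))
      (fun _ => rfl) hs'
    have h2 : evOn (toWreath f) g s (Finset.univ.map e) = evOn (toWreath f) g s S :=
      congrArg _ he
    rw [← h2, h1, evOn_univ (toWreath_isClass f)]
    refine spinFun_wElt_eq_zero _ _ _ C' ?_ hodd
    by_contra hC
    rw [evOn_of_not_stable _ _ _ _ hC] at hodd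
    norm_num at hodd
  · exact evOn_of_not_stable _ _ _ _ hS

end

end SpinWreath

end

noncomputable section

namespace SpinWreath

/-! ### The monomial basis of the Clifford algebra -/

section Clifford

variable {n : ℕ}

theorem cliffGen_mul_self (i : Fin n) : cliffGen i * cliffGen i = -1 := by
  rw [cliffGen, CliffordAlgebra.ι_sq_scalar]
  have h : cliffForm n (Pi.single i 1) = -1 := by simp [cliffForm, Pi.single_apply]
  rw [h, map_neg, map_one]

theorem cliffGen_mul_comm {i j : Fin n} (h : i ≠ j) :
    cliffGen i * cliffGen j = -(cliffGen j * cliffGen i) := by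
  refine eq_neg_of_add_eq_zero_left ?_
  rw [cliffGen, cliffGen, CliffordAlgebra.ι_mul_ι_add_swap, QuadraticMap.polar]
  have h1 : ∀ v : Fin n → ℂ, cliffForm n v = -∑ k, v k * v k := fun v => by
    simp [cliffForm]
  have h2 : ∑ k, Pi.single (M := fun _ => ℂ) i 1 k * Pi.single (M := fun _ => ℂ) j 1 k = 0 := by
    refine Finset.sum_eq_zero fun k _ => ?_
    by_cases hk : k = i
    · subst hk; simp [h]
    · simp [hk]
  have h3 : ∑ k, Pi.single (M := fun _ => ℂ) j 1 k * Pi.single (M := fun _ => ℂ) i 1 k = 0 := by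
    simpa only [mul_comm] using h2
  simp only [h1, Pi.add_apply, add_mul, mul_add, Finset.sum_add_distrib, h2, h3]
  simp

/-- The factor at `i` of a Clifford monomial. -/
def cliffFactor (x : Fin n → ZMod 2) (i : Fin n) : Cliff n := if x i = 1 then cliffGen i else 1

/-- The product of the factors of a Clifford monomial over a list of indices. -/
def cliffList (x : Fin n → ZMod 2) (L : List (Fin n)) : Cliff n := (L.map (cliffFactor x)).prod

theorem cliffMon_eq (x : Fin n → ZMod 2) : cliffMon x = cliffList x (List.finRange n) := rfl

theorem cliffList_congr {x y : Fin n → ZMod 2} {L : List (Fin n)} (h : ∀ i ∈ L, x i = y i) :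
    cliffList x L = cliffList y L := by
  unfold cliffList
  congr 1
  exact List.map_congr_left fun i hi => by simp only [cliffFactor, h i hi]

theorem cliffGen_mul_cliffList (y : Fin n → ZMod 2) (i : Fin n) (L : List (Fin n)) (hi : i ∉ L) :
    cliffGen i * cliffList y L = zsign (L.map y).sum • (cliffList y L * cliffGen i) := by
  induction L with
  | nil => simp [cliffList]
  | cons a L ih =>
    rw [List.mem_cons, not_or] at hi
    have e : cliffList y (a :: L) = cliffFactor y a * cliffList y L := by simp [cliffList]
    have h1 : cliffGen i * cliffFactor y a = zsign (y a) • (cliffFactor y a * cliffGen i) := by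
      rcases zmod2_cases (y a) with h | h
      · simp [cliffFactor, h]
      · simp [cliffFactor, h, cliffGen_mul_comm hi.1]
    rw [e, ← mul_assoc, h1, smul_mul_assoc, mul_assoc, ih hi.2, List.map_cons, List.sum_cons,
      zsign_add, mul_smul_comm, smul_smul, mul_assoc]

theorem cliffList_append (y : Fin n → ZMod 2) (L L' : List (Fin n)) :
    cliffList y (L ++ L') = cliffList y L * cliffList y L' := by simp [cliffList]

theorem bil_single_left (i : Fin n) (y : Fin n → ZMod 2) :
    bil (cliffMatrix n) (Pi.single i 1) y = ∑ j, if j ≤ i then y j else 0 := by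
  unfold bil
  rw [Finset.sum_eq_single i]
  · simp [cliffMatrix]
  · intro b _ hb; simp [hb]
  · simp

/-- Moving $e_i$ to its place in the increasing product passes the generators with smaller index,
and if $e_i$ is already present then $e_i^2=-1$ gives one more sign. Together these are the cocycle
of $\Pi_n$. -/
theorem cliffGen_mul_cliffMon (i : Fin n) (y : Fin n → ZMod 2) :
    cliffGen i * cliffMon y =
      zsign (bil (cliffMatrix n) (Pi.single i 1) y) • cliffMon (Pi.single i 1 + y) := by
  obtain ⟨L₁, L₂, hL⟩ := List.append_of_mem (List.mem_finRange i)
  have hp : (L₁ ++ i :: L₂).Pairwise (· < ·) := hL ▸ List.pairwise_lt_finRange n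
  rw [List.pairwise_append, List.pairwise_cons] at hp
  have hlt : ∀ j ∈ L₁, j < i := fun j hj => hp.2.2 j hj i (by simp)
  have hgt : ∀ j ∈ L₂, i < j := fun j hj => hp.2.1.1 j hj
  have h1 : i ∉ L₁ := fun h => (hlt i h).false
  have hbil : bil (cliffMatrix n) (Pi.single i 1) y = (L₁.map y).sum + y i := by
    rw [bil_single_left, Fin.sum_univ_def, hL, List.map_append, List.map_cons, List.sum_append,
      List.sum_cons, List.map_congr_left (g := y) fun j hj => if_pos (hlt j hj).le,
      List.map_congr_left (l := L₂) (g := fun _ => 0) fun j hj => if_neg (hgt j hj).not_ge]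
    simp
  have hne : ∀ j, j ≠ i → y j = (Pi.single i 1 + y : Fin n → ZMod 2) j := fun j hj => by simp [hj]
  have hcons : ∀ y : Fin n → ZMod 2, cliffList y (i :: L₂) = cliffFactor y i * cliffList y L₂ :=
    fun y => by simp [cliffList]
  have hi : cliffGen i * cliffFactor y i =
      zsign (y i) • cliffFactor (Pi.single i 1 + y) i := by
    have h2 : (1 + 1 : ZMod 2) = 0 := zmod2_add_self 1
    rcases zmod2_cases (y i) with h | h
    · simp [cliffFactor, h]
    · simp [cliffFactor, h, h2, cliffGen_mul_self]
  rw [cliffMon_eq, cliffMon_eq, hL, cliffList_append, cliffList_append, hcons, hcons,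
    ← mul_assoc, cliffGen_mul_cliffList y i L₁ h1, smul_mul_assoc, mul_assoc,
    ← mul_assoc (cliffGen i), hi, hbil, zsign_add, smul_mul_assoc, mul_smul_comm, smul_smul,
    cliffList_congr (x := y) (L := L₁) fun j hj => hne j (hlt j hj).ne,
    cliffList_congr (x := y) (L := L₂) fun j hj => hne j (hgt j hj).ne']

/-- The vector `x` cut down to the indices in a list. -/
def cutVec (x : Fin n → ZMod 2) (L : List (Fin n)) : Fin n → ZMod 2 :=
  fun i => if i ∈ L then x i else 0

theorem cutVec_cons (x : Fin n → ZMod 2) (a : Fin n) (L : List (Fin n)) (ha : a ∉ L) :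
    cutVec x (a :: L) = Pi.single a (x a) + cutVec x L := by
  funext i
  by_cases hi : i = a
  · subst hi; simp [cutVec, ha]
  · simp [cutVec, hi]

theorem cutVec_finRange (x : Fin n → ZMod 2) : cutVec x (List.finRange n) = x := by
  funext i; simp [cutVec]

theorem bil_single_cutVec (x : Fin n → ZMod 2) (a : Fin n) (L : List (Fin n))
    (ha : ∀ j ∈ L, a < j) : bil (cliffMatrix n) (Pi.single a 1) (cutVec x L) = 0 := by
  rw [bil_single_left]
  refine Finset.sum_eq_zero fun j _ => ?_
  split_ifs with hj
  · exact if_neg fun h => (ha j h).not_ge hj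
  · rfl

/-- Induction principle for statements about increasing products of Clifford generators. -/
theorem cliffMon_induction (x : Fin n → ZMod 2) (P : Cliff n → (Fin n → ZMod 2) → Prop)
    (h0 : P 1 0)
    (h1 : ∀ a u v, bil (cliffMatrix n) (Pi.single a 1) v = 0 → P u v →
      P (cliffGen a * u) (Pi.single a 1 + v)) : P (cliffMon x) x := by
  have key : ∀ L : List (Fin n), L.Pairwise (· < ·) → P (cliffList x L) (cutVec x L) := by
    intro L hL
    induction L with
    | nil =>
      have e : cutVec x [] = 0 := funext fun i => if_neg (by simp)
      rw [e]
      exact h0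
    | cons a L ih =>
      rw [List.pairwise_cons] at hL
      have e : cliffList x (a :: L) = cliffFactor x a * cliffList x L := by simp [cliffList]
      rw [e, cutVec_cons x a L fun h => (hL.1 a h).false]
      rcases zmod2_cases (x a) with h | h
      · simpa [cliffFactor, h] using ih hL.2
      · rw [cliffFactor, if_pos h, h]
        exact h1 _ _ _ (bil_single_cutVec x a L hL.1) (ih hL.2)
  have := key _ (List.pairwise_lt_finRange n)
  rwa [cutVec_finRange] at this

theorem cliffMon_zero : cliffMon (0 : Fin n → ZMod 2) = 1 := by
  simp [cliffMon]

theorem cliffMon_mul_cliffMon (x y : Fin n → ZMod 2) :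
    cliffMon x * cliffMon y = zsign (bil (cliffMatrix n) x y) • cliffMon (x + y) := by
  refine cliffMon_induction x
    (fun u v => u * cliffMon y = zsign (bil (cliffMatrix n) v y) • cliffMon (v + y)) ?_ ?_
  · simp [bil_zero_left]
  · intro a u v h ih
    rw [mul_assoc, ih, mul_smul_comm, cliffGen_mul_cliffMon, bil_add_right, h, zero_add,
      smul_smul, bil_add_left, zsign_add, mul_comm, add_assoc]

theorem single_comp_symm (s : Equiv.Perm (Fin n)) (a : Fin n) {α : Type} [Zero α] (c : α) :
    (Pi.single a c : Fin n → α) ∘ s.symm = Pi.single (s a) c := by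
  funext j
  simp [Pi.single_apply, Equiv.symm_apply_eq]

theorem inversions_single (s : Equiv.Perm (Fin n)) (a : Fin n) :
    inversions s (Pi.single a 1) = 0 := by
  unfold inversions
  refine Finset.sum_eq_zero fun i _ => Finset.sum_eq_zero fun j _ => ?_
  split_ifs with h
  · by_cases hi : i = a
    · subst hi; simp [h.1.ne']
    · simp [hi]
  · rfl

/-- The sign is the one by which `s` acts on $\Pi_n$; the induction adds a smallest index, for which
`inversions_add` has no cocycle term on its left side. -/
theorem map_cliffMon (s : Equiv.Perm (Fin n)) (x : Fin n → ZMod 2) :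
    CliffordAlgebra.map (permIsometry s) (cliffMon x) =
      zsign (inversions s x) • cliffMon (x ∘ s.symm) := by
  refine cliffMon_induction x (fun u v => CliffordAlgebra.map (permIsometry s) u =
    zsign (inversions s v) • cliffMon (v ∘ s.symm)) ?_ ?_
  · simp [inversions_zero, Pi.zero_comp, cliffMon_zero]
  · intro a u v h ih
    have h1 : CliffordAlgebra.map (permIsometry s) (cliffGen a) = cliffGen (s a) := by
      rw [cliffGen, CliffordAlgebra.map_apply_ι, cliffGen]
      congr 1
      exact single_comp_symm s a 1
    have h2 := inversions_add s (Pi.single a 1) v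
    rw [h, add_zero, inversions_single, zero_add, single_comp_symm] at h2
    rw [map_mul, h1, ih, mul_smul_comm, cliffGen_mul_cliffMon, smul_smul, h2, zsign_add]
    congr 2
    funext i
    simp only [Function.comp_apply, Pi.add_apply]
    congr 1
    exact (congrFun (single_comp_symm s a (1 : ZMod 2)) i).symm

/-- The operator on functions on `𝔽₂^n` by which the generator `e_i` acts. -/
def genOp (i : Fin n) : Module.End ℂ ((Fin n → ZMod 2) → ℂ) where
  toFun f K := zsign (bil (cliffMatrix n) (Pi.single i 1) (Pi.single i 1 + K)) *
    f (Pi.single i 1 + K)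
  map_add' f g := by funext K; simp [mul_add]
  map_smul' c f := by funext K; simp [mul_left_comm]

theorem bil_single_single (i j : Fin n) :
    bil (cliffMatrix n) (Pi.single i 1) (Pi.single j 1) = if j ≤ i then 1 else 0 := by
  rw [bil_single_left, Finset.sum_eq_single j]
  · simp
  · intro b _ hb; simp [hb]
  · simp

theorem add_self_vec (x : Fin n → ZMod 2) : x + x = 0 := funext fun i => zmod2_add_self (x i)

theorem genOp_genOp (i j : Fin n) (f : (Fin n → ZMod 2) → ℂ) (K : Fin n → ZMod 2) :
    genOp i (genOp j f) K =
      zsign (1 + bil (cliffMatrix n) (Pi.single i 1) K +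
        (1 + (bil (cliffMatrix n) (Pi.single j 1) (Pi.single i 1) +
          bil (cliffMatrix n) (Pi.single j 1) K))) * f (Pi.single j 1 + (Pi.single i 1 + K)) := by
  have h : ∀ i : Fin n, bil (cliffMatrix n) (Pi.single i 1) (Pi.single i 1) = 1 := fun i => by
    rw [bil_single_single, if_pos le_rfl]
  change zsign _ * (zsign _ * f _) = _
  rw [← mul_assoc, ← zsign_add, bil_add_right, bil_add_right, bil_add_right, h, h]

theorem genOp_anticomm (i j : Fin n) :
    genOp i * genOp j + genOp j * genOp i = if i = j then (-2 : ℂ) • 1 else 0 := by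
  refine LinearMap.ext fun f => funext fun K => ?_
  have h1 : (genOp i * genOp j + genOp j * genOp i) f K = genOp i (genOp j f) K +
    genOp j (genOp i f) K := rfl
  rw [h1, genOp_genOp, genOp_genOp]
  have a1 := zmod2_add_self (1 : ZMod 2)
  by_cases hij : i = j
  · subst hij
    rw [bil_single_single, if_pos le_rfl, ← add_assoc (Pi.single i 1), add_self_vec, zero_add]
    have h2 : (1 + bil (cliffMatrix n) (Pi.single i 1) K +
        (1 + (1 + bil (cliffMatrix n) (Pi.single i 1) K)) : ZMod 2) = 1 := by
      have a2 := zmod2_add_self (bil (cliffMatrix n) (Pi.single i 1) K)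
      linear_combination a1 + a2
    rw [h2, if_pos rfl, zsign_one]
    change -1 * f K + -1 * f K = -2 * f K
    ring
  · rw [if_neg hij, add_left_comm (Pi.single i 1) (Pi.single j 1) K, ← add_mul]
    have h2 : zsign (bil (cliffMatrix n) (Pi.single j 1) (Pi.single i 1)) =
        -zsign (bil (cliffMatrix n) (Pi.single i 1) (Pi.single j 1)) := by
      rw [bil_single_single, bil_single_single]
      rcases lt_or_gt_of_ne hij with h | h
      · simp [h.le, h.not_ge]
      · simp [h.le, h.not_ge]
    simp only [zsign_add, h2]
    change _ = (0 : ℂ)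
    ring

/-- The Clifford algebra acts on the functions on `𝔽₂^n`. -/
def cliffRep (n : ℕ) : Cliff n →ₐ[ℂ] Module.End ℂ ((Fin n → ZMod 2) → ℂ) :=
  CliffordAlgebra.lift (cliffForm n)
    ⟨∑ i, (LinearMap.toSpanSingleton ℂ _ (genOp i)) ∘ₗ LinearMap.proj i, fun v => by
      have h1 : (∑ i, (LinearMap.toSpanSingleton ℂ _ (genOp i)) ∘ₗ LinearMap.proj i) v =
          ∑ i, v i • genOp i := by simp
      rw [h1]
      -- Doubling the square allows it to be symmetrised into anticommutators, which are known.
      have h2 : (2 : ℂ) • ((∑ i, v i • genOp i) * ∑ i, v i • genOp i) =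
          (2 : ℂ) • algebraMap ℂ _ (cliffForm n v) := by
        have h3 : (∑ i, v i • genOp i) * ∑ j, v j • genOp j =
            ∑ i, ∑ j, (v i * v j) • (genOp i * genOp j) := by
          rw [Finset.sum_mul_sum]
          refine Finset.sum_congr rfl fun i _ => Finset.sum_congr rfl fun j _ => ?_
          rw [smul_mul_smul_comm]
        have h4 : (∑ i, v i • genOp i) * ∑ j, v j • genOp j =
            ∑ i, ∑ j, (v i * v j) • (genOp j * genOp i) := by
          rw [h3, Finset.sum_comm]
          refine Finset.sum_congr rfl fun i _ => Finset.sum_congr rfl fun j _ => ?_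
          rw [mul_comm (v j)]
        rw [two_smul]
        nth_rewrite 1 [h3]
        rw [h4]
        simp only [← Finset.sum_add_distrib, ← smul_add, genOp_anticomm]
        rw [Algebra.algebraMap_eq_smul_one, smul_smul]
        simp only [smul_ite, smul_zero, Finset.sum_ite_eq, Finset.mem_univ, if_true, smul_smul,
          ← Finset.sum_smul]
        congr 1
        simp [cliffForm, Finset.mul_sum, mul_comm]
      exact smul_right_injective _ two_ne_zero h2⟩

theorem cliffRep_cliffGen (i : Fin n) : cliffRep n (cliffGen i) = genOp i := by
  rw [cliffRep, cliffGen, CliffordAlgebra.lift_ι_apply]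
  simp [Pi.single_apply]

/-- The monomials send one fixed vector to distinct basis vectors, hence they are linearly
independent. -/
theorem cliffRep_cliffMon (x : Fin n → ZMod 2) :
    cliffRep n (cliffMon x) (Pi.single 0 1) = Pi.single x 1 := by
  refine cliffMon_induction x (fun u v => cliffRep n u (Pi.single 0 1) = Pi.single v 1) ?_ ?_
  · simp
  · intro a u v h ih
    rw [map_mul, Module.End.mul_apply, ih, cliffRep_cliffGen]
    funext K
    have hK : Pi.single a 1 + K = v ↔ K = Pi.single a 1 + v := by
      constructor
      · rintro rfl; rw [← add_assoc, add_self_vec, zero_add]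
      · rintro rfl; rw [← add_assoc, add_self_vec, zero_add]
    simp only [genOp, LinearMap.coe_mk, AddHom.coe_mk, Pi.single_apply, hK]
    split_ifs with hk
    · rw [hK.mpr hk, h]; simp
    · simp

theorem cliffMon_linearIndependent : LinearIndependent ℂ (cliffMon (n := n)) := by
  have h := (Pi.basisFun ℂ (Fin n → ZMod 2)).linearIndependent
  have e : (Pi.basisFun ℂ (Fin n → ZMod 2) : _ → (Fin n → ZMod 2) → ℂ) =
      ((LinearMap.applyₗ (R := ℂ) (Pi.single 0 1 : (Fin n → ZMod 2) → ℂ)) ∘ₗ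
        (cliffRep n).toLinearMap) ∘ cliffMon := by
    funext x
    simp [cliffRep_cliffMon]
  rw [e] at h
  exact h.of_comp _

/-- The span contains 1 and is stable under left multiplication by the generators. -/
theorem cliffMon_span : ⊤ ≤ Submodule.span ℂ (Set.range (cliffMon (n := n))) := by
  have hmul : ∀ u ∈ Submodule.span ℂ (Set.range (cliffMon (n := n))), ∀ v : Fin n → ℂ,
      CliffordAlgebra.ι (cliffForm n) v * u ∈ Submodule.span ℂ (Set.range (cliffMon (n := n))) := by
    intro u hu v
    have hv : CliffordAlgebra.ι (cliffForm n) v = ∑ i, v i • cliffGen i := by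
      conv_lhs => rw [← Finset.univ_sum_single v, map_sum]
      refine Finset.sum_congr rfl fun i _ => ?_
      rw [cliffGen, ← map_smul, ← Pi.single_smul, smul_eq_mul, mul_one]
    rw [hv, Finset.sum_mul]
    refine Submodule.sum_mem _ fun i _ => ?_
    rw [smul_mul_assoc]
    refine Submodule.smul_mem _ _ ?_
    induction hu using Submodule.span_induction with
    | mem u hu =>
      obtain ⟨y, rfl⟩ := hu
      rw [cliffGen_mul_cliffMon]
      exact Submodule.smul_mem _ _ (Submodule.subset_span ⟨_, rfl⟩)
    | zero => simp
    | add a b _ _ ha hb => rw [mul_add]; exact Submodule.add_mem _ ha hb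
    | smul c a _ ha => rw [mul_smul_comm]; exact Submodule.smul_mem _ _ ha
  intro u _
  have h1 : (1 : Cliff n) ∈ Submodule.span ℂ (Set.range (cliffMon (n := n))) :=
    Submodule.subset_span ⟨0, cliffMon_zero⟩
  have : ∀ w ∈ Submodule.span ℂ (Set.range (cliffMon (n := n))),
      u * w ∈ Submodule.span ℂ (Set.range (cliffMon (n := n))) := by
    induction u using CliffordAlgebra.induction with
    | algebraMap c =>
      intro w hw
      rw [← Algebra.smul_def]
      exact Submodule.smul_mem _ _ hw
    | ι v => exact fun w hw => hmul w hw v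
    | mul a b ha hb => intro w hw; rw [mul_assoc]; exact ha trivial _ (hb trivial _ hw)
    | add a b ha hb =>
      intro w hw; rw [add_mul]; exact Submodule.add_mem _ (ha trivial _ hw) (hb trivial _ hw)
  simpa using this 1 h1

/-- The basis of the Clifford algebra by the monomials `e_I`. -/
def cliffBasis (n : ℕ) : Module.Basis (Fin n → ZMod 2) ℂ (Cliff n) :=
  Module.Basis.mk cliffMon_linearIndependent cliffMon_span

@[simp] theorem cliffBasis_apply (x : Fin n → ZMod 2) : cliffBasis n x = cliffMon x := by
  simp [cliffBasis]

theorem cliffOp_cliffMon (k : ZMod 2) (x : Fin n → ZMod 2) (s : Equiv.Perm (Fin n))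
    (J : Fin n → ZMod 2) : cliffOp k x s (cliffMon J) =
      zsign (k + inversions s J + bil (cliffMatrix n) x (J ∘ s.symm)) •
        cliffMon (x + J ∘ s.symm) := by
  change zsign k • (cliffMon x * CliffordAlgebra.map (permIsometry s) (cliffMon J)) = _
  rw [map_cliffMon, mul_smul_comm, cliffMon_mul_cliffMon, smul_smul, smul_smul, zsign_add,
    zsign_add, mul_assoc]

/-- The operator permutes the monomial basis up to signs, so only the fixed monomials contribute. -/
theorem trace_cliffOp (k : ZMod 2) (x : Fin n → ZMod 2) (s : Equiv.Perm (Fin n)) :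
    LinearMap.trace ℂ (Cliff n) (cliffOp k x s) =
      ∑ J : Fin n → ZMod 2, if x + J ∘ s.symm = J then
        zsign (k + inversions s J + bil (cliffMatrix n) x (J ∘ s.symm)) else 0 := by
  rw [LinearMap.trace_eq_matrix_trace ℂ (cliffBasis n), Matrix.trace]
  refine Finset.sum_congr rfl fun J _ => ?_
  rw [Matrix.diag_apply, LinearMap.toMatrix_apply, cliffBasis_apply, cliffOp_cliffMon,
    ← cliffBasis_apply, map_smul, Module.Basis.repr_self, Finsupp.smul_apply,
    Finsupp.single_apply]
  split_ifs <;> simp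

end Clifford

end SpinWreath

end

noncomputable section

namespace SpinWreath

/-! ### The values of the basic spin characters -/

/-- The character of a tensor power of a matrix representation on `Γ^n ⋊ S_n`. -/
def tensorChar {Γ : Type*} {κ : Type} [Fintype κ] (R : Γ → Matrix κ κ ℂ) {A : Type} [Fintype A]
    [DecidableEq A] (g : A → Γ) (s : Equiv.Perm A) : ℂ :=
  ∑ b : A → κ, ∏ a, R (g a) (b a) (b (s.symm a))

/-- The trivial characters. -/
def oneFun (Γ : Type*) : WreathFun Γ := fun _ _ _ => 1

theorem oneFun_isClass (Γ : Type*) : (oneFun Γ).IsClass := fun _ _ _ _ => rfl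

section

variable {Γ : Type*} [Group Γ] {r : ℕ} (I : IrrepList Γ r) (β : Fin (r + 1) → ℕ) {n : ℕ}

theorem tensorOp_tprod (g : Fin n → Γ) (s : Equiv.Perm (Fin n)) (v : Fin n → I.SumSpace β) :
    I.tensorOp β g s (PiTensorProduct.tprod ℂ v) =
      PiTensorProduct.tprod ℂ fun a => I.sumRep β (g a) (v (s.symm a)) := by
  simp [IrrepList.tensorOp]

theorem sumRep_mul (g h : Γ) : I.sumRep β (g * h) = I.sumRep β g ∘ₗ I.sumRep β h := by
  refine LinearMap.ext fun v => funext fun i => funext fun c => ?_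
  simp [IrrepList.sumRep, LinearMap.piMap]

theorem tensorOp_mul (g g' : Fin n → Γ) (s s' : Equiv.Perm (Fin n)) :
    I.tensorOp β (g * g' ∘ s.symm) (s * s') = I.tensorOp β g s ∘ₗ I.tensorOp β g' s' := by
  refine PiTensorProduct.ext (MultilinearMap.ext fun v => ?_)
  simp [tensorOp_tprod, sumRep_mul]
  rfl

theorem trace_tensorOp {κ : Type} [Fintype κ] [DecidableEq κ]
    (b : Module.Basis κ ℂ (I.SumSpace β)) (g : Fin n → Γ) (s : Equiv.Perm (Fin n)) :
    LinearMap.trace ℂ _ (I.tensorOp β g s) =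
      tensorChar (fun x => LinearMap.toMatrix b b (I.sumRep β x)) g s := by
  classical
  rw [LinearMap.trace_eq_matrix_trace ℂ (Basis.piTensorProduct fun _ : Fin n => b), Matrix.trace,
    tensorChar]
  refine Finset.sum_congr rfl fun p _ => ?_
  rw [Matrix.diag_apply, LinearMap.toMatrix_apply, Basis.piTensorProduct_apply, tensorOp_tprod,
    Basis.piTensorProduct_repr_tprod_apply]
  simp [LinearMap.toMatrix_apply]

/-- The operator of an element of `Γ̃_n` on the basic spin supermodule. -/
def basicOp (x : SpinGroup Γ n) : Module.End ℂ ((⨂[ℂ] _ : Fin n, I.SumSpace β) ⊗[ℂ] Cliff n) :=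
  TensorProduct.map (I.tensorOp β x.left.1 x.right)
    (cliffOp x.left.2.sgn x.left.2.vec x.right)

/-- On monomials the signs agree by `inversions_add`, the same identity that makes $S_n$ act on
$\Pi_n$ by automorphisms. -/
theorem cliffOp_mul (x y : SpinGroup Γ n) :
    cliffOp (x * y).left.2.sgn (x * y).left.2.vec (x * y).right =
      cliffOp x.left.2.sgn x.left.2.vec x.right ∘ₗ cliffOp y.left.2.sgn y.left.2.vec y.right := by
  refine (cliffBasis n).ext fun J => ?_
  rw [cliffBasis_apply, LinearMap.comp_apply, cliffOp_cliffMon, cliffOp_cliffMon, map_smul,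
    cliffOp_cliffMon, smul_smul, ← zsign_add]
  have h1 : (x * y).left.2.vec + J ∘ (x * y).right.symm =
      x.left.2.vec + (y.left.2.vec + J ∘ y.right.symm) ∘ x.right.symm := by
    funext i
    simp [add_assoc]
    rfl
  have h2 : (x * y).left.2.sgn + inversions (x * y).right J +
      bil (cliffMatrix n) (x * y).left.2.vec (J ∘ (x * y).right.symm) =
      y.left.2.sgn + inversions y.right J + bil (cliffMatrix n) y.left.2.vec (J ∘ y.right.symm) +
      (x.left.2.sgn + inversions x.right (y.left.2.vec + J ∘ y.right.symm) +
        bil (cliffMatrix n) x.left.2.vec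
          ((y.left.2.vec + J ∘ y.right.symm) ∘ x.right.symm)) := by
    have a1 : J ∘ (x * y).right.symm = (J ∘ y.right.symm) ∘ x.right.symm := rfl
    have a2 : (y.left.2.vec + J ∘ y.right.symm) ∘ x.right.symm =
      y.left.2.vec ∘ x.right.symm + (J ∘ y.right.symm) ∘ x.right.symm := rfl
    have a3 := inversions_add x.right y.left.2.vec (J ∘ y.right.symm)
    rw [a1, a2]
    simp only [SemidirectProduct.mul_left, SemidirectProduct.mul_right, Prod.snd_mul,
      SignExt.mul_sgn, SignExt.mul_vec, permAction_sgn, permAction_vec, inversions_mul,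
      bil_add_left, bil_add_right]
    linear_combination -a3
  rw [h1, h2]

theorem basicOp_mul (x y : SpinGroup Γ n) : basicOp I β (x * y) = basicOp I β x * basicOp I β y := by
  unfold basicOp
  rw [cliffOp_mul]
  change TensorProduct.map (I.tensorOp β (x.left.1 * y.left.1 ∘ x.right.symm) (x.right * y.right)) _ = _
  rw [tensorOp_mul, TensorProduct.map_comp]
  rfl

theorem basicChar_mem (n : ℕ) : basicChar I β n ∈ SpinFun Γ n := by
  refine ⟨fun x y => ?_, fun x => ?_, basicChar_odd I β n⟩
  · change LinearMap.trace ℂ _ (basicOp I β (y * x * y⁻¹)) =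
      LinearMap.trace ℂ _ (basicOp I β x)
    rw [mul_assoc, basicOp_mul, LinearMap.trace_mul_comm, ← basicOp_mul, inv_mul_cancel_right]
  · change LinearMap.trace ℂ _ (basicOp I β (zElt n * x)) =
      -LinearMap.trace ℂ _ (basicOp I β x)
    have h1 : (zElt n * x).left.1 = x.left.1 := by
      funext i; simp
    have h2 : (zElt n * x).left.2.sgn = 1 + x.left.2.sgn := by
      simp [bil_zero_left]
    have h3 : (zElt n * x).left.2.vec = x.left.2.vec := by
      funext i; simp
    have h4 : (zElt n * x).right = x.right := by simp
    have h5 : ∀ k v s, cliffOp (n := n) (1 + k) v s = (-1 : ℂ) • cliffOp k v s := by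
      intro k v s
      change zsign (1 + k) • _ = (-1 : ℂ) • (zsign k • _)
      rw [zsign_add, zsign_one, smul_smul]
    unfold basicOp
    rw [h1, h2, h3, h4, h5, TensorProduct.map_smul_right, map_smul, smul_eq_mul, neg_one_mul]

/-- The basic spin characters as a family of spin functions. -/
def basicFam (n : ℕ) : SpinFun Γ n := ⟨basicChar I β n, basicChar_mem I β n⟩

theorem basicChar_eq {κ : Type} [Fintype κ] [DecidableEq κ]
    (b : Module.Basis κ ℂ (I.SumSpace β)) (x : SpinGroup Γ n) :
    basicChar I β n x =
      tensorChar (fun x => LinearMap.toMatrix b b (I.sumRep β x)) x.left.1 x.right *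
        LinearMap.trace ℂ (Cliff n) (cliffOp x.left.2.sgn x.left.2.vec x.right) := by
  have := Module.Free.of_basis (cliffBasis n)
  have := Module.Finite.of_basis (cliffBasis n)
  have := Module.Free.of_basis (Basis.piTensorProduct fun _ : Fin n => b)
  have := Module.Finite.of_basis (Basis.piTensorProduct fun _ : Fin n => b)
  rw [basicChar, LinearMap.trace_tensorProduct', trace_tensorOp I β b]

theorem indicator_injective {A : Type} [DecidableEq A] :
    Function.Injective (indicator : Finset A → A → ZMod 2) := by
  intro C D h
  ext a
  have := congrFun h a
  by_cases h1 : a ∈ C <;> by_cases h2 : a ∈ D <;> simp_all [indicator]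

theorem indicator_surjective {A : Type} [DecidableEq A] [Fintype A] :
    Function.Surjective (indicator : Finset A → A → ZMod 2) := by
  intro x
  refine ⟨Finset.univ.filter fun a => x a = 1, funext fun a => ?_⟩
  rcases zmod2_cases (x a) with h | h <;> simp [indicator, h]

theorem indicator_comp_symm_iff (s : Equiv.Perm (Fin n)) (C : Finset (Fin n)) :
    indicator C ∘ s.symm = indicator C ↔ Stable s C := by
  constructor
  · intro h a
    have := congrFun h (s a)
    simp only [Function.comp_apply, Equiv.symm_apply_apply] at this
    by_cases h1 : a ∈ C <;> by_cases h2 : s a ∈ C <;> simp_all [indicator]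
  · intro h
    funext i
    have := h (s.symm i)
    rw [Equiv.apply_symm_apply] at this
    simp [indicator, this]

theorem evOn_oneFun (Γ : Type*) {A : Type} (g : A → Γ) (s : Equiv.Perm A) (S : Finset A)
    (h : Stable s S) : evOn (oneFun Γ) g s S = 1 := dif_pos h

-- The monomials fixed up to sign are the $e_C$ with `C` stable, and the sign is that of `s` on `C`:
-- this is the trace of `s` on an exterior algebra.
omit [Group Γ] in
theorem trace_cliffOp_wElt (g : Fin n → Γ) (s : Equiv.Perm (Fin n)) :
    LinearMap.trace ℂ (Cliff n) (cliffOp 0 0 s) = conv (signFun Γ) (oneFun Γ) n g s := by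
  have hb : Function.Bijective (indicator (A := Fin n)) :=
    ⟨indicator_injective, indicator_surjective⟩
  rw [trace_cliffOp, conv,
    ← (Equiv.ofBijective (indicator (A := Fin n)) hb).sum_comp]
  refine Finset.sum_congr rfl fun C _ => ?_
  split_ifs with hC <;> rw [Equiv.ofBijective_apply, zero_add, indicator_comp_symm_iff] at hC
  · rw [Equiv.ofBijective_apply, evOn_oneFun Γ _ _ _ hC.compl, mul_one, zero_add, bil_zero_left,
      add_zero, zsign_inversions g s C hC]
  · rw [evOn_of_not_stable _ _ _ _ hC, zero_mul]

theorem toWreath_basicFam {κ : Type} [Fintype κ] [DecidableEq κ]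
    (b : Module.Basis κ ℂ (I.SumSpace β)) (g : Fin n → Γ) (s : Equiv.Perm (Fin n)) :
    toWreath (basicFam I β) n g s =
      tensorChar (fun x => LinearMap.toMatrix b b (I.sumRep β x)) g s *
        conv (signFun Γ) (oneFun Γ) n g s := by
  rw [← trace_cliffOp_wElt g]
  exact basicChar_eq I β b (wElt g s)

/-- The matrices of the `i`-th irreducible representation. -/
def irrMat (i : Fin (r + 1)) (x : Γ) : Matrix (Fin (I.dim i)) (Fin (I.dim i)) ℂ :=
  LinearMap.toMatrix' (I.rep i x)

/-- The summand of multiplicity one of `SumSpace` is everything. -/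
def sumSpaceEquiv (i : Fin (r + 1)) (h1 : β i = 1) (h0 : ∀ j, j ≠ i → β j = 0) :
    I.SumSpace β ≃ₗ[ℂ] (Fin (I.dim i) → ℂ) :=
  LinearEquiv.ofBijective
    { toFun := fun v : I.SumSpace β => v i ⟨0, by omega⟩
      map_add' := fun _ _ => rfl
      map_smul' := fun _ _ => rfl }
    ⟨by
      rw [injective_iff_map_eq_zero]
      intro v hv
      funext j c
      by_cases hj : j = i
      · subst hj
        have : c = ⟨0, by omega⟩ := Fin.ext (by have := c.2; omega)
        rw [this]
        exact hv
      · exact absurd c.2 (by have := h0 j hj; omega),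
    fun w => ⟨Pi.single i fun _ => w, by
      change (Pi.single i (fun _ => w) : I.SumSpace β) i _ = w
      rw [Pi.single_eq_same]⟩⟩

/-- The basis of `SumSpace` when only one multiplicity is nonzero. -/
def sumSpaceBasis (i : Fin (r + 1)) (h1 : β i = 1) (h0 : ∀ j, j ≠ i → β j = 0) :
    Module.Basis (Fin (I.dim i)) ℂ (I.SumSpace β) :=
  Module.Basis.ofEquivFun (sumSpaceEquiv I β i h1 h0)

theorem toMatrix_sumSpaceBasis (i : Fin (r + 1)) (h1 : β i = 1) (h0 : ∀ j, j ≠ i → β j = 0)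
    (x : Γ) : LinearMap.toMatrix (sumSpaceBasis I β i h1 h0) (sumSpaceBasis I β i h1 h0)
      (I.sumRep β x) = irrMat I i x := by
  have key : ∀ v, sumSpaceEquiv I β i h1 h0 (I.sumRep β x v) =
      I.rep i x (sumSpaceEquiv I β i h1 h0 v) := fun v => rfl
  ext c d
  rw [LinearMap.toMatrix_apply, sumSpaceBasis, Module.Basis.ofEquivFun_repr_apply, key,
    Module.Basis.coe_ofEquivFun, LinearEquiv.apply_symm_apply, irrMat, LinearMap.toMatrix'_apply]

/-- The family `χ_n(γ_i)` restricted to `Γ^n ⋊ S_n`. -/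
def spinWreath (i : Fin (r + 1)) : WreathFun Γ := fun n g s =>
  tensorChar (irrMat I i) g s * conv (signFun Γ) (oneFun Γ) n g s

theorem toWreath_basicFam_single (i : Fin (r + 1)) (h1 : β i = 1) (h0 : ∀ j, j ≠ i → β j = 0) :
    toWreath (basicFam I β) = spinWreath I i := by
  funext n g s
  rw [toWreath_basicFam I β (sumSpaceBasis I β i h1 h0)]
  simp only [toMatrix_sumSpaceBasis]
  rfl

/-- For $V=0$ the positive tensor powers vanish and the zeroth is a line; this family is the unit
for `conv`. -/
theorem toWreath_basicFam_zero (n : ℕ) (g : Fin n → Γ) (s : Equiv.Perm (Fin n)) :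
    toWreath (basicFam I 0) n g s = if n = 0 then 1 else 0 := by
  have : Subsingleton (I.SumSpace 0) := ⟨fun v w => funext fun i => funext fun c => c.elim0⟩
  rw [toWreath_basicFam I 0 (Module.Basis.empty (ι := Empty) _)]
  split_ifs with hn
  · subst hn
    have h2 : s = 1 := Subsingleton.elim _ _
    have h3 : evOn (signFun Γ) g s ∅ = 1 := by
      rw [evOn_eq (signFun_isClass Γ) (n := 0) (fun i => i) (fun i => i.elim0) (by simp) g
        (fun _ => rfl) s fun _ => rfl, signFun, h2]
      simp
    rw [tensorChar, conv, Fintype.sum_unique, Fintype.sum_unique, evOn_oneFun Γ _ _ _ fun a => a.elim0,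
      show (default : Finset (Fin 0)) = ∅ from rfl, h3]
    simp
  · have : IsEmpty (Fin n → Empty) := ⟨fun f => (f ⟨0, Nat.pos_of_ne_zero hn⟩).elim⟩
    simp [tensorChar]

end

end SpinWreath

end

noncomputable section

namespace SpinWreath

/-! ### The annihilation operators on functions on `Γ^n ⋊ S_n` -/

section

variable {Γ : Type*} [Group Γ] {κ : Type} [Fintype κ]

/-- The value of the tensor power character at the inverse element. -/
def tensorCharInv (R : Γ → Matrix κ κ ℂ) {A : Type} [Fintype A] [DecidableEq A] (g : A → Γ)
    (s : Equiv.Perm A) : ℂ := tensorChar R (fun a => (g (s a))⁻¹) s⁻¹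

variable [Fintype Γ]

/-- The pairing of the first `l` indices with a tensor power character. -/
def annihWreath (R : Γ → Matrix κ κ ℂ) (l : ℕ) (F : WreathFun Γ) : WreathFun Γ := fun n g s =>
  ((Fintype.card Γ ^ l * l.factorial : ℕ) : ℂ)⁻¹ * ∑ g₀ : Fin l → Γ, ∑ s₀ : Equiv.Perm (Fin l),
    tensorCharInv R g₀ s₀ * evOn F (Sum.elim g₀ g) (Equiv.sumCongr s₀ s)
      (Finset.univ : Finset (Fin l ⊕ Fin n))

variable {l p m : ℕ} (h : l + p = m)

omit [Fintype Γ] in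
theorem apply_embL_mul_embR_wElt (f : ∀ n, SpinFun Γ n) (g₀ : Fin l → Γ)
    (s₀ : Equiv.Perm (Fin l)) (g : Fin p → Γ) (s : Equiv.Perm (Fin p)) :
    (f m : SpinGroup Γ m → ℂ) (embL h (wElt g₀ s₀) * embR h (wElt g s)) =
      evOn (toWreath f) (Sum.elim g₀ g) (Equiv.sumCongr s₀ s) Finset.univ := by
  have h1 : embL h (wElt g₀ s₀) * embR h (wElt g s) =
      wElt (ext (leftIdx h) 1 g₀ * ext (rightIdx h) 1 g)
        (permExt (leftIdx h) s₀ * permExt (rightIdx h) s) := by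
    rw [embL_mul_embR]
    exact spinGroup_ext rfl (add_zero _) (ext_add_ext_comp h (0 : Fin m → ZMod 2)) rfl
  let e : Fin l ⊕ Fin p ↪ Fin m := ⟨Sum.elim (leftIdx h) (rightIdx h),
    (leftIdx h).injective.sumElim (rightIdx h).injective (leftIdx_ne_rightIdx h)⟩
  have he : Finset.univ.map e = Finset.univ := by
    ext b
    simp only [Finset.mem_map, Finset.mem_univ, true_and, iff_true]
    rcases leftIdx_or_rightIdx h b with ⟨i, rfl⟩ | ⟨j, rfl⟩
    · exact ⟨.inl i, rfl⟩
    · exact ⟨.inr j, rfl⟩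
  rw [h1]
  change toWreath f m _ _ = _
  rw [← evOn_univ (toWreath_isClass f), ← he]
  refine evOn_map (toWreath_isClass f) Finset.univ e ?_ ?_
  · rintro (i | j)
    · exact (ext_leftIdx_mul h _ _ i).symm
    · exact (ext_rightIdx_mul h _ _ j).symm
  · rintro (i | j)
    · exact (permExt_mul_leftIdx h _ _ i).symm
    · exact (permExt_mul_rightIdx h _ _ j).symm

-- The hypothesis on `J` says that `x` is conjugate by $a_J$ to $(g,s)$ times a power of $z$, whose
-- exponent is the one in `trace_cliffOp`. As `w` is even, its image commutes with that of $a_J$ and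
-- is untouched by the conjugation.
omit [Fintype Γ] in
theorem apply_embL_inv_mul_embR (f : SpinFun Γ m) (x : SpinGroup Γ l) (w : SpinGroup Γ p)
    (hw : parity w = 0) (J : Fin l → ZMod 2) (hJ : x.left.2.vec + J ∘ x.right.symm = J) :
    (f : SpinGroup Γ m → ℂ) (embL h x⁻¹ * embR h w) =
      zsign (x.left.2.sgn + inversions x.right J +
        bil (cliffMatrix l) x.left.2.vec (J ∘ x.right.symm)) *
      (f : SpinGroup Γ m → ℂ) (embL h (wElt x.left.1 x.right)⁻¹ * embR h w) := by
  set a : SpinGroup Γ l := ⟨(1, ⟨0, J⟩), 1⟩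
  set k := x.left.2.sgn + inversions x.right J +
        bil (cliffMatrix l) x.left.2.vec (J ∘ x.right.symm)
  set w₀ := wElt x.left.1 x.right
  have hcomm : ∀ b : SpinGroup Γ l, embL h b * embR h w = embR h w * embL h b := fun b => by
    rw [embL_mul_embR_comm, if_neg (by simp [hw]), one_mul]
  have e2 : ∀ y : SpinGroup Γ l, embL h (a * y⁻¹ * a⁻¹) * embR h w =
      embL h a * (embL h y⁻¹ * embR h w) * (embL h a)⁻¹ := by
    intro y
    rw [map_mul, mul_assoc, hcomm, map_mul, map_inv (embL (Γ := Γ) h) a]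
    simp only [mul_assoc]
  have hxa1 : (x * a).left.1 = (a * w₀).left.1 := by
    funext i; simp [a, w₀]
  have hxa2 : (x * a).left.2.sgn = k := by
    simp [a, k]
  have hxa2' : (a * w₀).left.2.sgn = 0 := by
    simp [a, w₀, bil_zero_right]
  have hxa3 : (x * a).left.2.vec = (a * w₀).left.2.vec := by
    have : (x * a).left.2.vec = x.left.2.vec + J ∘ x.right.symm := by simp [a]
    rw [this, hJ]; funext i; simp [a, w₀]
  have hxa4 : (x * a).right = (a * w₀).right := by simp [a, w₀]
  rcases zmod2_cases k with hk | hk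
  · have : x * a = a * w₀ := spinGroup_ext hxa1 (by rw [hxa2, hxa2', hk]) hxa3 hxa4
    have hx : x⁻¹ = a * w₀⁻¹ * a⁻¹ := by
      rw [inv_eq_iff_eq_inv, mul_inv_rev, mul_inv_rev, inv_inv, inv_inv, ← mul_assoc, ← this,
        mul_inv_cancel_right]
    rw [hk, zsign_zero, one_mul, hx, e2, f.2.1]
  · have : x * a = zElt l * (a * w₀) := by
      refine spinGroup_ext ?_ ?_ ?_ ?_
      · rw [hxa1]; funext i; simp
      · rw [hxa2, hk, SemidirectProduct.mul_left, Prod.snd_mul, SignExt.mul_sgn]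
        simp only [zElt_right, map_one, MulAut.one_apply, hxa2', zElt_left_sgn, zElt_left_vec,
          bil_zero_left, add_zero]
      · rw [hxa3]; funext i; simp
      · rw [hxa4]; simp
    have hx : x⁻¹ = a * w₀⁻¹ * a⁻¹ * zElt l := by
      have hz : (zElt l : SpinGroup Γ l)⁻¹ = zElt l := inv_eq_of_mul_eq_one_right (zElt_sq l)
      rw [inv_eq_iff_eq_inv, mul_inv_rev, mul_inv_rev, mul_inv_rev, inv_inv, inv_inv, hz,
        ← mul_assoc a, ← mul_assoc, ← this, mul_inv_cancel_right]
    have hzr : embL h (zElt l : SpinGroup Γ l) = zElt m := embed_zElt _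
    have e3 : embL h x⁻¹ * embR h w = zElt m * (embL h (a * w₀⁻¹ * a⁻¹) * embR h w) := by
      rw [hx, ← zElt_mul_comm, map_mul, hzr, mul_assoc]
    rw [hk, zsign_one, e3, f.2.2.1, e2, f.2.1, neg_one_mul]

/-- Inversion in `Γ^n ⋊ S_n`. -/
def wreathInv (n : ℕ) : ((Fin n → Γ) × Equiv.Perm (Fin n)) ≃ ((Fin n → Γ) × Equiv.Perm (Fin n)) :=
  Function.Involutive.toPerm (fun x => (fun a => (x.1 (x.2 a))⁻¹, x.2⁻¹)) fun x => by
    refine Prod.ext ?_ (inv_inv _)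
    funext a
    simp

/-- Frobenius reciprocity made explicit. The Clifford trace is a sum of signs over fixed `J`, and
for each such `J` the value of `f` carries the same sign relative to $\Gamma^l\rtimes S_l$. The
signs cancel, leaving the tensor character and the factor $2\cdot2^l$, which cancels the order of
$\Pi_l$. -/
theorem resPair_wElt {r : ℕ} (I : IrrepList Γ r) (β : Fin (r + 1) → ℕ) [DecidableEq κ]
    (b : Module.Basis κ ℂ (I.SumSpace β)) (f : ∀ n, SpinFun Γ n) (g : Fin p → Γ)
    (s : Equiv.Perm (Fin p)) :
    resPair h (basicChar I β l) (f m) (wElt g s) =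
      annihWreath (fun x => LinearMap.toMatrix b b (I.sumRep β x)) l (toWreath f) p g s := by
  classical
  set R := fun x => LinearMap.toMatrix b b (I.sumRep β x)
  set Θ : (Fin l → Γ) × Equiv.Perm (Fin l) → ℂ := fun x =>
    tensorChar R x.1 x.2 *
      (f m : SpinGroup Γ m → ℂ) (embL h (wElt x.1 x.2)⁻¹ * embR h (wElt g s))
  let δ : (Fin l → ZMod 2) → (Fin l → ZMod 2) → Equiv.Perm (Fin l) → ℂ := fun v J s₀ =>
    if v = J + J ∘ s₀.symm then 1 else 0
  -- Each `J` is fixed for exactly one vector `v`, so summing over `v` first leaves one term for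
  -- each of the $2^l$ choices of `J`.
  have hδ : ∀ J s₀, ∑ v, δ v J s₀ = 1 := fun J s₀ => by simp [δ]
  have h1 : ∀ x : SpinGroup Γ l, basicChar I β l x *
      (f m : SpinGroup Γ m → ℂ) (embL h x⁻¹ * embR h (wElt g s)) =
      ∑ J : Fin l → ZMod 2, δ x.left.2.vec J x.right * Θ (x.left.1, x.right) := by
    intro x
    rw [basicChar_eq I β b, trace_cliffOp, Finset.mul_sum, Finset.sum_mul]
    refine Finset.sum_congr rfl fun J _ => ?_
    have hiff : x.left.2.vec = J + J ∘ x.right.symm ↔ x.left.2.vec + J ∘ x.right.symm = J := by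
      constructor
      · intro hh; rw [hh, add_assoc, add_self_vec, add_zero]
      · intro hh
        have h6 := congrArg (· + J ∘ x.right.symm) hh
        rwa [add_assoc, add_self_vec, add_zero] at h6
    by_cases hJ : x.left.2.vec + J ∘ x.right.symm = J
    · simp only [δ]
      rw [if_pos hJ, if_pos (hiff.mpr hJ), one_mul,
        apply_embL_inv_mul_embR h (f m) x (wElt g s) (parity_wElt g s) J hJ]
      rw [mul_assoc, ← mul_assoc (zsign _), zsign_mul_self, one_mul]
    · simp only [δ]
      rw [if_neg hJ, if_neg fun hh => hJ (hiff.mp hh)]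
      simp
  have h2 : ∑ x : SpinGroup Γ l, basicChar I β l x *
      (f m : SpinGroup Γ m → ℂ) (embL h x⁻¹ * embR h (wElt g s)) =
      (2 * 2 ^ l : ℕ) * ∑ x, Θ x := by
    rw [Finset.sum_congr rfl fun x _ => h1 x,
      ← Equiv.sum_comp (SemidirectProduct.equivProd (φ := permAction Γ l)).symm,
      Fintype.sum_prod_type, Fintype.sum_prod_type, Fintype.sum_prod_type, Finset.mul_sum]
    refine Finset.sum_congr rfl fun g₀ _ => ?_
    rw [Finset.sum_comm, Finset.mul_sum]
    refine Finset.sum_congr rfl fun s₀ _ => ?_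
    rw [← Equiv.sum_comp (SignExt.equivProd (cliffMatrix l)).symm, Fintype.sum_prod_type]
    simp only [SemidirectProduct.equivProd, SignExt.equivProd, Equiv.coe_fn_symm_mk]
    have h3 : ∑ v : Fin l → ZMod 2, ∑ J : Fin l → ZMod 2, δ v J s₀ * Θ (g₀, s₀) =
        (2 ^ l : ℕ) * Θ (g₀, s₀) := by
      rw [Finset.sum_comm, Finset.sum_congr rfl fun J _ => by rw [← Finset.sum_mul, hδ, one_mul]]
      simp
    refine (Finset.sum_congr rfl fun k _ => h3).trans ?_
    simp
    ring
  have h4 : ∑ x, Θ x = ∑ g₀ : Fin l → Γ, ∑ s₀ : Equiv.Perm (Fin l), tensorCharInv R g₀ s₀ *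
      evOn (toWreath f) (Sum.elim g₀ g) (Equiv.sumCongr s₀ s) Finset.univ := by
    rw [← Equiv.sum_comp (wreathInv l), Fintype.sum_prod_type]
    refine Finset.sum_congr rfl fun g₀ _ => Finset.sum_congr rfl fun s₀ _ => ?_
    have h5 : (wElt (wreathInv l (g₀, s₀)).1 (wreathInv l (g₀, s₀)).2)⁻¹ = wElt g₀ s₀ := by
      have : wElt (wreathInv l (g₀, s₀)).1 (wreathInv l (g₀, s₀)).2 = (wElt g₀ s₀)⁻¹ :=
        (wElt_inv g₀ s₀).symm
      rw [this, inv_inv]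
    simp only [Θ]
    rw [h5, apply_embL_mul_embR_wElt]
    rfl
  unfold resPair annihWreath
  rw [h2, h4, ← mul_assoc]
  congr 1
  rw [card_spinGroup, card_base]
  push_cast
  have hc : (2 * 2 ^ l : ℂ) ≠ 0 := mul_ne_zero two_ne_zero (pow_ne_zero _ two_ne_zero)
  have h7 : ∀ a b c : ℂ, b ≠ 0 → (a * b * c)⁻¹ * b = (a * c)⁻¹ := by
    intro a b c hb
    rw [mul_right_comm, mul_inv, mul_assoc, inv_mul_cancel₀ hb, mul_one]
  exact h7 _ _ _ hc

end

end SpinWreath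

end

noncomputable section

namespace SpinWreath

/-! ### Multiplicative families -/

section

variable {Γ : Type*} {A B : Type}

/-- A family of class functions which is multiplicative for disjoint unions of index sets. -/
structure WreathFun.IsMult (F : WreathFun Γ) : Prop where
  isClass : F.IsClass
  map_zero : ∀ g s, F 0 g s = 1
  map_add : ∀ l p (g₀ : Fin l → Γ) (s₀ : Equiv.Perm (Fin l)) (g : Fin p → Γ)
    (s : Equiv.Perm (Fin p)), evOn F (Sum.elim g₀ g) (Equiv.sumCongr s₀ s) Finset.univ =
      F l g₀ s₀ * F p g s

theorem univ_map_sumMap {C D : Type} [Fintype A] [Fintype B] {S : Finset C} {T : Finset D}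
    (e : A ↪ C) (e' : B ↪ D) (h : Finset.univ.map e = S) (h' : Finset.univ.map e' = T) :
    Finset.univ.map (e.sumMap e') = S.disjSum T := by
  subst h h'
  ext (c | d) <;> simp

theorem WreathFun.IsMult.evOn_disjSum {F : WreathFun Γ} (hF : F.IsMult) (g₀ : A → Γ)
    (s₀ : Equiv.Perm A) (g : B → Γ) (s : Equiv.Perm B) (S : Finset A) (T : Finset B) :
    evOn F (Sum.elim g₀ g) (Equiv.sumCongr s₀ s) (S.disjSum T) =
      evOn F g₀ s₀ S * evOn F g s T := by
  by_cases hS : Stable s₀ S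
  swap
  · rw [evOn_of_not_stable _ _ _ _ hS, evOn_of_not_stable, zero_mul]
    exact fun h => hS (stable_disjSum.mp h).1
  by_cases hT : Stable s T
  swap
  · rw [evOn_of_not_stable _ g _ _ hT, evOn_of_not_stable, mul_zero]
    exact fun h => hT (stable_disjSum.mp h).2
  obtain ⟨e, s', hs', he⟩ := exists_restrict hS
  obtain ⟨f, t', ht', hf⟩ := exists_restrict hT
  have h1 : evOn F g₀ s₀ S = F _ (g₀ ∘ e) s' := by
    rw [← congrArg (evOn F g₀ s₀) he,
      evOn_map hF.isClass Finset.univ e (g' := g₀ ∘ e) (fun _ => rfl) hs', evOn_univ hF.isClass]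
  have h2 : evOn F g s T = F _ (g ∘ f) t' := by
    rw [← congrArg (evOn F g s) hf,
      evOn_map hF.isClass Finset.univ f (g' := g ∘ f) (fun _ => rfl) ht', evOn_univ hF.isClass]
  rw [h1, h2, ← hF.map_add, ← congrArg (evOn F _ _) (univ_map_sumMap e f he hf)]
  refine evOn_map hF.isClass Finset.univ _ ?_ ?_
  · rintro (i | j) <;> rfl
  · rintro (i | j)
    · exact congrArg Sum.inl (hs' i)
    · exact congrArg Sum.inr (ht' j)

theorem WreathFun.IsMult.evOn_empty {F : WreathFun Γ} (hF : F.IsMult) (g : A → Γ)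
    (s : Equiv.Perm A) : evOn F g s ∅ = 1 := by
  rw [evOn_eq hF.isClass (n := 0) (fun i => i.elim0) (fun i => i.elim0) (by simp)
    (fun i => i.elim0) (fun i => i.elim0) 1 (fun i => i.elim0), hF.map_zero]

theorem WreathFun.IsMult.evOn_union [DecidableEq A] {F : WreathFun Γ} (hF : F.IsMult) {g : A → Γ}
    {s : Equiv.Perm A} {S T : Finset A} (hS : Stable s S) (hT : Stable s T)
    (h : Disjoint S T) : evOn F g s (S ∪ T) = evOn F g s S * evOn F g s T := by
  obtain ⟨e, s', hs', he⟩ := exists_restrict hS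
  obtain ⟨f, t', ht', hf⟩ := exists_restrict hT
  let k : Fin S.card ⊕ Fin T.card ↪ A := ⟨Sum.elim e f, e.injective.sumElim f.injective
    fun i j hij => Finset.disjoint_left.mp h
      (show e i ∈ S from he.le (Finset.mem_map_of_mem e (Finset.mem_univ i)))
      (show e i ∈ T by rw [hij]; exact hf.le (Finset.mem_map_of_mem f (Finset.mem_univ j)))⟩
  have hk : Finset.univ.map k = S ∪ T := by
    have he' : ∀ a, a ∈ S ↔ ∃ i, e i = a := fun a => by
      rw [← congrArg (a ∈ ·) he]; simp
    have hf' : ∀ a, a ∈ T ↔ ∃ i, f i = a := fun a => by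
      rw [← congrArg (a ∈ ·) hf]; simp
    ext a
    rw [Finset.mem_union, he', hf']
    simp [k]
  have h1 : evOn F g s S = F _ (g ∘ e) s' := by
    rw [← congrArg (evOn F g s) he,
      evOn_map hF.isClass Finset.univ e (g' := g ∘ e) (fun _ => rfl) hs', evOn_univ hF.isClass]
  have h2 : evOn F g s T = F _ (g ∘ f) t' := by
    rw [← congrArg (evOn F g s) hf,
      evOn_map hF.isClass Finset.univ f (g' := g ∘ f) (fun _ => rfl) ht', evOn_univ hF.isClass]
  rw [h1, h2, ← hF.map_add, ← hk]
  refine evOn_map hF.isClass Finset.univ _ ?_ ?_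
  · rintro (i | j) <;> rfl
  · rintro (i | j)
    · exact hs' i
    · exact ht' j

/-- Criterion for a family defined uniformly for all index sets. -/
theorem isMult_of_natural (F : ∀ (A : Type) [Fintype A] [DecidableEq A], (A → Γ) →
      Equiv.Perm A → ℂ)
    (hmap : ∀ (A B : Type) [Fintype A] [DecidableEq A] [Fintype B] [DecidableEq B] (e : A ≃ B)
      (g : A → Γ) (s : Equiv.Perm A), F B (g ∘ e.symm) (e.permCongr s) = F A g s)
    (hzero : ∀ g s, F (Fin 0) g s = 1)
    (hadd : ∀ (A B : Type) [Fintype A] [DecidableEq A] [Fintype B] [DecidableEq B]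
      (g₀ : A → Γ) (s₀ : Equiv.Perm A) (g : B → Γ) (s : Equiv.Perm B),
      F (A ⊕ B) (Sum.elim g₀ g) (Equiv.sumCongr s₀ s) = F A g₀ s₀ * F B g s) :
    WreathFun.IsMult (fun n g s => F (Fin n) g s : WreathFun Γ) := by
  have hcl : WreathFun.IsClass (fun n g s => F (Fin n) g s : WreathFun Γ) :=
    fun n g s π => hmap (Fin n) (Fin n) π g s
  refine ⟨hcl, hzero, fun l p g₀ s₀ g s => ?_⟩
  have h1 := evOn_eq hcl (g := Sum.elim g₀ g) (s := Equiv.sumCongr s₀ s) (S := Finset.univ)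
    finSumFinEquiv.symm finSumFinEquiv.symm.injective
    (fun a => ⟨fun _ => ⟨finSumFinEquiv a, by simp⟩, fun _ => Finset.mem_univ _⟩)
    (Sum.elim g₀ g ∘ finSumFinEquiv.symm) (fun _ => rfl)
    (finSumFinEquiv.permCongr (Equiv.sumCongr s₀ s)) (fun i => by
      rw [Equiv.permCongr_apply, Equiv.symm_apply_apply])
  rw [h1, hmap, hadd]

theorem signFun_isMult (Γ : Type*) : (signFun Γ).IsMult := by
  refine isMult_of_natural (fun A _ _ _ s => ((Equiv.Perm.sign s : ℤ) : ℂ)) ?_ ?_ ?_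
  · intro A B _ _ _ _ e g s
    rw [Equiv.Perm.sign_permCongr]
  · intro g s
    rw [Subsingleton.elim s 1]
    simp
  · intro A B _ _ _ _ g₀ s₀ g s
    have := Equiv.Perm.sign_sumCongr s₀ s
    rw [show Equiv.sumCongr s₀ s = Equiv.Perm.sumCongr s₀ s from rfl, this]
    push_cast
    rfl

theorem oneFun_isMult (Γ : Type*) : (oneFun Γ).IsMult :=
  isMult_of_natural (fun _ _ _ _ _ => 1) (fun _ _ _ _ _ _ _ _ _ => rfl) (fun _ _ => rfl)
    (fun _ _ _ _ _ _ _ _ _ _ => (one_mul 1).symm)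

theorem tensorChar_permCongr {κ : Type} [Fintype κ] (R : Γ → Matrix κ κ ℂ) [Fintype A]
    [DecidableEq A] [Fintype B] [DecidableEq B] (e : A ≃ B) (g : A → Γ) (s : Equiv.Perm A) :
    tensorChar R (g ∘ e.symm) (e.permCongr s) = tensorChar R g s := by
  unfold tensorChar
  rw [← Equiv.sum_comp (Equiv.arrowCongr e (Equiv.refl κ))]
  refine Finset.sum_congr rfl fun b _ => ?_
  rw [← Equiv.prod_comp e]
  refine Finset.prod_congr rfl fun a _ => ?_
  have h : (e.permCongr s).symm (e a) = e (s.symm a) := by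
    rw [Equiv.symm_apply_eq]; simp
  simp [h]

theorem tensorChar_sumCongr {κ : Type} [Fintype κ] (R : Γ → Matrix κ κ ℂ) [Fintype A]
    [DecidableEq A] [Fintype B] [DecidableEq B] (g₀ : A → Γ) (s₀ : Equiv.Perm A) (g : B → Γ)
    (s : Equiv.Perm B) :
    tensorChar R (Sum.elim g₀ g) (Equiv.sumCongr s₀ s) = tensorChar R g₀ s₀ * tensorChar R g s := by
  unfold tensorChar
  rw [← Equiv.sum_comp (Equiv.sumArrowEquivProdArrow A B κ).symm, Fintype.sum_prod_type,
    Finset.sum_mul_sum]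
  refine Finset.sum_congr rfl fun b _ => Finset.sum_congr rfl fun c _ => ?_
  rw [Fintype.prod_sum_type]
  simp [Equiv.sumArrowEquivProdArrow]

/-- The characters of the tensor powers of a matrix representation. -/
def tensorFun {κ : Type} [Fintype κ] (R : Γ → Matrix κ κ ℂ) : WreathFun Γ :=
  fun _ g s => tensorChar R g s

theorem tensorFun_isMult {κ : Type} [Fintype κ] (R : Γ → Matrix κ κ ℂ) : (tensorFun R).IsMult :=
  isMult_of_natural (fun _ _ _ g s => tensorChar R g s)
    (fun _ _ _ _ _ _ e g s => tensorChar_permCongr R e g s) (fun g s => by simp [tensorChar])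
    (fun _ _ _ _ _ _ g₀ s₀ g s => tensorChar_sumCongr R g₀ s₀ g s)

/-- The values of the characters of tensor powers at inverse elements. -/
def tensorInvFun [Group Γ] {κ : Type} [Fintype κ] (R : Γ → Matrix κ κ ℂ) : WreathFun Γ :=
  fun _ g s => tensorCharInv R g s

theorem tensorInvFun_isMult [Group Γ] {κ : Type} [Fintype κ] (R : Γ → Matrix κ κ ℂ) :
    (tensorInvFun R).IsMult := by
  refine isMult_of_natural (fun _ _ _ g s => tensorCharInv R g s) ?_ (fun g s => ?_) ?_
  · intro A B _ _ _ _ e g s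
    unfold tensorCharInv
    rw [← tensorChar_permCongr R e]
    congr 1
    · funext b; simp [Equiv.permCongr_apply]
  · simp [tensorCharInv, tensorChar]
  · intro A B _ _ _ _ g₀ s₀ g s
    unfold tensorCharInv
    rw [← tensorChar_sumCongr]
    congr 1
    · funext b; rcases b with b | b <;> rfl

theorem WreathFun.IsMult.mul {F G : WreathFun Γ} (hF : F.IsMult) (hG : G.IsMult) :
    WreathFun.IsMult (F * G : WreathFun Γ) := by
  have hev : ∀ {A : Type} (g : A → Γ) (s : Equiv.Perm A) S,
      evOn (F * G) g s S = evOn F g s S * evOn G g s S := by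
    intro A g s S
    unfold evOn
    split_ifs
    · rfl
    · simp
  refine ⟨fun n g s π => ?_, fun g s => ?_, fun l p g₀ s₀ g s => ?_⟩
  · simp only [Pi.mul_apply]
    rw [hF.isClass, hG.isClass]
  · simp only [Pi.mul_apply]
    rw [hF.map_zero, hG.map_zero, one_mul]
  · rw [hev, hF.map_add, hG.map_add]
    simp only [Pi.mul_apply]
    ring

/-- Subsets of a disjoint union are pairs of subsets, so the defining sum factors. -/
theorem WreathFun.IsMult.conv {F G : WreathFun Γ} (hF : F.IsMult) (hG : G.IsMult) :
    (conv F G).IsMult := by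
  refine ⟨conv_isClass hF.isClass hG.isClass, fun g s => ?_, fun l p g₀ s₀ g s => ?_⟩
  · rw [SpinWreath.conv, Fintype.sum_unique, show (default : Finset (Fin 0)) = ∅ from rfl,
      show (∅ : Finset (Fin 0))ᶜ = ∅ from rfl, hF.evOn_empty, hG.evOn_empty, one_mul]
  · rw [evOn_conv hF.isClass hG.isClass, Finset.powerset_univ,
      ← Equiv.sum_comp (Finset.sumEquiv (α := Fin l) (β := Fin p)).symm.toEquiv,
      Fintype.sum_prod_type]
    unfold SpinWreath.conv
    rw [Finset.sum_mul_sum]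
    refine Finset.sum_congr rfl fun S _ => Finset.sum_congr rfl fun T _ => ?_
    have h1 : (Finset.univ : Finset (Fin l ⊕ Fin p)) \ S.disjSum T = Sᶜ.disjSum Tᶜ := by
      ext (a | a) <;> simp
    change evOn F _ _ (S.disjSum T) * evOn G _ _ (Finset.univ \ S.disjSum T) = _
    rw [h1, hF.evOn_disjSum, hG.evOn_disjSum]
    ring

end

theorem spinWreath_isMult {Γ : Type*} [Group Γ] {r : ℕ} (I : IrrepList Γ r) (i : Fin (r + 1)) :
    (spinWreath I i).IsMult :=
  (tensorFun_isMult (irrMat I i)).mul ((signFun_isMult Γ).conv (oneFun_isMult Γ))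

end SpinWreath

end

noncomputable section

namespace SpinWreath

/-! ### Cancellation along an orbit -/

section

variable {A : Type} [Fintype A] [DecidableEq A] {s : Equiv.Perm A}

omit [Fintype A] in
theorem Stable.symmDiff {S T : Finset A} (hS : Stable s S) (hT : Stable s T) :
    Stable s (symmDiff S T) := fun a => by
  rw [Finset.mem_symmDiff, Finset.mem_symmDiff, hS a, hT a]

omit [Fintype A] [DecidableEq A] in
theorem Stable.mem_iff_of_sameCycle {T : Finset A} (hT : Stable s T) {x y : A}
    (h : s.SameCycle x y) : x ∈ T ↔ y ∈ T := by
  obtain ⟨i, rfl⟩ := h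
  induction i with
  | zero => rfl
  | succ i ih => rw [ih, add_comm, zpow_add, Equiv.Perm.mul_apply, zpow_one, hT]
  | pred i ih =>
    rw [ih, ← hT ((s ^ (-(i : ℤ) - 1)) x), ← Equiv.Perm.mul_apply, ← zpow_one_add]
    rw [show 1 + (-(i : ℤ) - 1) = -(i : ℤ) by ring]

/-- The orbit of a point under a permutation. -/
def orbitFinset (s : Equiv.Perm A) (a : A) : Finset A :=
  Finset.univ.filter fun b => s.SameCycle a b

theorem mem_orbitFinset (s : Equiv.Perm A) (a b : A) : b ∈ orbitFinset s a ↔ s.SameCycle a b := by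
  simp [orbitFinset]

theorem orbitFinset_stable (s : Equiv.Perm A) (a : A) : Stable s (orbitFinset s a) := fun b => by
  rw [mem_orbitFinset, mem_orbitFinset, Equiv.Perm.sameCycle_apply_right]

theorem orbitFinset_subset_or_disjoint {T : Finset A} (hT : Stable s T) (a : A) :
    orbitFinset s a ⊆ T ∨ Disjoint T (orbitFinset s a) := by
  by_cases ha : a ∈ T
  · exact Or.inl fun b hb =>
      (hT.mem_iff_of_sameCycle ((mem_orbitFinset s a b).mp hb)).mp ha
  · refine Or.inr (Finset.disjoint_right.mpr fun b hb hbT => ha ?_)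
    exact (hT.mem_iff_of_sameCycle ((mem_orbitFinset s a b).mp hb)).mpr hbT

/-- The involution $T\mapsto T\,\triangle\,\mathrm{orbit}(a)$ has no fixed point, since it changes
membership of `a`, and it reverses the sign of `ψ`. -/
theorem sum_eq_zero_of_orbit (a : A) (ψ : Finset A → ℂ) (h0 : ∀ T, ¬ Stable s T → ψ T = 0)
    (h1 : ∀ T, Stable s T → Disjoint T (orbitFinset s a) → ψ (T ∪ orbitFinset s a) = -ψ T) :
    ∑ T, ψ T = 0 := by
  have hC := orbitFinset_stable s a
  set C := orbitFinset s a with hCdef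
  have haC : a ∈ C := by rw [hCdef, mem_orbitFinset]
  refine Finset.sum_involution (fun T _ => symmDiff T C) ?_ ?_ (fun _ _ => Finset.mem_univ _) ?_
  · intro T _
    by_cases hT : Stable s T
    · rcases orbitFinset_subset_or_disjoint hT a with h | h
      · have h2 : symmDiff T C = T \ C := by rw [symmDiff_comm, symmDiff_of_le h]
        have h3 := h1 _ (hT.sdiff hC) Finset.sdiff_disjoint
        rw [Finset.sdiff_union_of_subset h] at h3
        rw [h2, h3, neg_add_cancel]
      · have h2 : symmDiff T C = T ∪ C := by rw [h.symmDiff_eq_sup]; rfl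
        rw [h2, h1 T hT h, add_neg_cancel]
    · rw [h0 T hT, h0, add_zero]
      intro h
      apply hT
      have := h.symmDiff hC
      rwa [symmDiff_symmDiff_cancel_right] at this
  · intro T _ _ h
    have := congrArg (a ∈ ·) h
    simp [Finset.mem_symmDiff, haC] at this
  · intro T _
    exact symmDiff_symmDiff_cancel_right _ _

/-- A cycle of length $k$ has sign $-(-1)^k$, so an orbit of even length has sign $-1$. This
dichotomy drives both quadratic relations. -/
theorem orbitFinset_card_or_sign {Γ : Type*} (g : A → Γ) (s : Equiv.Perm A) (a : A) :
    (-1 : ℂ) ^ (orbitFinset s a).card = -1 ∨ evOn (signFun Γ) g s (orbitFinset s a) = -1 := by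
  -- A fixed point is separate: `cycleOf` is then the identity, and its support is not the orbit.
  by_cases ha : s a = a
  · left
    have : orbitFinset s a = {a} := by
      ext b
      rw [mem_orbitFinset, Finset.mem_singleton]
      exact ⟨fun h => (h.eq_of_left ha).symm, fun h => h ▸ Equiv.Perm.SameCycle.refl s a⟩
    rw [this]
    simp
  · have hsupp : (s.cycleOf a).support = orbitFinset s a := by
      ext b
      rw [Equiv.Perm.mem_support_cycleOf_iff' ha, mem_orbitFinset]
    have hst := orbitFinset_stable s a
    have hst' : ∀ b, (s.cycleOf a) b ∈ orbitFinset s a ↔ b ∈ orbitFinset s a := fun b => by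
      rw [← hsupp, Equiv.Perm.apply_mem_support]
    have h1 : s.subtypePerm hst = (s.cycleOf a).subtypePerm hst' := by
      ext b
      have hb := (mem_orbitFinset s a _).mp b.2
      change s b = s.cycleOf a b
      rw [hb.cycleOf_apply]
    have h2 : evOn (signFun Γ) g s (orbitFinset s a) = -(-1 : ℂ) ^ (orbitFinset s a).card := by
      have h3 : Equiv.Perm.sign ((s.cycleOf a).subtypePerm hst') = Equiv.Perm.sign (s.cycleOf a) := by
        convert Equiv.Perm.sign_subtypePerm (s.cycleOf a) hst' fun b hb => by
          rw [← hsupp, Equiv.Perm.mem_support]; exact hb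
      rw [(Equiv.Perm.isCycle_cycleOf s ha).sign, hsupp] at h3
      rw [evOn, dif_pos hst, signFun, Equiv.Perm.sign_permCongr, h1]
      have h4 := congrArg (fun u : ℤˣ => ((u : ℤ) : ℂ)) h3
      push_cast at h4
      convert h4
    rw [h2]
    rcases neg_one_pow_eq_or ℂ (orbitFinset s a).card with h | h <;> rw [h] <;> simp

variable {Γ : Type*}

/-- The exterior trace is a product over orbits of $1+\mathrm{sgn}$, and an even orbit contributes
$1-1$. -/
theorem conv_sign_one_eq_zero {n : ℕ} (g : Fin n → Γ) (s : Equiv.Perm (Fin n)) (a : Fin n)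
    (h : evOn (signFun Γ) g s (orbitFinset s a) = -1) : conv (signFun Γ) (oneFun Γ) n g s = 0 := by
  unfold conv
  refine sum_eq_zero_of_orbit (s := s) a _ (fun T hT => ?_) (fun T hT hd => ?_)
  · rw [evOn_of_not_stable _ _ _ _ hT, zero_mul]
  · rw [(signFun_isMult Γ).evOn_union hT (orbitFinset_stable s a) hd, h,
      evOn_oneFun Γ _ _ _ (hT.union (orbitFinset_stable s a)).compl, evOn_oneFun Γ _ _ _ hT.compl]
    ring

theorem sum_neg_one_pow_card (s : Equiv.Perm A) (a : A)
    (h : (-1 : ℂ) ^ (orbitFinset s a).card = -1) (c : ℂ) (φ : Finset A → ℂ)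
    (h0 : ∀ T, ¬ Stable s T → φ T = 0) (h1 : ∀ T, Stable s T → φ T = c) :
    ∑ T : Finset A, (-1 : ℂ) ^ T.card * φ T = 0 := by
  refine sum_eq_zero_of_orbit (s := s) a _ (fun T hT => ?_) (fun T hT hd => ?_)
  · rw [h0 T hT, mul_zero]
  · rw [h1 _ (hT.union (orbitFinset_stable s a)), h1 _ hT, Finset.card_union_of_disjoint hd,
      pow_add, h]
    ring

/-! ### The relation between the creation operators -/

theorem conv_comm (F G : WreathFun Γ) : conv F G = conv G F := by
  funext n g s
  unfold conv
  rw [← Equiv.sum_comp (Function.Involutive.toPerm compl (compl_involutive (α := Finset (Fin n))))]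
  refine Finset.sum_congr rfl fun T _ => ?_
  change evOn F g s Tᶜ * evOn G g s Tᶜᶜ = _
  rw [compl_compl, mul_comm]

theorem conv_assoc {F G H : WreathFun Γ} (hF : F.IsClass) (hG : G.IsClass) (hH : H.IsClass) :
    conv F (conv G H) = conv (conv F G) H := by
  rw [conv_comm G H, conv_left_comm hF hH hG, conv_comm]

-- Each subset `T` contributes to exactly one bidegree, so the graded terms recombine into a signed
-- sum over all `T`.
omit [Fintype A] in
theorem sum_card_antidiagonal (N : ℕ) (S : Finset A) (φ : Finset A → ℂ) :
    ∑ p ∈ Finset.HasAntidiagonal.antidiagonal N, (-1 : ℂ) ^ p.1 * ∑ T ∈ S.powerset,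
      (if T.card = p.1 ∧ (S \ T).card = p.2 then φ T else 0) =
      if S.card = N then ∑ T ∈ S.powerset, (-1 : ℂ) ^ T.card * φ T else 0 := by
  simp only [Finset.mul_sum]
  rw [Finset.sum_comm]
  split_ifs with h
  · refine Finset.sum_congr rfl fun T hT => ?_
    have h2 := Finset.card_sdiff_add_card_eq_card (Finset.mem_powerset.mp hT)
    rw [Finset.sum_eq_single (T.card, (S \ T).card)]
    · simp
    · intro p _ hp
      rw [if_neg, mul_zero]
      rintro ⟨h3, h4⟩
      exact hp (Prod.ext h3.symm h4.symm)
    · intro hp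
      exact absurd (Finset.HasAntidiagonal.mem_antidiagonal.mpr (by dsimp only; omega)) hp
  · refine Finset.sum_eq_zero fun T hT => Finset.sum_eq_zero fun p hp => ?_
    have h2 := Finset.card_sdiff_add_card_eq_card (Finset.mem_powerset.mp hT)
    have h3 := Finset.HasAntidiagonal.mem_antidiagonal.mp hp
    rw [if_neg, mul_zero]
    rintro ⟨h4, h5⟩
    omega

end

section

variable {Γ : Type*} [Group Γ] {r : ℕ} (I : IrrepList Γ r) (i : Fin (r + 1))

/-- This is $H_+(\gamma_i,w)H_+(\gamma_i,-w)=1$ for the characters. By multiplicativity the product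
over a stable `T` and its complement does not depend on `T`, which leaves a signed count of stable
sets. -/
theorem sum_conv_grade_grade (N : ℕ) (hN : N ≠ 0) (n : ℕ) (g : Fin n → Γ)
    (s : Equiv.Perm (Fin n)) :
    ∑ p ∈ Finset.HasAntidiagonal.antidiagonal N, (-1 : ℂ) ^ p.1 *
      conv (grade p.1 (spinWreath I i)) (grade p.2 (spinWreath I i)) n g s = 0 := by
  have hm := spinWreath_isMult I i
  have h := sum_card_antidiagonal N (Finset.univ : Finset (Fin n))
    fun T => evOn (spinWreath I i) g s T * evOn (spinWreath I i) g s (Finset.univ \ T)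
  have h' : ∀ p : ℕ × ℕ, conv (grade p.1 (spinWreath I i)) (grade p.2 (spinWreath I i)) n g s =
      ∑ T ∈ (Finset.univ : Finset (Fin n)).powerset,
      (if T.card = p.1 ∧ (Finset.univ \ T).card = p.2 then
        evOn (spinWreath I i) g s T * evOn (spinWreath I i) g s (Finset.univ \ T) else 0) := by
    intro p
    rw [Finset.powerset_univ, conv]
    refine Finset.sum_congr rfl fun T _ => ?_
    rw [evOn_grade, evOn_grade, Finset.compl_eq_univ_sdiff]
    split_ifs <;> simp_all
  rw [Finset.sum_congr rfl fun p _ => by rw [h' p], h, Finset.powerset_univ]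
  split_ifs with hn
  swap
  · rfl
  rw [Finset.card_univ, Fintype.card_fin] at hn
  have hpos : 0 < n := by omega
  have hprod : ∀ T, Stable s T → evOn (spinWreath I i) g s T *
      evOn (spinWreath I i) g s (Finset.univ \ T) = spinWreath I i n g s := by
    intro T hT
    rw [← hm.evOn_union hT ((stable_univ s).sdiff hT) Finset.disjoint_sdiff,
      Finset.union_sdiff_of_subset (Finset.subset_univ T), evOn_univ hm.isClass]
  -- An odd orbit cancels the signed count; an even one makes the common value zero.
  rcases orbitFinset_card_or_sign g s ⟨0, hpos⟩ with ho | he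
  · exact sum_neg_one_pow_card s _ ho _ _ (fun T hT => by
      rw [evOn_of_not_stable _ _ _ _ hT, zero_mul]) hprod
  · have hz : spinWreath I i n g s = 0 := by
      rw [spinWreath, conv_sign_one_eq_zero g s _ he, mul_zero]
    refine Finset.sum_eq_zero fun T _ => ?_
    by_cases hT : Stable s T
    · rw [hprod T hT, hz, mul_zero]
    · rw [evOn_of_not_stable _ _ _ _ hT, zero_mul, mul_zero]

theorem sum_conv_grade_conv_grade {F : WreathFun Γ} (hF : F.IsClass) (N : ℕ) (hN : N ≠ 0) (n : ℕ)
    (g : Fin n → Γ) (s : Equiv.Perm (Fin n)) :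
    ∑ p ∈ Finset.HasAntidiagonal.antidiagonal N, (-1 : ℂ) ^ p.1 *
      conv (grade p.1 (spinWreath I i)) (conv (grade p.2 (spinWreath I i)) F) n g s = 0 := by
  have hc : ∀ k, (grade k (spinWreath I i)).IsClass :=
    grade_isClass (spinWreath_isMult I i).isClass
  have h1 : ∀ p : ℕ × ℕ,
      conv (grade p.1 (spinWreath I i)) (conv (grade p.2 (spinWreath I i)) F) n g s =
      ∑ T, evOn (conv (grade p.1 (spinWreath I i)) (grade p.2 (spinWreath I i))) g s T *
        evOn F g s Tᶜ := by
    intro p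
    rw [conv_assoc (hc _) (hc _) hF]
    rfl
  simp only [h1, Finset.mul_sum]
  rw [Finset.sum_comm]
  refine Finset.sum_eq_zero fun T _ => ?_
  simp only [← mul_assoc]
  rw [← Finset.sum_mul]
  refine mul_eq_zero_of_left ?_ _
  by_cases hT : Stable s T
  · have h2 := sum_conv_grade_grade I i N hN T.card (fun i => g (T.equivFin.symm i))
      (T.equivFin.permCongr (s.subtypePerm hT))
    rw [← h2]
    refine Finset.sum_congr rfl fun p _ => ?_
    rw [evOn, dif_pos hT]
  · refine Finset.sum_eq_zero fun p _ => ?_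
    rw [evOn_of_not_stable _ _ _ _ hT, mul_zero]

end

end SpinWreath

end

noncomputable section

namespace SpinWreath

/-! ### Sums over wreath products with a distinguished stable set -/

section

variable {Γ : Type*} {A B : Type} [Fintype A] [Fintype B]

theorem evOn_univ_equiv {F : WreathFun Γ} (hF : F.IsClass) {g : A → Γ} {s : Equiv.Perm A}
    {g' : B → Γ} {s' : Equiv.Perm B} (e : B ≃ A) (hg : ∀ b, g' b = g (e b))
    (hs : ∀ b, e (s' b) = s (e b)) :
    evOn F g s Finset.univ = evOn F g' s' Finset.univ := by
  rw [← evOn_map hF Finset.univ e.toEmbedding hg hs, Finset.map_univ_equiv]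

variable [DecidableEq A] [Fintype Γ]

-- The permutations preserving the first block are exactly the pairs of permutations of the two
-- blocks.
omit [Fintype B] in
theorem sum_perm_split {a b : ℕ} (e : Fin a ⊕ Fin b ≃ A) (φ : Equiv.Perm A → ℂ)
    (h0 : ∀ s, ¬ Stable s (Finset.univ.map (Function.Embedding.inl.trans e.toEmbedding)) →
      φ s = 0) :
    ∑ s, φ s = ∑ s₁ : Equiv.Perm (Fin a), ∑ s₂ : Equiv.Perm (Fin b),
      φ (e.permCongr (Equiv.sumCongr s₁ s₂)) := by
  rw [← Fintype.sum_prod_type' fun s₁ s₂ => φ (e.permCongr (Equiv.sumCongr s₁ s₂))]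
  symm
  refine Fintype.sum_of_injective
    (fun p : Equiv.Perm (Fin a) × Equiv.Perm (Fin b) => e.permCongr (Equiv.sumCongr p.1 p.2))
    ?_ _ _ ?_ fun _ => rfl
  · exact e.permCongr.injective.comp Equiv.Perm.sumCongrHom_injective
  · intro s hs
    refine h0 s fun hst => hs ?_
    have h1 : Stable (e.symm.permCongr s) ((Finset.univ : Finset (Fin a)).map
        Function.Embedding.inl) := by
      rw [← Finset.map_map, Stable.map_iff (s' := e.symm.permCongr s) e.toEmbedding
        (fun b => by simp)] at hst
      exact hst
    have h2 := Equiv.Perm.mem_sumCongrHom_range_of_perm_mapsTo_inl (σ := e.symm.permCongr s) (by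
      rintro _ ⟨i, rfl⟩
      have := (h1 (Sum.inl i)).mpr (by simp)
      simpa using this)
    obtain ⟨p, hp⟩ := h2
    refine ⟨p, ?_⟩
    change e.permCongr (Equiv.Perm.sumCongrHom _ _ p) = s
    rw [hp]
    ext x
    simp

/-- Every `T` of size `a` is the image of the standard block under $a!\,b!$ permutations, and by
invariance each of the $(a+b)!$ permutations contributes the same as the identity. The factorials
stay on both sides to avoid division. -/
theorem sum_wreath_split {a b : ℕ} (e : Fin a ⊕ Fin b ≃ A)
    (Ψ : (A → Γ) → Equiv.Perm A → Finset A → ℂ)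
    (hinv : ∀ g s T (π : Equiv.Perm A),
      Ψ (g ∘ π.symm) (π * s * π⁻¹) (T.map π.toEmbedding) = Ψ g s T)
    (h0 : ∀ g s T, ¬ Stable s T → Ψ g s T = 0) :
    (a.factorial * b.factorial : ℕ) * ∑ g, ∑ s, ∑ T : Finset A,
      (if T.card = a then Ψ g s T else 0) =
    ((a + b).factorial : ℕ) * ∑ g₁ : Fin a → Γ, ∑ s₁ : Equiv.Perm (Fin a), ∑ g₂ : Fin b → Γ,
      ∑ s₂ : Equiv.Perm (Fin b), Ψ (Sum.elim g₁ g₂ ∘ e.symm) (e.permCongr (Equiv.sumCongr s₁ s₂))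
        (Finset.univ.map (Function.Embedding.inl.trans e.toEmbedding)) := by
  set L : Finset A := Finset.univ.map (Function.Embedding.inl.trans e.toEmbedding) with hL
  have hLc : L.card = a := by simp [hL]
  have hA : Fintype.card A = a + b := by rw [← Fintype.card_congr e]; simp
  have h1 : ∀ g s, (a.factorial * b.factorial : ℕ) * ∑ T : Finset A,
      (if T.card = a then Ψ g s T else 0) = ∑ π : Equiv.Perm A, Ψ g s (L.map π.toEmbedding) := by
    intro g s
    rw [sum_perm_map L (Ψ g s), hLc, hA, Nat.add_sub_cancel_left]
  have h2 : ∀ π : Equiv.Perm A, ∑ g, ∑ s, Ψ g s (L.map π.toEmbedding) = ∑ g, ∑ s, Ψ g s L := by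
    intro π
    rw [← Equiv.sum_comp (Equiv.arrowCongr π (Equiv.refl Γ))]
    refine Finset.sum_congr rfl fun g _ => ?_
    rw [← Equiv.sum_comp (MulAut.conj π).toEquiv]
    exact Finset.sum_congr rfl fun s _ => hinv g s L π
  have h3 : (a.factorial * b.factorial : ℕ) * ∑ g, ∑ s, ∑ T : Finset A,
      (if T.card = a then Ψ g s T else 0) = ∑ π : Equiv.Perm A, ∑ g, ∑ s, Ψ g s L := by
    simp only [Finset.mul_sum _ _ ((a.factorial * b.factorial : ℕ) : ℂ)] at h1 ⊢
    simp only [h1]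
    calc ∑ g, ∑ s, ∑ π : Equiv.Perm A, Ψ g s (L.map π.toEmbedding)
        = ∑ g, ∑ π : Equiv.Perm A, ∑ s, Ψ g s (L.map π.toEmbedding) :=
          Finset.sum_congr rfl fun g _ => Finset.sum_comm
      _ = ∑ π : Equiv.Perm A, ∑ g, ∑ s, Ψ g s (L.map π.toEmbedding) := Finset.sum_comm
      _ = ∑ _π : Equiv.Perm A, ∑ g, ∑ s, Ψ g s L := Finset.sum_congr rfl fun π _ => h2 π
  rw [h3, Finset.sum_const, Finset.card_univ, Fintype.card_perm, hA, nsmul_eq_mul]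
  congr 1
  rw [← Equiv.sum_comp (Equiv.arrowCongr e (Equiv.refl Γ)),
    ← Equiv.sum_comp (Equiv.sumArrowEquivProdArrow (Fin a) (Fin b) Γ).symm, Fintype.sum_prod_type]
  refine Finset.sum_congr rfl fun g₁ _ => ?_
  refine Eq.trans ?_ Finset.sum_comm
  refine Finset.sum_congr rfl fun g₂ _ => ?_
  exact sum_perm_split e _ fun s hs => h0 _ s L hs

end

/-! ### Relations between the annihilation operators -/

section

variable {Γ : Type*} [Group Γ] [Fintype Γ] {κ κ' : Type} [Fintype κ] [Fintype κ']
  (R : Γ → Matrix κ κ ℂ) (R' : Γ → Matrix κ' κ' ℂ) {F : WreathFun Γ}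

theorem evOn_annihWreath (hF : F.IsClass) (l : ℕ) {A : Type} (g : A → Γ) (s : Equiv.Perm A)
    (S : Finset A) : evOn (annihWreath R l F) g s S =
    ((Fintype.card Γ ^ l * l.factorial : ℕ) : ℂ)⁻¹ * ∑ g₀ : Fin l → Γ, ∑ s₀ : Equiv.Perm (Fin l),
      tensorCharInv R g₀ s₀ *
        evOn F (Sum.elim g₀ g) (Equiv.sumCongr s₀ s) (Finset.univ.disjSum S) := by
  by_cases h : Stable s S
  · rw [evOn, dif_pos h, annihWreath]
    congr 1
    refine Finset.sum_congr rfl fun g₀ _ => Finset.sum_congr rfl fun s₀ _ => ?_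
    congr 1
    let e : Fin S.card ↪ A := S.equivFin.symm.toEmbedding.trans (Function.Embedding.subtype _)
    have he : Finset.univ.map e = S := by
      ext a
      simp only [Finset.mem_map, Finset.mem_univ, true_and]
      constructor
      · rintro ⟨i, rfl⟩; exact (S.equivFin.symm i).2
      · intro ha; exact ⟨S.equivFin ⟨a, ha⟩, by simp [e]⟩
    rw [← univ_map_sumMap (Function.Embedding.refl (Fin l)) e Finset.map_refl he]
    symm
    refine evOn_map hF Finset.univ _ ?_ ?_
    · rintro (i | j) <;> rfl
    · rintro (i | j)
      · rfl
      · simp [e, coe_subtypePerm]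
  · rw [evOn_of_not_stable _ _ _ _ h]
    symm
    refine mul_eq_zero_of_right _ (Finset.sum_eq_zero fun g₀ _ => Finset.sum_eq_zero fun s₀ _ => ?_)
    rw [evOn_of_not_stable, mul_zero]
    exact fun hh => h (stable_disjSum.mp hh).2

theorem annihWreath_annihWreath (hF : F.IsClass) (k l n : ℕ) (g : Fin n → Γ)
    (s : Equiv.Perm (Fin n)) : annihWreath R k (annihWreath R' l F) n g s =
    ((Fintype.card Γ ^ k * k.factorial : ℕ) : ℂ)⁻¹ *
      ((Fintype.card Γ ^ l * l.factorial : ℕ) : ℂ)⁻¹ *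
      ∑ g₀ : Fin l → Γ, ∑ s₀ : Equiv.Perm (Fin l), ∑ g₁ : Fin k → Γ, ∑ s₁ : Equiv.Perm (Fin k),
        tensorCharInv R' g₀ s₀ * tensorCharInv R g₁ s₁ *
          evOn F (Sum.elim g₀ (Sum.elim g₁ g)) (Equiv.sumCongr s₀ (Equiv.sumCongr s₁ s))
            Finset.univ := by
  rw [annihWreath]
  simp only [evOn_annihWreath R' hF, Finset.univ_disjSum_univ]
  rw [mul_assoc]
  congr 1
  simp only [Finset.mul_sum]
  rw [Finset.sum_congr rfl fun g₁ _ => (Finset.sum_comm.trans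
    (Finset.sum_congr rfl fun g₀ _ => Finset.sum_comm)), Finset.sum_comm]
  refine Finset.sum_congr rfl fun g₀ _ => ?_
  rw [Finset.sum_comm]
  refine Finset.sum_congr rfl fun s₀ _ => Finset.sum_congr rfl fun g₁ _ =>
    Finset.sum_congr rfl fun s₁ _ => ?_
  ring

theorem annihWreath_comm (hF : F.IsClass) (k l : ℕ) :
    annihWreath R k (annihWreath R' l F) = annihWreath R' l (annihWreath R k F) := by
  funext n g s
  rw [annihWreath_annihWreath R R' hF, annihWreath_annihWreath R' R hF, mul_comm (_⁻¹ : ℂ)]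
  congr 1
  rw [Finset.sum_congr rfl fun g₀ _ => (Finset.sum_comm.trans
    (Finset.sum_congr rfl fun g₁ _ => Finset.sum_comm)), Finset.sum_comm]
  refine Finset.sum_congr rfl fun g₁ _ => ?_
  rw [Finset.sum_comm]
  refine Finset.sum_congr rfl fun s₁ _ => Finset.sum_congr rfl fun g₀ _ =>
    Finset.sum_congr rfl fun s₀ _ => ?_
  rw [mul_comm (tensorCharInv R' g₀ s₀)]
  congr 1
  let e : Fin k ⊕ (Fin l ⊕ Fin n) ≃ Fin l ⊕ (Fin k ⊕ Fin n) :=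
    ((Equiv.sumAssoc _ _ _).symm.trans ((Equiv.sumComm _ _).sumCongr (Equiv.refl _))).trans
      (Equiv.sumAssoc _ _ _)
  refine evOn_univ_equiv hF e ?_ ?_
  · rintro (i | i | i) <;> rfl
  · rintro (i | i | i) <;> rfl

omit [Fintype Γ] in
theorem tensorCharInv_split {a b N : ℕ} (e : Fin a ⊕ Fin b ≃ Fin N) (g₁ : Fin a → Γ)
    (s₁ : Equiv.Perm (Fin a)) (g₂ : Fin b → Γ) (s₂ : Equiv.Perm (Fin b)) :
    tensorCharInv R (Sum.elim g₁ g₂ ∘ e.symm) (e.permCongr (Equiv.sumCongr s₁ s₂)) =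
      tensorCharInv R g₁ s₁ * tensorCharInv R g₂ s₂ := by
  have h := tensorInvFun_isMult R
  have h1 := evOn_univ h.isClass (Sum.elim g₁ g₂ ∘ e.symm) (e.permCongr (Equiv.sumCongr s₁ s₂))
  rw [evOn_univ_equiv h.isClass (g' := Sum.elim g₁ g₂) (s' := Equiv.sumCongr s₁ s₂) e (by simp)
    (by simp), h.map_add] at h1
  exact h1.symm

omit [Fintype Γ] in
theorem tensorCharInv_conj {N : ℕ} (g : Fin N → Γ) (s π : Equiv.Perm (Fin N)) :
    tensorCharInv R (g ∘ π.symm) (π * s * π⁻¹) = tensorCharInv R g s :=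
  (tensorInvFun_isMult R).isClass N g s π

omit [Fintype Γ] in
theorem stable_map_inl {a b N : ℕ} (e : Fin a ⊕ Fin b ≃ Fin N) (s₁ : Equiv.Perm (Fin a))
    (s₂ : Equiv.Perm (Fin b)) : Stable (e.permCongr (Equiv.sumCongr s₁ s₂))
      (Finset.univ.map (Function.Embedding.inl.trans e.toEmbedding)) := by
  rw [Stable.map_iff (s' := s₁) _ (by simp)]
  exact stable_univ s₁

theorem inv_factorial_split {a b N : ℕ} (hN : a + b = N) (c : ℕ) (hc : c ≠ 0) (x y : ℂ)
    (h : (a.factorial * b.factorial : ℕ) * x = (N.factorial : ℕ) * y) :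
    ((c ^ N * N.factorial : ℕ) : ℂ)⁻¹ * x =
      ((c ^ a * a.factorial : ℕ) : ℂ)⁻¹ * ((c ^ b * b.factorial : ℕ) : ℂ)⁻¹ * y := by
  have ha : (a.factorial : ℂ) ≠ 0 := Nat.cast_ne_zero.mpr a.factorial_ne_zero
  have hb : (b.factorial : ℂ) ≠ 0 := Nat.cast_ne_zero.mpr b.factorial_ne_zero
  have hN' : (N.factorial : ℂ) ≠ 0 := Nat.cast_ne_zero.mpr N.factorial_ne_zero
  have hc' : (c : ℂ) ≠ 0 := Nat.cast_ne_zero.mpr hc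
  push_cast at h ⊢
  subst hN
  rw [pow_add]
  field_simp
  linear_combination h

/-- Two successive pairings over blocks of sizes $a$ and $b$ equal one pairing over $N=a+b$ indices
with a marked stable set of size $a$. For fixed $(g_0,s_0)$ the summand is independent of that set,
so the signed sum is again a count of stable sets. -/
theorem sum_annihWreath_annihWreath (f : ∀ n, SpinFun Γ n) (N : ℕ) (hN : N ≠ 0) (n : ℕ)
    (g : Fin n → Γ) (s : Equiv.Perm (Fin n)) :
    ∑ p ∈ Finset.HasAntidiagonal.antidiagonal N, (-1 : ℂ) ^ p.1 *
      annihWreath R p.2 (annihWreath R p.1 (toWreath f)) n g s = 0 := by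
  classical
  have hF := toWreath_isClass f
  let Ψ : (Fin N → Γ) → Equiv.Perm (Fin N) → Finset (Fin N) → ℂ := fun g₀ s₀ T =>
    if Stable s₀ T then tensorCharInv R g₀ s₀ *
      evOn (toWreath f) (Sum.elim g₀ g) (Equiv.sumCongr s₀ s) Finset.univ else 0
  have hinv : ∀ g s T (π : Equiv.Perm (Fin N)),
      Ψ (g ∘ π.symm) (π * s * π⁻¹) (T.map π.toEmbedding) = Ψ g s T := by
    intro g₀ s₀ T π
    simp only [Ψ]
    rw [tensorCharInv_conj, evOn_univ_equiv hF (g' := Sum.elim g₀ g) (s' := Equiv.sumCongr s₀ s)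
      (Equiv.sumCongr π (Equiv.refl _)) (by rintro (i | i) <;> simp) (by rintro (i | i) <;> simp)]
    exact if_congr (Stable.map_iff _ (by simp)) rfl rfl
  have h0 : ∀ g s T, ¬ Stable s T → Ψ g s T = 0 := fun g s T h => if_neg h
  have h1 : ∀ p ∈ Finset.HasAntidiagonal.antidiagonal N,
      annihWreath R p.2 (annihWreath R p.1 (toWreath f)) n g s =
      ((Fintype.card Γ ^ N * N.factorial : ℕ) : ℂ)⁻¹ * ∑ g, ∑ s, ∑ T : Finset (Fin N),
        (if T.card = p.1 then Ψ g s T else 0) := by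
    rintro ⟨a, b⟩ hp
    have hab : a + b = N := Finset.HasAntidiagonal.mem_antidiagonal.mp hp
    let e : Fin a ⊕ Fin b ≃ Fin N := finSumFinEquiv.trans (finCongr hab)
    have h2 := sum_wreath_split e Ψ hinv h0
    rw [hab] at h2
    rw [inv_factorial_split hab _ Fintype.card_ne_zero _ _ h2, annihWreath_annihWreath R R hF,
      mul_comm (_⁻¹ : ℂ)]
    congr 1
    refine Finset.sum_congr rfl fun g₁ _ => Finset.sum_congr rfl fun s₁ _ =>
      Finset.sum_congr rfl fun g₂ _ => Finset.sum_congr rfl fun s₂ _ => ?_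
    simp only [Ψ]
    rw [if_pos (stable_map_inl e s₁ s₂), tensorCharInv_split]
    congr 1
    symm
    refine evOn_univ_equiv hF ((Equiv.sumAssoc _ _ _).symm.trans (e.sumCongr (Equiv.refl _)))
      ?_ ?_
    · rintro (i | i | i) <;> simp
    · rintro (i | i | i) <;> simp
  rw [Finset.sum_congr rfl fun p hp => by rw [h1 p hp, mul_left_comm], ← Finset.mul_sum]
  refine mul_eq_zero_of_right _ ?_
  simp only [Finset.mul_sum]
  rw [Finset.sum_comm]
  refine Finset.sum_eq_zero fun g₀ _ => ?_
  rw [Finset.sum_comm]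
  refine Finset.sum_eq_zero fun s₀ _ => ?_
  rw [Finset.sum_comm]
  have h3 : ∀ T : Finset (Fin N), ∑ p ∈ Finset.HasAntidiagonal.antidiagonal N,
      (-1 : ℂ) ^ p.1 * (if T.card = p.1 then Ψ g₀ s₀ T else 0) = (-1) ^ T.card * Ψ g₀ s₀ T := by
    intro T
    have hT : T.card ≤ N := by simpa using Finset.card_le_univ T
    rw [Finset.sum_eq_single (T.card, N - T.card)]
    · simp
    · rintro ⟨a, b⟩ hp hne
      have := Finset.HasAntidiagonal.mem_antidiagonal.mp hp
      rw [if_neg, mul_zero]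
      rintro h
      exact hne (Prod.ext h.symm (by dsimp only at *; omega))
    · intro h
      exact absurd (Finset.HasAntidiagonal.mem_antidiagonal.mpr (by dsimp only; omega)) h
  rw [Finset.sum_congr rfl fun T _ => h3 T]
  let a₀ : Fin N := ⟨0, Nat.pos_of_ne_zero hN⟩
  rcases orbitFinset_card_or_sign g₀ s₀ a₀ with ho | he
  · exact sum_neg_one_pow_card s₀ _ ho _ _ (h0 g₀ s₀) fun T hT => if_pos hT
  -- The tensor character need not vanish on an even orbit; here the spin function `f` itself does.
  · have hz : evOn (toWreath f) (Sum.elim g₀ g) (Equiv.sumCongr s₀ s) Finset.univ = 0 := by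
      refine evOn_toWreath_eq_zero f _ _ _ ((orbitFinset s₀ a₀).map Function.Embedding.inl)
        (Finset.subset_univ _) ?_
      rw [evOn_map (signFun_isClass Γ) _ Function.Embedding.inl (g' := g₀) (s' := s₀)
        (fun _ => rfl) (fun _ => rfl), he]
    refine Finset.sum_eq_zero fun T _ => ?_
    simp [Ψ, hz]

end

end SpinWreath

end

noncomputable section

namespace SpinWreath

/-! ### Schur orthogonality -/

section

variable {Γ : Type*} [Group Γ] {r : ℕ} (I : IrrepList Γ r)

theorem irrMat_mul (i : Fin (r + 1)) (x y : Γ) :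
    irrMat I i (x * y) = irrMat I i x * irrMat I i y := by
  rw [irrMat, map_mul, LinearMap.toMatrix'_mul]
  rfl

theorem irrMat_one (i : Fin (r + 1)) : irrMat I i 1 = 1 := by
  rw [irrMat, map_one, LinearMap.toMatrix'_one]

theorem dim_ne_zero (i : Fin (r + 1)) : I.dim i ≠ 0 := by
  intro h
  have := I.irreducible i
  have hn : Nontrivial (Subrepresentation (I.rep i)) := inferInstance
  obtain ⟨U, W, hUW⟩ := hn
  apply hUW
  have : IsEmpty (Fin (I.dim i)) := by rw [h]; infer_instance
  ext v
  have : v = 0 := Subsingleton.elim _ _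
  subst this
  exact ⟨fun _ => W.toSubmodule.zero_mem, fun _ => U.toSubmodule.zero_mem⟩

theorem eq_zero_of_intertwining {i j : Fin (r + 1)} (hij : i ≠ j)
    (M : Matrix (Fin (I.dim i)) (Fin (I.dim j)) ℂ)
    (h : ∀ y, M * irrMat I j y = irrMat I i y * M) : M = 0 := by
  have := I.irreducible i
  have := I.irreducible j
  have := I.distinct j i hij.symm
  let f : Representation.IntertwiningMap (I.rep j) (I.rep i) := ⟨Matrix.toLin' M, fun y => by
    apply LinearMap.toMatrix'.injective
    rw [LinearMap.toMatrix'_comp, LinearMap.toMatrix'_comp, LinearMap.toMatrix'_toLin']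
    exact h y⟩
  have hf : f = 0 := Subsingleton.elim _ _
  have h2 : Matrix.toLin' M = 0 := congrArg (fun k => k.toLinearMap) hf
  simpa using h2

theorem eq_scalar_of_intertwining (i : Fin (r + 1))
    (M : Matrix (Fin (I.dim i)) (Fin (I.dim i)) ℂ)
    (h : ∀ y, M * irrMat I i y = irrMat I i y * M) : ∃ c : ℂ, M = c • 1 := by
  have := I.irreducible i
  let f : Representation.IntertwiningMap (I.rep i) (I.rep i) := ⟨Matrix.toLin' M, fun y => by
    apply LinearMap.toMatrix'.injective
    rw [LinearMap.toMatrix'_comp, LinearMap.toMatrix'_comp, LinearMap.toMatrix'_toLin']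
    exact h y⟩
  obtain ⟨c, hc⟩ :=
    (Representation.IsIrreducible.algebraMap_intertwiningMap_bijective_of_isAlgClosed
      (ρ := I.rep i)).2 f
  refine ⟨c, ?_⟩
  have h2 : Matrix.toLin' M = c • LinearMap.id := (congrArg (fun k => k.toLinearMap) hc).symm
  have h3 := congrArg LinearMap.toMatrix' h2
  simpa using h3

variable [Fintype Γ]

theorem sum_irrMat_intertwining (i j : Fin (r + 1))
    (E : Matrix (Fin (I.dim i)) (Fin (I.dim j)) ℂ) (y : Γ) :
    (∑ x, irrMat I i x⁻¹ * E * irrMat I j x) * irrMat I j y =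
      irrMat I i y * ∑ x, irrMat I i x⁻¹ * E * irrMat I j x := by
  rw [Matrix.sum_mul, Matrix.mul_sum, ← Equiv.sum_comp (Equiv.mulRight y)
    fun x => irrMat I i y * (irrMat I i x⁻¹ * E * irrMat I j x)]
  refine Finset.sum_congr rfl fun x _ => ?_
  rw [Equiv.coe_mulRight, irrMat_mul I j, ← Matrix.mul_assoc, ← Matrix.mul_assoc,
    ← Matrix.mul_assoc, mul_inv_rev, ← irrMat_mul, mul_inv_cancel_left]

/-- Schur orthogonality of the matrix coefficients of the irreducible representations. -/
theorem sum_irrMat_mul_irrMat (i j : Fin (r + 1)) (p q : Fin (I.dim i)) (t u : Fin (I.dim j)) :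
    ∑ x, irrMat I i x⁻¹ p q * irrMat I j x t u =
      if h : i = j then
        (Fintype.card Γ : ℂ) / I.dim i * ((if p = h ▸ u then 1 else 0) * if q = h ▸ t then 1 else 0)
      else 0 := by
  -- The sum is an entry of the averaged elementary matrix, which intertwines; Schur's lemma makes
  -- it zero or scalar, and the trace fixes the scalar.
  have hentry : (∑ x, irrMat I i x⁻¹ * Matrix.single q t (1 : ℂ) * irrMat I j x) p u =
      ∑ x, irrMat I i x⁻¹ p q * irrMat I j x t u := by
    rw [Matrix.sum_apply]
    refine Finset.sum_congr rfl fun x _ => ?_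
    rw [Matrix.mul_apply, Finset.sum_eq_single t]
    · simp
    · intro b _ hb
      rw [Matrix.mul_single_apply_of_ne _ _ _ _ _ hb, zero_mul]
    · simp
  have hint := sum_irrMat_intertwining I i j (Matrix.single q t (1 : ℂ))
  rw [← hentry]
  by_cases h : i = j
  · subst h
    rw [dif_pos rfl]
    obtain ⟨c, hc⟩ := eq_scalar_of_intertwining I i _ hint
    have htr := congrArg Matrix.trace hc
    rw [Matrix.trace_sum, Matrix.trace_smul, Matrix.trace_one, Fintype.card_fin,
      Finset.sum_congr rfl fun x _ => by
        rw [mul_assoc, Matrix.trace_mul_comm, mul_assoc, ← irrMat_mul, mul_inv_cancel,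
          irrMat_one, mul_one]] at htr
    have hd : (I.dim i : ℂ) ≠ 0 := Nat.cast_ne_zero.mpr (dim_ne_zero I i)
    have hc' : c = (Fintype.card Γ : ℂ) / I.dim i * if q = t then 1 else 0 := by
      rw [div_mul_eq_mul_div, eq_div_iff hd]
      rw [Finset.sum_const, Finset.card_univ, nsmul_eq_mul] at htr
      rw [smul_eq_mul] at htr
      rw [← htr]
      congr 1
      split_ifs with hqt
      · subst hqt; simp [Matrix.trace_single_eq_same]
      · rw [Matrix.trace_single_eq_of_ne q t (1 : ℂ) hqt]
    rw [hc, hc', Matrix.smul_apply, Matrix.one_apply, smul_eq_mul, mul_assoc, mul_comm (ite _ _ _)]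
  · rw [eq_zero_of_intertwining I h _ hint, dif_neg h, Matrix.zero_apply]

/-- For fixed `s` the sum over `g` is a product of Schur sums, one for each index. They force the
two index functions to agree, and the $(\dim\gamma_i)^n$ remaining choices cancel the denominators;
`s` disappears from the answer. -/
theorem sum_tensorCharInv_mul_tensorChar {n : ℕ} (i j : Fin (r + 1)) (s : Equiv.Perm (Fin n)) :
    ∑ g : Fin n → Γ, tensorCharInv (irrMat I i) g s * tensorChar (irrMat I j) g s =
      if n = 0 ∨ i = j then (Fintype.card Γ : ℂ) ^ n else 0 := by
  have h1 : ∀ g : Fin n → Γ, tensorCharInv (irrMat I i) g s * tensorChar (irrMat I j) g s =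
      ∑ b : Fin n → Fin (I.dim i), ∑ c : Fin n → Fin (I.dim j),
        ∏ a, irrMat I i (g a)⁻¹ (b (s.symm a)) (b a) * irrMat I j (g a) (c a) (c (s.symm a)) := by
    intro g
    rw [tensorCharInv, tensorChar, tensorChar, Finset.sum_mul_sum]
    refine Finset.sum_congr rfl fun b _ => Finset.sum_congr rfl fun c _ => ?_
    rw [Finset.prod_mul_distrib]
    congr 1
    rw [← Equiv.prod_comp s.symm]
    refine Finset.prod_congr rfl fun a _ => ?_
    simp [Equiv.Perm.inv_def]
  have h2 : ∀ (b : Fin n → Fin (I.dim i)) (c : Fin n → Fin (I.dim j)),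
      ∑ g : Fin n → Γ, ∏ a, irrMat I i (g a)⁻¹ (b (s.symm a)) (b a) *
        irrMat I j (g a) (c a) (c (s.symm a)) =
      ∏ a, ∑ x, irrMat I i x⁻¹ (b (s.symm a)) (b a) * irrMat I j x (c a) (c (s.symm a)) := by
    intro b c
    rw [Finset.prod_univ_sum, Fintype.piFinset_univ]
  simp only [h1]
  rw [Finset.sum_comm]
  simp only [Finset.sum_comm (s := (Finset.univ : Finset (Fin n → Γ))), h2,
    sum_irrMat_mul_irrMat]
  by_cases hij : i = j
  · subst hij
    simp only [dite_true, or_true, if_true]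
    have h3 : ∀ b c : Fin n → Fin (I.dim i), (∏ a, (Fintype.card Γ : ℂ) / I.dim i *
        ((if b (s.symm a) = c (s.symm a) then 1 else 0) * if b a = c a then 1 else 0)) =
        if b = c then ((Fintype.card Γ : ℂ) / I.dim i) ^ n else 0 := by
      intro b c
      split_ifs with hbc
      · subst hbc
        simp only [if_true, mul_one, Finset.prod_const, Finset.card_univ, Fintype.card_fin]
      · obtain ⟨a, ha⟩ := Function.ne_iff.mp hbc
        exact Finset.prod_eq_zero (Finset.mem_univ a) (by simp [ha])
    have hd : (I.dim i : ℂ) ≠ 0 := Nat.cast_ne_zero.mpr (dim_ne_zero I i)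
    simp only [h3]
    simp
    rw [← mul_pow, mul_div_cancel₀ _ hd]
  · by_cases hn : n = 0
    · subst hn; simp
    · have : Nonempty (Fin n) := ⟨⟨0, Nat.pos_of_ne_zero hn⟩⟩
      simp [hij, hn]

/-! ### The pairing of basic spin characters -/

theorem sum_sign_eq_zero {n : ℕ} (hn : 2 ≤ n) :
    ∑ s : Equiv.Perm (Fin n), ((Equiv.Perm.sign s : ℤ) : ℂ) = 0 := by
  let t : Equiv.Perm (Fin n) := Equiv.swap ⟨0, by omega⟩ ⟨1, by omega⟩
  have ht : Equiv.Perm.sign t = -1 := Equiv.Perm.sign_swap (by simp)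
  have h := Equiv.sum_comp (Equiv.mulLeft t) fun s => ((Equiv.Perm.sign s : ℤ) : ℂ)
  simp only [Equiv.coe_mulLeft, Equiv.Perm.sign_mul, ht] at h
  push_cast at h
  rw [Finset.sum_congr rfl fun s _ => neg_one_mul _, Finset.sum_neg_distrib] at h
  exact self_eq_neg.mp h.symm

theorem sum_finset_eq_sum_antidiagonal {N : ℕ} (φ : Finset (Fin N) → ℂ) :
    ∑ T, φ T = ∑ p ∈ Finset.HasAntidiagonal.antidiagonal N,
      ∑ T : Finset (Fin N), if T.card = p.1 then φ T else 0 := by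
  rw [Finset.sum_comm]
  refine Finset.sum_congr rfl fun T _ => ?_
  have hT : T.card ≤ N := by simpa using Finset.card_le_univ T
  rw [Finset.sum_eq_single (T.card, N - T.card)]
  · simp
  · rintro ⟨a, b⟩ hp hne
    have := Finset.HasAntidiagonal.mem_antidiagonal.mp hp
    rw [if_neg]
    rintro h
    exact hne (Prod.ext h.symm (by dsimp only at *; omega))
  · intro h
    exact absurd (Finset.HasAntidiagonal.mem_antidiagonal.mpr (by dsimp only; omega)) h

theorem sum_sign (n : ℕ) : ∑ s : Equiv.Perm (Fin n), ((Equiv.Perm.sign s : ℤ) : ℂ) =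
    n.factorial * if n ≤ 1 then 1 else 0 := by
  split_ifs with h
  · interval_cases n <;> simp
  · rw [sum_sign_eq_zero (by omega), mul_zero]

/-- Sets of size $a$ contribute $n!$ times the average of the sign over $S_a$, which is 1 for
$a\le1$ and 0 otherwise. So $S_n$ has a two-dimensional space of invariants in the exterior algebra.
-/
theorem sum_conv_sign_one {Γ : Type*} {n : ℕ} (hn : n ≠ 0) (g : Fin n → Γ) :
    ∑ s, conv (signFun Γ) (oneFun Γ) n g s = 2 * n.factorial := by
  -- The summand ignores `g`; the label type `Unit` lets `sum_wreath_split` be used without a group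
  -- factor.
  let Ψ : (Fin n → Unit) → Equiv.Perm (Fin n) → Finset (Fin n) → ℂ := fun u s T =>
    evOn (signFun Unit) u s T * evOn (oneFun Unit) u s Tᶜ
  have hs := signFun_isClass Unit
  have ho := oneFun_isClass Unit
  have h1 : ∑ s, conv (signFun Γ) (oneFun Γ) n g s = ∑ u, ∑ s, ∑ T, Ψ u s T := by
    exact ((Fintype.sum_unique fun u => ∑ s, ∑ T, Ψ u s T).trans rfl).symm
  have hinv : ∀ u s T (π : Equiv.Perm (Fin n)),
      Ψ (u ∘ π.symm) (π * s * π⁻¹) (T.map π.toEmbedding) = Ψ u s T := by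
    intro u s T π
    have hc : (T.map π.toEmbedding)ᶜ = Tᶜ.map π.toEmbedding := by
      ext a
      simp
    simp only [Ψ]
    rw [hc, evOn_map hs T π.toEmbedding (g' := u) (s' := s) (by simp) (by simp),
      evOn_map ho Tᶜ π.toEmbedding (g' := u) (s' := s) (by simp) (by simp)]
  have h0 : ∀ u s T, ¬ Stable s T → Ψ u s T = 0 := fun u s T h => by
    simp only [Ψ]
    rw [evOn_of_not_stable _ _ _ _ h, zero_mul]
  have h2 : ∀ p ∈ Finset.HasAntidiagonal.antidiagonal n,
      ∑ u, ∑ s, ∑ T : Finset (Fin n), (if T.card = p.1 then Ψ u s T else 0) =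
      n.factorial * if p.1 ≤ 1 then 1 else 0 := by
    rintro ⟨a, b⟩ hp
    have hab : a + b = n := Finset.HasAntidiagonal.mem_antidiagonal.mp hp
    let e : Fin a ⊕ Fin b ≃ Fin n := finSumFinEquiv.trans (finCongr hab)
    have h3 := sum_wreath_split e Ψ hinv h0
    have h4 : ∀ (u₁ : Fin a → Unit) (s₁ : Equiv.Perm (Fin a)) (u₂ : Fin b → Unit)
        (s₂ : Equiv.Perm (Fin b)),
        Ψ (Sum.elim u₁ u₂ ∘ e.symm) (e.permCongr (Equiv.sumCongr s₁ s₂))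
          (Finset.univ.map (Function.Embedding.inl.trans e.toEmbedding)) =
          ((Equiv.Perm.sign s₁ : ℤ) : ℂ) := by
      intro u₁ s₁ u₂ s₂
      simp only [Ψ]
      rw [evOn_oneFun Unit _ _ _ (stable_map_inl e s₁ s₂).compl,
        evOn_map hs _ _ (g' := u₁) (s' := s₁) (by simp) (by simp), evOn_univ hs, mul_one, signFun]
    simp only [h4, Finset.sum_const, Finset.card_univ, Fintype.card_perm, Fintype.card_fin,
      nsmul_eq_mul, Fintype.card_unique, Nat.cast_one, one_mul, ← Finset.mul_sum, sum_sign, hab]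
      at h3
    have ha : (a.factorial : ℂ) ≠ 0 := Nat.cast_ne_zero.mpr a.factorial_ne_zero
    have hb : (b.factorial : ℂ) ≠ 0 := Nat.cast_ne_zero.mpr b.factorial_ne_zero
    push_cast at h3
    apply mul_left_cancel₀ (mul_ne_zero ha hb)
    rw [h3]
    ring
  have h5 : ∑ u, ∑ s, ∑ T, Ψ u s T = ∑ p ∈ Finset.HasAntidiagonal.antidiagonal n,
      ∑ u, ∑ s, ∑ T : Finset (Fin n), (if T.card = p.1 then Ψ u s T else 0) := by
    refine Eq.trans (Finset.sum_congr rfl fun u _ => ?_) Finset.sum_comm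
    refine Eq.trans (Finset.sum_congr rfl fun s _ => ?_) Finset.sum_comm
    exact sum_finset_eq_sum_antidiagonal _
  rw [h1, h5, Finset.sum_congr rfl h2, Finset.Nat.sum_antidiagonal_eq_sum_range_succ_mk]
  obtain ⟨k, rfl⟩ := Nat.exists_eq_succ_of_ne_zero hn
  rw [Finset.sum_range_succ', Finset.sum_range_succ']
  simp
  ring

/-- The pairing of the basic spin characters of two irreducible characters in degree `a`. -/
def pairCoeff {r : ℕ} (i j : Fin (r + 1)) (a : ℕ) : ℂ := if a = 0 then 1 else if i = j then 2 else 0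

/-- The tensor part gives $|\Gamma|^a\delta_{ij}$ for every permutation, and the exterior part then
sums to $2\,a!$ when $a>0$. -/
theorem sum_tensorCharInv_mul_spinWreath (i j : Fin (r + 1)) (a : ℕ) :
    ((Fintype.card Γ ^ a * a.factorial : ℕ) : ℂ)⁻¹ * ∑ g : Fin a → Γ, ∑ s : Equiv.Perm (Fin a),
      tensorCharInv (irrMat I i) g s * spinWreath I j a g s = pairCoeff i j a := by
  have h1 : ∑ g : Fin a → Γ, ∑ s : Equiv.Perm (Fin a),
      tensorCharInv (irrMat I i) g s * spinWreath I j a g s =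
      (if a = 0 ∨ i = j then (Fintype.card Γ : ℂ) ^ a else 0) *
        ∑ s, conv (signFun Γ) (oneFun Γ) a 1 s := by
    rw [Finset.sum_comm, Finset.mul_sum]
    refine Finset.sum_congr rfl fun s _ => ?_
    rw [← sum_tensorCharInv_mul_tensorChar I i j s, Finset.sum_mul]
    refine Finset.sum_congr rfl fun g _ => ?_
    rw [spinWreath, ← mul_assoc]
    rfl
  have hΓ : (Fintype.card Γ : ℂ) ^ a ≠ 0 := pow_ne_zero _ (Nat.cast_ne_zero.mpr Fintype.card_ne_zero)
  have ha : (a.factorial : ℂ) ≠ 0 := Nat.cast_ne_zero.mpr a.factorial_ne_zero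
  rw [h1, pairCoeff]
  by_cases h : a = 0
  · subst h
    have := ((signFun_isMult Γ).conv (oneFun_isMult Γ)).map_zero
    simp [this]
  · rw [sum_conv_sign_one h]
    push_cast
    by_cases hij : i = j
    · simp only [h, hij, or_true, if_true, if_false]
      field_simp
    · simp [h, hij]

end

end SpinWreath

end

noncomputable section

namespace SpinWreath

/-! ### The commutation relation of annihilation and creation operators -/

section

variable {Γ : Type*} [Group Γ] [Fintype Γ] {r : ℕ} (I : IrrepList Γ r) (i j : Fin (r + 1))
  {F : WreathFun Γ}

theorem compl_disjSum {A B : Type} [Fintype A] [DecidableEq A] [Fintype B] [DecidableEq B]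
    (S : Finset A) (T : Finset B) :
    (Finset.univ : Finset (A ⊕ B)) \ S.disjSum T = Sᶜ.disjSum Tᶜ := by
  ext (a | a) <;> simp

/-- Of the `l` indices being paired, those in `T` meet the created character and give a scalar; the
others are paired with `F`. -/
theorem sum_wreath_tensorCharInv_mul (hF : F.IsClass) {l n : ℕ} (g : Fin n → Γ)
    (s : Equiv.Perm (Fin n)) (U : Finset (Fin n)) {p : ℕ × ℕ}
    (hp : p ∈ Finset.HasAntidiagonal.antidiagonal l) :
    ((Fintype.card Γ ^ l * l.factorial : ℕ) : ℂ)⁻¹ * ∑ g₀ : Fin l → Γ,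
      ∑ s₀ : Equiv.Perm (Fin l), ∑ T : Finset (Fin l), (if T.card = p.1 then
        tensorCharInv (irrMat I i) g₀ s₀ * (evOn (spinWreath I j) g₀ s₀ T *
          evOn F (Sum.elim g₀ g) (Equiv.sumCongr s₀ s) (Tᶜ.disjSum U)) else 0) =
      pairCoeff i j p.1 * evOn (annihWreath (irrMat I i) p.2 F) g s U := by
  obtain ⟨a, b⟩ := p
  have hχ := (spinWreath_isMult I j).isClass
  let Ψ : (Fin l → Γ) → Equiv.Perm (Fin l) → Finset (Fin l) → ℂ := fun g₀ s₀ T =>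
    tensorCharInv (irrMat I i) g₀ s₀ * (evOn (spinWreath I j) g₀ s₀ T *
      evOn F (Sum.elim g₀ g) (Equiv.sumCongr s₀ s) (Tᶜ.disjSum U))
  have hinv : ∀ g₀ s₀ T (π : Equiv.Perm (Fin l)),
      Ψ (g₀ ∘ π.symm) (π * s₀ * π⁻¹) (T.map π.toEmbedding) = Ψ g₀ s₀ T := by
    intro g₀ s₀ T π
    have hc : ((T.map π.toEmbedding)ᶜ).disjSum U =
        (Tᶜ.disjSum U).map (π.sumCongr (Equiv.refl (Fin n))).toEmbedding := by
      ext (x | x) <;> simp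
    simp only [Ψ]
    rw [tensorCharInv_conj, hc, evOn_map hχ T π.toEmbedding (g' := g₀) (s' := s₀) (by simp)
      (by simp), evOn_map hF _ (π.sumCongr (Equiv.refl (Fin n))).toEmbedding
      (g' := Sum.elim g₀ g) (s' := Equiv.sumCongr s₀ s) (by rintro (x | x) <;> simp)
      (by rintro (x | x) <;> simp)]
  have h0 : ∀ g₀ s₀ T, ¬ Stable s₀ T → Ψ g₀ s₀ T = 0 := fun g₀ s₀ T h => by
    simp only [Ψ]
    rw [evOn_of_not_stable _ _ _ _ h, zero_mul, mul_zero]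
  have hab : a + b = l := Finset.HasAntidiagonal.mem_antidiagonal.mp hp
  let e : Fin a ⊕ Fin b ≃ Fin l := finSumFinEquiv.trans (finCongr hab)
  have h1 := sum_wreath_split e Ψ hinv h0
  rw [hab] at h1
  refine (inv_factorial_split hab _ Fintype.card_ne_zero _ _ h1).trans ?_
  have h2 : ∀ (g₁ : Fin a → Γ) (s₁ : Equiv.Perm (Fin a)) (g₂ : Fin b → Γ)
      (s₂ : Equiv.Perm (Fin b)),
      Ψ (Sum.elim g₁ g₂ ∘ e.symm) (e.permCongr (Equiv.sumCongr s₁ s₂))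
        (Finset.univ.map (Function.Embedding.inl.trans e.toEmbedding)) =
      (tensorCharInv (irrMat I i) g₁ s₁ * spinWreath I j a g₁ s₁) *
        (tensorCharInv (irrMat I i) g₂ s₂ *
          evOn F (Sum.elim g₂ g) (Equiv.sumCongr s₂ s) (Finset.univ.disjSum U)) := by
    intro g₁ s₁ g₂ s₂
    let k : Fin b ⊕ Fin n ↪ Fin l ⊕ Fin n :=
      (Function.Embedding.inr.trans e.toEmbedding).sumMap (Function.Embedding.refl _)
    have hc : (Finset.univ.map (Function.Embedding.inl.trans e.toEmbedding))ᶜ.disjSum U =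
        ((Finset.univ : Finset (Fin b)).disjSum U).map k := by
      ext (x | x)
      · obtain ⟨y, rfl⟩ := e.surjective x
        rcases y with y | y <;> simp [k]
      · simp [k]
    simp only [Ψ]
    rw [tensorCharInv_split, evOn_map hχ _ _ (g' := g₁) (s' := s₁) (by simp) (by simp),
      evOn_univ hχ, hc, evOn_map hF _ k (g' := Sum.elim g₂ g) (s' := Equiv.sumCongr s₂ s)
      (by rintro (x | x) <;> simp [k]) (by rintro (x | x) <;> simp [k])]
    ring
  simp only [h2]
  rw [evOn_annihWreath _ hF, ← sum_tensorCharInv_mul_spinWreath I i j a]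
  simp only [← Finset.mul_sum, ← Finset.sum_mul]
  ring

/-- A Mackey decomposition: the set carrying the created character splits into its part `T` among
the paired indices and its part `U` among the others, and multiplicativity separates the two. -/
theorem annihWreath_conv (hF : F.IsClass) (k l n : ℕ) (g : Fin n → Γ) (s : Equiv.Perm (Fin n)) :
    annihWreath (irrMat I i) l (conv (grade k (spinWreath I j)) F) n g s =
      ∑ p ∈ Finset.HasAntidiagonal.antidiagonal l, if p.1 ≤ k then pairCoeff i j p.1 *
        conv (grade (k - p.1) (spinWreath I j)) (annihWreath (irrMat I i) p.2 F) n g s else 0 := by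
  have hm := spinWreath_isMult I j
  set χ := spinWreath I j with hχ
  let Ψ : Finset (Fin n) → (Fin l → Γ) → Equiv.Perm (Fin l) → Finset (Fin l) → ℂ :=
    fun U g₀ s₀ T => tensorCharInv (irrMat I i) g₀ s₀ * (evOn χ g₀ s₀ T *
      evOn F (Sum.elim g₀ g) (Equiv.sumCongr s₀ s) (Tᶜ.disjSum U))
  have h1 : ∀ (g₀ : Fin l → Γ) (s₀ : Equiv.Perm (Fin l)), tensorCharInv (irrMat I i) g₀ s₀ *
      evOn (conv (grade k χ) F) (Sum.elim g₀ g) (Equiv.sumCongr s₀ s) Finset.univ =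
      ∑ U : Finset (Fin n), ∑ p ∈ Finset.HasAntidiagonal.antidiagonal l,
        (if p.1 + U.card = k then evOn χ g s U else 0) *
          ∑ T : Finset (Fin l), if T.card = p.1 then Ψ Uᶜ g₀ s₀ T else 0 := by
    intro g₀ s₀
    rw [evOn_conv (grade_isClass hm.isClass k) hF, Finset.powerset_univ,
      ← Equiv.sum_comp (Finset.sumEquiv (α := Fin l) (β := Fin n)).symm.toEquiv,
      Fintype.sum_prod_type, Finset.sum_comm, Finset.mul_sum]
    refine Finset.sum_congr rfl fun U _ => ?_
    rw [sum_finset_eq_sum_antidiagonal, Finset.mul_sum]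
    refine Finset.sum_congr rfl fun p _ => ?_
    rw [Finset.mul_sum, Finset.mul_sum]
    refine Finset.sum_congr rfl fun T _ => ?_
    by_cases hT : T.card = p.1
    · rw [if_pos hT, if_pos hT]
      change _ * (evOn (grade k χ) _ _ (T.disjSum U) * evOn F _ _ (Finset.univ \ T.disjSum U)) = _
      rw [compl_disjSum, evOn_grade, Finset.card_disjSum, hT, hm.evOn_disjSum]
      simp only [Ψ]
      split_ifs
      · ring
      · ring
    · rw [if_neg hT, if_neg hT, mul_zero, mul_zero]
  have h2 : annihWreath (irrMat I i) l (conv (grade k χ) F) n g s =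
      ∑ U : Finset (Fin n), ∑ p ∈ Finset.HasAntidiagonal.antidiagonal l,
        (if p.1 + U.card = k then evOn χ g s U else 0) *
          (((Fintype.card Γ ^ l * l.factorial : ℕ) : ℂ)⁻¹ * ∑ g₀, ∑ s₀,
            ∑ T : Finset (Fin l), if T.card = p.1 then Ψ Uᶜ g₀ s₀ T else 0) := by
    rw [annihWreath]
    simp only [h1]
    simp only [mul_left_comm _ (((Fintype.card Γ ^ l * l.factorial : ℕ) : ℂ)⁻¹), ← Finset.mul_sum]
    congr 1
    calc _ = ∑ g₀, ∑ U : Finset (Fin n), ∑ s₀, ∑ p ∈ Finset.HasAntidiagonal.antidiagonal l,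
        (if p.1 + U.card = k then evOn χ g s U else 0) *
          ∑ T : Finset (Fin l), (if T.card = p.1 then Ψ Uᶜ g₀ s₀ T else 0) :=
        Finset.sum_congr rfl fun _ _ => Finset.sum_comm
      _ = ∑ U : Finset (Fin n), ∑ g₀, ∑ s₀, ∑ p ∈ Finset.HasAntidiagonal.antidiagonal l,
        (if p.1 + U.card = k then evOn χ g s U else 0) *
          ∑ T : Finset (Fin l), (if T.card = p.1 then Ψ Uᶜ g₀ s₀ T else 0) := Finset.sum_comm
      _ = _ := by
        refine Finset.sum_congr rfl fun U _ => ?_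
        simp only [Finset.mul_sum (ι := Fin l → Γ), Finset.mul_sum (ι := Equiv.Perm (Fin l))]
        refine Eq.trans (Finset.sum_congr rfl fun g₀ _ => Finset.sum_comm) Finset.sum_comm
  rw [h2, Finset.sum_comm]
  refine Finset.sum_congr rfl fun p hp => ?_
  rw [Finset.sum_congr rfl fun U _ => by
    rw [sum_wreath_tensorCharInv_mul I i j hF g s Uᶜ hp]]
  split_ifs with hpk
  · rw [conv, Finset.mul_sum]
    refine Finset.sum_congr rfl fun U _ => ?_
    rw [evOn_grade, mul_left_comm]
    congr 2
    exact if_congr (by omega) rfl rfl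
  · refine Finset.sum_eq_zero fun U _ => ?_
    rw [if_neg (by omega), zero_mul]

end

end SpinWreath

end

noncomputable section

namespace SpinWreath

/-! ### Normal ordering of products of vertex operators -/

section

variable {V : Type*} [AddCommMonoid V] [Module ℂ V]

/-- Extension of a sequence of operators by zero to negative indices. -/
def extendInt (C : ℕ → Module.End ℂ V) (k : ℤ) : Module.End ℂ V := if 0 ≤ k then C k.toNat else 0

theorem extendInt_of_neg (C : ℕ → Module.End ℂ V) {k : ℤ} (hk : k < 0) : extendInt C k = 0 :=
  if_neg (by omega)

theorem extendInt_natCast (C : ℕ → Module.End ℂ V) (k : ℕ) : extendInt C k = C k := by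
  simp [extendInt]

theorem extendInt_comm {C C' : ℕ → Module.End ℂ V} (h : ∀ k l w, C k (C' l w) = C' l (C k w))
    (k l : ℤ) (w : V) : extendInt C k (extendInt C' l w) = extendInt C' l (extendInt C k w) := by
  unfold extendInt
  split_ifs <;> simp [h]

/-- The component of degree `n` of a vertex operator on vectors killed by `D l` for `l ≥ M`. -/
def modeSum (C D : ℕ → Module.End ℂ V) (n : ℤ) (M : ℕ) (w : V) : V :=
  ∑ l ∈ Finset.range M, (-1 : ℂ) ^ l • extendInt C (l - n) (D l w)

variable {C D C' D' : ℕ → Module.End ℂ V} {c : ℕ → ℂ}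

/-- After extension by zero to negative indices the restriction `p.1 ≤ k` is automatic. -/
theorem extendInt_commutation
    (hDC : ∀ k l w, D l (C' k w) = ∑ p ∈ Finset.HasAntidiagonal.antidiagonal l,
      if p.1 ≤ k then c p.1 • C' (k - p.1) (D p.2 w) else 0) (k : ℤ) (l : ℕ) (w : V) :
    D l (extendInt C' k w) = ∑ p ∈ Finset.HasAntidiagonal.antidiagonal l,
      c p.1 • extendInt C' (k - p.1) (D p.2 w) := by
  by_cases hk : 0 ≤ k
  · lift k to ℕ using hk
    rw [extendInt_natCast, hDC]
    refine Finset.sum_congr rfl fun p _ => ?_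
    split_ifs with h
    · rw [← Nat.cast_sub h, extendInt_natCast]
    · rw [extendInt_of_neg _ (by omega), LinearMap.zero_apply, smul_zero]
  · rw [extendInt_of_neg _ (by omega), LinearMap.zero_apply, map_zero]
    symm
    refine Finset.sum_eq_zero fun p _ => ?_
    rw [extendInt_of_neg _ (by omega), LinearMap.zero_apply, smul_zero]

omit [Module ℂ V] in
theorem sum_range_antidiagonal {K M L : ℕ} (hK : M + L ≤ K) (φ : ℕ → ℕ → V)
    (h1 : ∀ a u, M ≤ u → φ a u = 0) (h2 : ∀ a u, L ≤ a → φ a u = 0) :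
    ∑ l ∈ Finset.range K, ∑ p ∈ Finset.HasAntidiagonal.antidiagonal l, φ p.1 p.2 =
      ∑ u ∈ Finset.range M, ∑ a ∈ Finset.range L, φ a u := by
  rw [Finset.sum_sigma', ← Finset.sum_product']
  symm
  refine Finset.sum_of_injOn (fun q : ℕ × ℕ => (⟨q.1 + q.2, (q.2, q.1)⟩ : Σ _ : ℕ, ℕ × ℕ)) ?_ ?_ ?_ ?_
  · rintro ⟨u, a⟩ _ ⟨u', a'⟩ _ h
    simp only [Sigma.mk.injEq, heq_eq_eq, Prod.mk.injEq] at h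
    exact Prod.ext h.2.2 h.2.1
  · rintro ⟨u, a⟩ h
    simp only [Finset.coe_product, Finset.coe_range, Set.mem_prod, Set.mem_Iio] at h
    simp only [Finset.coe_sigma, Set.mem_sigma_iff, Finset.mem_coe, Finset.mem_range,
      Finset.HasAntidiagonal.mem_antidiagonal]
    omega
  · rintro ⟨l, a, u⟩ h hn
    simp only [Finset.mem_sigma, Finset.mem_range, Finset.HasAntidiagonal.mem_antidiagonal] at h
    by_cases hu : M ≤ u
    · exact h1 a u hu
    · by_cases ha : L ≤ a
      · exact h2 a u ha
      · refine absurd ⟨(u, a), ?_, ?_⟩ hn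
        · simp only [Finset.coe_product, Finset.coe_range, Set.mem_prod, Set.mem_Iio]
          omega
        · obtain ⟨-, rfl⟩ := h
          simp [add_comm]
  · intro q _
    rfl

/-- Normal ordering: all `D` are moved to the right, at the cost of the series `c`. The bounds `L`
and `K` cut the sums only where the terms vanish. -/
theorem modeSum_modeSum
    (hDC : ∀ k l w, D l (C' k w) = ∑ p ∈ Finset.HasAntidiagonal.antidiagonal l,
      if p.1 ≤ k then c p.1 • C' (k - p.1) (D p.2 w) else 0)
    {M L K : ℕ} (n n' : ℤ) (hL : (M : ℤ) - n' ≤ L) (hK : M + L ≤ K) (w : V)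
    (hw : ∀ u v, M ≤ u → D u (D' v w) = 0) :
    modeSum C D n K (modeSum C' D' n' M w) =
      ∑ v ∈ Finset.range M, ∑ u ∈ Finset.range M, (-1 : ℂ) ^ (u + v) •
        ∑ a ∈ Finset.range L, ((-1 : ℂ) ^ a * c a) •
          extendInt C (u - n + a) (extendInt C' (v - n' - a) (D u (D' v w))) := by
  have h1 : ∀ l v : ℕ, (-1 : ℂ) ^ l • extendInt C (l - n) (D l ((-1 : ℂ) ^ v •
      extendInt C' (v - n') (D' v w))) = ∑ p ∈ Finset.HasAntidiagonal.antidiagonal l,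
        (-1 : ℂ) ^ (p.2 + v) • ((-1 : ℂ) ^ p.1 * c p.1) • extendInt C (p.2 - n + p.1)
          (extendInt C' (v - n' - p.1) (D p.2 (D' v w))) := by
    intro l v
    rw [map_smul, extendInt_commutation hDC, map_smul, map_sum, smul_smul, Finset.smul_sum]
    refine Finset.sum_congr rfl fun p hp => ?_
    have hp' := Finset.HasAntidiagonal.mem_antidiagonal.mp hp
    rw [map_smul, smul_smul, smul_smul, show (l : ℤ) - n = p.2 - n + p.1 by omega, ← hp']
    congr 1
    ring
  unfold modeSum
  simp only [map_sum, Finset.smul_sum, h1]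
  rw [Finset.sum_comm]
  refine Finset.sum_congr rfl fun v hv => ?_
  have hv' := Finset.mem_range.mp hv
  rw [sum_range_antidiagonal hK fun a u => (-1 : ℂ) ^ (u + v) • ((-1 : ℂ) ^ a * c a) •
    extendInt C (u - n + a) (extendInt C' (v - n' - a) (D u (D' v w)))]
  · intro a u hu
    simp [hw u v hu]
  · intro a u ha
    -- Since $v<M$ and $a\ge L\ge M-n'$, the index $v-n'-a$ is negative.
    rw [extendInt_of_neg C' (by omega)]
    simp

/-- The series $\sum c_ax^a=(1+x)/(1-x)$ and its reflection in $x^{-1}$ add up to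
$2\sum_{a\in\mathbb Z}x^a$. The term $a=0$ occurs in both, so its weight also becomes 2. -/
theorem sum_range_add_sum_range_neg (hc0 : c 0 = 1) (hc : ∀ a, a ≠ 0 → c a = 2) (f : ℤ → V)
    {L : ℕ} (hL : L ≠ 0) (hf : ∀ a : ℤ, (L : ℤ) ≤ a.natAbs → f a = 0) :
    ∑ a ∈ Finset.range L, c a • f a + ∑ a ∈ Finset.range L, c a • f (-a) =
      (2 : ℂ) • ∑ᶠ a, f a := by
  have h1 : ∀ K : ℕ, ∑ a ∈ Finset.range (K + 1), c a • f a +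
      ∑ a ∈ Finset.range (K + 1), c a • f (-a) =
      (2 : ℂ) • ∑ a ∈ Finset.Ioo (-(K + 1) : ℤ) (K + 1), f a := by
    intro K
    induction K with
    | zero =>
      have : Finset.Ioo (-((0 : ℕ) + 1) : ℤ) ((0 : ℕ) + 1) = {0} := by
        ext a; simp only [Finset.mem_Ioo, Finset.mem_singleton]; omega
      rw [this]
      simp [hc0, two_smul]
    | succ K ih =>
      have h2 : Finset.Ioo (-((K + 1 : ℕ) + 1) : ℤ) ((K + 1 : ℕ) + 1) =
          insert ((K : ℤ) + 1) (insert (-((K : ℤ) + 1)) (Finset.Ioo (-(K + 1) : ℤ) (K + 1))) := by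
        ext a; simp only [Finset.mem_Ioo, Finset.mem_insert]; omega
      rw [h2, Finset.sum_insert, Finset.sum_insert, Finset.sum_range_succ, Finset.sum_range_succ _ (K + 1),
        smul_add, smul_add, ← ih, hc _ K.succ_ne_zero]
      · push_cast
        abel
      · simp
      · simp only [Finset.mem_insert, Finset.mem_Ioo]; omega
  obtain ⟨K, rfl⟩ := Nat.exists_eq_succ_of_ne_zero hL
  rw [Nat.succ_eq_add_one, h1 K, finsum_eq_sum_of_support_subset]
  intro a ha
  have := mt (hf a) ha
  simp only [Finset.coe_Ioo, Set.mem_Ioo]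
  omega

theorem finsum_extendInt (h0 : C 0 = 1)
    (h1 : ∀ N, N ≠ 0 → ∀ w, ∑ p ∈ Finset.HasAntidiagonal.antidiagonal N,
      (-1 : ℂ) ^ p.1 • C p.1 (C p.2 w) = 0) (N : ℤ) (w : V) :
    ∑ᶠ p : ℤ, (-1 : ℂ) ^ p • extendInt C p (extendInt C (N - p) w) = if N = 0 then w else 0 := by
  by_cases hN : 0 ≤ N
  · lift N to ℕ using hN
    have h2 : ∑ᶠ p : ℤ, (-1 : ℂ) ^ p • extendInt C p (extendInt C (N - p) w) =
        ∑ p ∈ Finset.HasAntidiagonal.antidiagonal N, (-1 : ℂ) ^ p.1 • C p.1 (C p.2 w) := by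
      rw [finsum_eq_sum_of_support_subset (s := (Finset.range (N + 1)).map Nat.castEmbedding)]
      · rw [Finset.sum_map, Finset.Nat.sum_antidiagonal_eq_sum_range_succ_mk]
        refine Finset.sum_congr rfl fun a ha => ?_
        rw [Nat.castEmbedding_apply, extendInt_natCast, ← Nat.cast_sub (by
          have := Finset.mem_range.mp ha; omega), extendInt_natCast, zpow_natCast]
      · intro p hp
        rw [Function.mem_support] at hp
        have hp0 : 0 ≤ p := by
          by_contra h
          exact hp (by rw [extendInt_of_neg _ (by omega)]; simp)
        have hpN : p ≤ N := by
          by_contra h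
          exact hp (by rw [extendInt_of_neg (k := N - p) _ (by omega)]; simp)
        simp only [Finset.coe_map, Set.mem_image, Finset.mem_coe, Finset.mem_range]
        exact ⟨p.toNat, by omega, by simp [hp0]⟩
    rw [h2]
    by_cases hz : N = 0
    · subst hz; simp [h0]
    · rw [h1 N hz, if_neg (by exact_mod_cast hz)]
  · rw [if_neg (by omega)]
    refine (finsum_congr fun p => ?_).trans finsum_zero
    by_cases hp : p < 0
    · rw [extendInt_of_neg _ hp]; simp
    · rw [extendInt_of_neg (k := N - p) _ (by omega)]; simp

theorem neg_one_zpow_mul_self (n : ℤ) : (-1 : ℂ) ^ n * (-1) ^ n = 1 := by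
  rw [← mul_zpow]; simp

/-- The delta function sets the second variable to minus the first, and there
$H_+(\alpha,w)H_+(\alpha,-w)=1$ collapses the product; the substitution $p=x+a$ reduces it to
`finsum_extendInt`. -/
theorem finsum_extendInt_shift (h0 : C 0 = 1)
    (h1 : ∀ N, N ≠ 0 → ∀ w, ∑ p ∈ Finset.HasAntidiagonal.antidiagonal N,
      (-1 : ℂ) ^ p.1 • C p.1 (C p.2 w) = 0) (x y : ℤ) (w : V) :
    ∑ᶠ a : ℤ, (-1 : ℂ) ^ a • extendInt C (x + a) (extendInt C (y - a) w) =
      if x + y = 0 then (-1 : ℂ) ^ x • w else 0 := by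
  have h2 := finsum_extendInt h0 h1 (x + y) ((-1 : ℂ) ^ x • w)
  rw [← finsum_comp_equiv (Equiv.addLeft x)] at h2
  rw [← h2]
  refine finsum_congr fun a => ?_
  rw [Equiv.coe_addLeft, map_smul, map_smul, smul_smul, zpow_add₀ (by norm_num), mul_right_comm,
    neg_one_zpow_mul_self, one_mul, show x + y - (x + a) = y - a by ring]

theorem sum_range_range (h0 : D 0 = 1)
    (h1 : ∀ N, N ≠ 0 → ∀ w, ∑ p ∈ Finset.HasAntidiagonal.antidiagonal N,
      (-1 : ℂ) ^ p.1 • D p.2 (D p.1 w) = 0) {M : ℕ} (w : V)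
    (hw : ∀ u v, M ≤ u ∨ M ≤ v → D u (D v w) = 0) (N : ℤ) :
    ∑ v ∈ Finset.range M, ∑ u ∈ Finset.range M,
      (if (u : ℤ) + v = N then (-1 : ℂ) ^ v • D u (D v w) else 0) = if N = 0 then w else 0 := by
  by_cases hN : 0 ≤ N
  · lift N to ℕ using hN
    have h2 : ∑ v ∈ Finset.range M, ∑ u ∈ Finset.range M,
      (if (u : ℤ) + v = N then (-1 : ℂ) ^ v • D u (D v w) else 0) =
        ∑ p ∈ Finset.HasAntidiagonal.antidiagonal N, (-1 : ℂ) ^ p.1 • D p.2 (D p.1 w) := by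
      rw [← Finset.sum_product', ← Finset.sum_filter]
      refine Finset.sum_subset ?_ ?_
      · rintro ⟨v, u⟩ h
        rw [Finset.mem_filter] at h
        rw [Finset.HasAntidiagonal.mem_antidiagonal]
        dsimp only at h ⊢
        omega
      · rintro ⟨v, u⟩ h hn
        rw [Finset.HasAntidiagonal.mem_antidiagonal] at h
        rw [Finset.mem_filter, Finset.mem_product, Finset.mem_range, Finset.mem_range] at hn
        dsimp only at h hn ⊢
        rw [hw u v (by omega), smul_zero]
    rw [h2]
    by_cases hz : N = 0
    · subst hz; simp [h0]
    · rw [h1 N hz, if_neg (by exact_mod_cast hz)]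
  · rw [if_neg (by omega)]
    refine Finset.sum_eq_zero fun v _ => Finset.sum_eq_zero fun u _ => if_neg (by omega)

/-- The vertex operators of one lattice vector satisfy the Clifford relations. -/
theorem modeSum_anticommutator
    (hc0 : c 0 = 1) (hc : ∀ a, a ≠ 0 → c a = 2) (hC0 : C 0 = 1) (hD0 : D 0 = 1)
    (hCC : ∀ k l w, C k (C l w) = C l (C k w)) (hDD : ∀ k l w, D k (D l w) = D l (D k w))
    (hDC : ∀ k l w, D l (C k w) = ∑ p ∈ Finset.HasAntidiagonal.antidiagonal l,
      if p.1 ≤ k then c p.1 • C (k - p.1) (D p.2 w) else 0)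
    (hC1 : ∀ N, N ≠ 0 → ∀ w, ∑ p ∈ Finset.HasAntidiagonal.antidiagonal N,
      (-1 : ℂ) ^ p.1 • C p.1 (C p.2 w) = 0)
    (hD1 : ∀ N, N ≠ 0 → ∀ w, ∑ p ∈ Finset.HasAntidiagonal.antidiagonal N,
      (-1 : ℂ) ^ p.1 • D p.2 (D p.1 w) = 0)
    {M L K : ℕ} (n n' : ℤ) (hL0 : L ≠ 0) (hL : (M : ℤ) - n' ≤ L) (hL' : (M : ℤ) - n ≤ L)
    (hK : M + L ≤ K) (w : V) (hw : ∀ u v, M ≤ u → D u (D v w) = 0) :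
    modeSum C D n K (modeSum C D n' M w) + modeSum C D n' K (modeSum C D n M w) =
      (if n = -n' then 2 * (-1 : ℂ) ^ n else 0) • w := by
  rw [modeSum_modeSum hDC n n' hL hK w hw, modeSum_modeSum hDC n' n hL' hK w hw,
    Finset.sum_comm (f := fun v u : ℕ => (-1 : ℂ) ^ (u + v) •
        ∑ a ∈ Finset.range L, ((-1 : ℂ) ^ a * c a) •
          extendInt C (u - n' + a) (extendInt C (v - n - a) (D u (D v w))))]
  simp only [← Finset.sum_add_distrib]
  have h1 : ∀ u v : ℕ, u < M → v < M → (-1 : ℂ) ^ (u + v) • ∑ a ∈ Finset.range L,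
        ((-1 : ℂ) ^ a * c a) • extendInt C (u - n + a) (extendInt C (v - n' - a) (D u (D v w))) +
      (-1 : ℂ) ^ (v + u) • ∑ a ∈ Finset.range L, ((-1 : ℂ) ^ a * c a) •
          extendInt C (v - n' + a) (extendInt C (u - n - a) (D v (D u w))) =
      (2 * (-1 : ℂ) ^ n) • if (u : ℤ) + v = n + n' then (-1 : ℂ) ^ v • D u (D v w) else 0 := by
    intro u v hu hv
    have h2 := sum_range_add_sum_range_neg hc0 hc (fun a : ℤ => (-1 : ℂ) ^ a •
      extendInt C (u - n + a) (extendInt C (v - n' - a) (D u (D v w)))) hL0 (by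
        intro a ha
        by_cases h : 0 ≤ a
        · rw [extendInt_of_neg (k := v - n' - a) _ (by omega)]; simp
        · rw [extendInt_of_neg (k := u - n + a) _ (by omega)]; simp)
    rw [finsum_extendInt_shift hC0 hC1] at h2
    rw [add_comm v u, ← smul_add]
    have h3 : ∑ a ∈ Finset.range L, ((-1 : ℂ) ^ a * c a) •
          extendInt C (u - n + a) (extendInt C (v - n' - a) (D u (D v w))) +
        ∑ a ∈ Finset.range L, ((-1 : ℂ) ^ a * c a) •
          extendInt C (v - n' + a) (extendInt C (u - n - a) (D v (D u w))) =
        (2 : ℂ) • if (u : ℤ) - n + (v - n') = 0 then (-1 : ℂ) ^ ((u : ℤ) - n) • D u (D v w)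
          else 0 := by
      rw [← h2]
      congr 1
      · refine Finset.sum_congr rfl fun a _ => ?_
        rw [smul_smul, zpow_natCast, mul_comm]
      · refine Finset.sum_congr rfl fun a _ => ?_
        -- The swapped product is the same function at $-a$: its sign depends only on the parity of
        -- $a$, and the `C`, like the `D`, commute among themselves.
        rw [smul_smul, zpow_neg, zpow_natCast, hDD v u, extendInt_comm hCC, mul_comm, ← inv_pow]
        norm_num
        rfl
    rw [h3]
    by_cases h : (u : ℤ) + v = n + n'
    · rw [if_pos (by omega), if_pos h, smul_smul, smul_smul, smul_smul]
      congr 1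
      rw [zpow_sub₀ (by norm_num), zpow_natCast, pow_add, div_eq_mul_inv, ← zpow_neg]
      have h4 : (-1 : ℂ) ^ (-n) = (-1) ^ n := by rw [zpow_neg, ← inv_zpow]; norm_num
      have h5 : (-1 : ℂ) ^ u * (-1) ^ u = 1 := by rw [← mul_pow]; simp
      rw [h4]
      linear_combination (2 * (-1) ^ v * (-1) ^ n) * h5
    · rw [if_neg (by omega), if_neg h, smul_zero, smul_zero, smul_zero]
  rw [Finset.sum_congr rfl fun v hv => Finset.sum_congr rfl fun u hu =>
    h1 u v (Finset.mem_range.mp hu) (Finset.mem_range.mp hv)]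
  simp only [← Finset.smul_sum]
  rw [sum_range_range hD0 hD1 w (by
    rintro u v (h | h)
    · exact hw u v h
    · rw [hDD]; exact hw v u h) (n + n')]
  by_cases h : n = -n'
  · rw [if_pos h, if_pos (by omega)]
  · rw [if_neg h, if_neg (by omega), smul_zero, zero_smul]

/-- The vertex operators of orthogonal lattice vectors commute on the Fock space. -/
theorem modeSum_comm {c' : ℕ → ℂ}
    (hc0 : c 0 = 1) (hc : ∀ a, a ≠ 0 → c a = 0) (hc0' : c' 0 = 1) (hc' : ∀ a, a ≠ 0 → c' a = 0)
    (hCC : ∀ k l w, C k (C' l w) = C' l (C k w)) (hDD : ∀ k l w, D k (D' l w) = D' l (D k w))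
    (hDC : ∀ k l w, D l (C' k w) = ∑ p ∈ Finset.HasAntidiagonal.antidiagonal l,
      if p.1 ≤ k then c p.1 • C' (k - p.1) (D p.2 w) else 0)
    (hDC' : ∀ k l w, D' l (C k w) = ∑ p ∈ Finset.HasAntidiagonal.antidiagonal l,
      if p.1 ≤ k then c' p.1 • C (k - p.1) (D' p.2 w) else 0)
    {M L K : ℕ} (n n' : ℤ) (hL0 : L ≠ 0) (hL : (M : ℤ) - n' ≤ L) (hL' : (M : ℤ) - n ≤ L)
    (hK : M + L ≤ K) (w : V) (hw : ∀ u v, M ≤ u → D u (D' v w) = 0)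
    (hw' : ∀ u v, M ≤ u → D' u (D v w) = 0) :
    modeSum C D n K (modeSum C' D' n' M w) = modeSum C' D' n' K (modeSum C D n M w) := by
  -- With these coefficients reordering produces no corrections, and both products have the same
  -- normal ordered form.
  have key : ∀ {c : ℕ → ℂ}, c 0 = 1 → (∀ a, a ≠ 0 → c a = 0) → ∀ f : ℕ → V,
      ∑ a ∈ Finset.range L, ((-1 : ℂ) ^ a * c a) • f a = f 0 := by
    intro c h0 h f
    rw [Finset.sum_eq_single 0]
    · simp [h0]
    · intro a _ ha; simp [h a ha]
    · intro h; exact absurd (Finset.mem_range.mpr (Nat.pos_of_ne_zero hL0)) h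
  rw [modeSum_modeSum hDC n n' hL hK w hw, modeSum_modeSum hDC' n' n hL' hK w hw', Finset.sum_comm]
  refine Finset.sum_congr rfl fun u _ => Finset.sum_congr rfl fun v _ => ?_
  rw [key hc0 hc fun a => extendInt C (u - n + a) (extendInt C' (v - n' - a) (D u (D' v w))),
    key hc0' hc' fun a => extendInt C' (v - n' + a) (extendInt C (u - n - a) (D' v (D u w))),
    add_comm, extendInt_comm hCC, hDD]
  simp

end

end SpinWreath

end

noncomputable section

namespace SpinWreath

/-! ### The operators on the Fock space -/

section

variable {Γ : Type*} [Group Γ]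

/-- An element of the Fock space as a family of functions on the groups `Γ^n ⋊ S_n`. -/
def fockWreath : FockR Γ →ₗ[ℂ] WreathFun Γ where
  toFun F := toWreath fun n => F n
  map_add' _ _ := rfl
  map_smul' _ _ := rfl

theorem fockWreath_isClass (F : FockR Γ) : (fockWreath F).IsClass := toWreath_isClass _

variable [Fintype Γ]

omit [Fintype Γ] in
theorem spinFun_ext {n : ℕ} {f f' : SpinFun Γ n}
    (h : ∀ g s, (f : SpinGroup Γ n → ℂ) (wElt g s) = (f' : SpinGroup Γ n → ℂ) (wElt g s)) :
    f = f' :=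
  sub_eq_zero.mp (spinFun_eq_zero (f - f') fun g s => sub_eq_zero.mpr (h g s))

omit [Fintype Γ] in
theorem fockWreath_injective : Function.Injective (fockWreath (Γ := Γ)) := by
  intro F G h
  refine DFinsupp.ext fun n => spinFun_ext fun g s => ?_
  exact congrFun (congrFun (congrFun h n) g) s

variable {r : ℕ} (I : IrrepList Γ r) (α : Fin (r + 1) → ℤ)

theorem Hcreate_apply {k p n : ℕ} (h : k + p = n) (F : FockR Γ) :
    Hcreate I α k F n = createComp I α h (F p) := by
  subst h
  have h1 : DirectSum.component ℂ ℕ (fun n => SpinFun Γ n) (k + p) ∘ₗ Hcreate I α k =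
      createComp I α rfl ∘ₗ DirectSum.component ℂ ℕ (fun n => SpinFun Γ n) p := by
    refine DirectSum.linearMap_ext ℂ fun m => LinearMap.ext fun f => ?_
    simp only [LinearMap.comp_apply, Hcreate, DirectSum.toModule_lof]
    by_cases hm : m = p
    · subst hm
      rw [DirectSum.component.lof_self, DirectSum.component.lof_self]
    · rw [DirectSum.component.of, DirectSum.component.of, dif_neg (by omega), dif_neg hm, map_zero]
  exact LinearMap.congr_fun h1 F

theorem Hcreate_apply_of_lt {k n : ℕ} (h : n < k) (F : FockR Γ) : Hcreate I α k F n = 0 := by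
  have h1 : DirectSum.component ℂ ℕ (fun n => SpinFun Γ n) n ∘ₗ Hcreate I α k = 0 := by
    refine DirectSum.linearMap_ext ℂ fun m => LinearMap.ext fun f => ?_
    simp only [LinearMap.comp_apply, Hcreate, DirectSum.toModule_lof]
    rw [DirectSum.component.of, dif_neg (by omega)]
    rfl
  exact LinearMap.congr_fun h1 F

theorem Hannih_apply {l p m : ℕ} (h : l + p = m) (F : FockR Γ) :
    Hannih I α l F p = annihComp I α h (F m) := by
  subst h
  have h1 : DirectSum.component ℂ ℕ (fun n => SpinFun Γ n) p ∘ₗ Hannih I α l =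
      annihComp I α rfl ∘ₗ DirectSum.component ℂ ℕ (fun n => SpinFun Γ n) (l + p) := by
    refine DirectSum.linearMap_ext ℂ fun m => LinearMap.ext fun f => ?_
    simp only [LinearMap.comp_apply, Hannih, DirectSum.toModule_lof]
    by_cases hm : m = l + p
    · subst hm
      rw [DirectSum.component.lof_self, dif_pos (by omega), LinearMap.comp_apply]
      -- The component index is `l + p - l`, equal to `p` only propositionally; generalising it
      -- allows substitution.
      have h2 : ∀ q, ∀ hq : l + q = l + p, q = p →
          DirectSum.component ℂ ℕ (fun n => SpinFun Γ n) p
          (DirectSum.lof ℂ ℕ (fun n => SpinFun Γ n) q (annihComp I α hq f)) =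
          annihComp I α rfl f := by
        intro q hq hqp
        subst hqp
        rw [DirectSum.component.lof_self]
      exact h2 _ _ (by omega)
    · have h3 : DirectSum.component ℂ ℕ (fun n => SpinFun Γ n) (l + p)
          (DirectSum.lof ℂ ℕ (fun n => SpinFun Γ n) m f) = 0 := by
        rw [DirectSum.component.of, dif_neg hm]
      rw [h3, map_zero]
      split_ifs with hl
      · rw [LinearMap.comp_apply, DirectSum.component.of, dif_neg (by omega)]
      · rw [LinearMap.zero_apply, map_zero]
  exact LinearMap.congr_fun h1 F

/-! ### The spin characters of `±γ_i` -/

/-- The spin characters as class functions. -/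
def spinFam (n : ℕ) : SpinFun Γ n := ⟨spinChar I α n, by
  have h : spinChar I α n = ∑ m : Fin (n + 1), (-1 : ℂ) ^ (m : ℕ) •
      indProd (l := n - m) (p := m) (m := n) (by omega)
      (basicChar I (fun i => (α i).toNat) (n - m)) (basicChar I (fun i => (-α i).toNat) m) := by
    funext x
    rw [Finset.sum_apply]
    rfl
  rw [h]
  exact Submodule.sum_mem _ fun m _ => Submodule.smul_mem _ _
    (indProd_mem _ _ (basicChar_odd I _ _) (basicFam I (fun i => (-α i).toNat) m))⟩

theorem toWreath_spinFam (n : ℕ) (g : Fin n → Γ) (s : Equiv.Perm (Fin n)) :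
    toWreath (spinFam I α) n g s = ∑ m : Fin (n + 1), (-1 : ℂ) ^ (m : ℕ) *
      conv (grade (n - m) (toWreath (basicFam I fun i => (α i).toNat)))
        (toWreath (basicFam I fun i => (-α i).toNat)) n g s := by
  change spinChar I α n (wElt g s) = _
  unfold spinChar
  refine Finset.sum_congr rfl fun m _ => ?_
  rw [← indProd_wElt (show n - (m : ℕ) + m = n by omega) (basicFam I fun i => (α i).toNat)]
  rfl

omit [Group Γ] [Fintype Γ] in
theorem evOn_of_eq_zero {F : WreathFun Γ} {k : ℕ} (h : ∀ g s, F k g s = 0) {A : Type} (g : A → Γ)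
    (s : Equiv.Perm A) (S : Finset A) (hS : S.card = k) : evOn F g s S = 0 := by
  subst hS
  unfold evOn
  split_ifs
  · exact h _ _
  · rfl

omit [Group Γ] [Fintype Γ] in
theorem conv_of_delta {F E : WreathFun Γ} (hF : F.IsClass) (hE : E.IsClass)
    (hE0 : ∀ n g s, E n g s = if n = 0 then 1 else 0) : conv F E = F := by
  funext n g s
  rw [conv, Finset.sum_eq_single Finset.univ]
  · rw [evOn_univ hF, Finset.compl_univ, evOn_eq hE (n := 0) (fun i => i.elim0)
      (fun i => i.elim0) (by simp) (fun i => i.elim0) (fun i => i.elim0) 1 (fun i => i.elim0), hE0]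
    simp
  · intro T _ hT
    rw [evOn_of_eq_zero (F := E) (k := Tᶜ.card) (fun g s => ?_) _ _ _ rfl, mul_zero]
    rw [hE0, if_neg]
    rwa [Finset.card_eq_zero, Finset.compl_eq_empty_iff]
  · intro h
    exact absurd (Finset.mem_univ _) h

variable (i : Fin (r + 1))

/-- The multiplicities of the irreducible representation `γ_i`. -/
def singleMult (i : Fin (r + 1)) : Fin (r + 1) → ℕ := fun j => if j = i then 1 else 0

theorem toNat_single (i : Fin (r + 1)) :
    (fun j => ((Pi.single i 1 : Fin (r + 1) → ℤ) j).toNat) = singleMult i := by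
  funext j
  by_cases h : j = i
  · subst h; simp [singleMult]
  · simp [singleMult, h]

theorem toNat_neg_single (i : Fin (r + 1)) :
    (fun j => (-(Pi.single i 1 : Fin (r + 1) → ℤ) j).toNat) = 0 := by
  funext j
  by_cases h : j = i
  · subst h; simp
  · simp [h]

omit [Fintype Γ] in
theorem toWreath_basicFam_singleMult : toWreath (basicFam I (singleMult i)) = spinWreath I i :=
  toWreath_basicFam_single I _ i (if_pos rfl) fun _ hj => if_neg hj

/-- The negative part is zero, so only $m=0$ survives in the alternating sum. -/
theorem spinChar_single (n : ℕ) :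
    spinChar I (Pi.single i 1) n = basicChar I (singleMult i) n := by
  have h : spinFam I (Pi.single i 1) n = basicFam I (singleMult i) n := by
    refine spinFun_ext fun g s => ?_
    change toWreath (spinFam I (Pi.single i 1)) n g s = toWreath (basicFam I (singleMult i)) n g s
    have hc := toWreath_isClass (basicFam I (singleMult i))
    rw [toWreath_spinFam, toNat_single, toNat_neg_single,
      Finset.sum_congr rfl fun m _ => by
        rw [conv_of_delta (grade_isClass hc _) (toWreath_isClass _) (toWreath_basicFam_zero I)],
      Finset.sum_eq_single 0]
    · simp [grade]
    · intro m _ hm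
      rw [grade, if_neg, mul_zero]
      have : (m : ℕ) ≠ 0 := fun h => hm (Fin.ext h)
      omega
    · simp
  exact congrArg Subtype.val h

/-- The positive part is zero, so only $m=n$ survives, with its sign. -/
theorem spinChar_neg_single (n : ℕ) (x : SpinGroup Γ n) :
    spinChar I (-Pi.single i 1) n x = (-1 : ℂ) ^ n * spinChar I (Pi.single i 1) n x := by
  have h : spinFam I (-Pi.single i 1) n = (-1 : ℂ) ^ n • basicFam I (singleMult i) n := by
    refine spinFun_ext fun g s => ?_
    change toWreath (spinFam I (-Pi.single i 1)) n g s =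
      (-1) ^ n * toWreath (basicFam I (singleMult i)) n g s
    have hc := toWreath_isClass (basicFam I (singleMult i))
    have e1 : (fun j => ((-Pi.single i 1 : Fin (r + 1) → ℤ) j).toNat) = 0 := toNat_neg_single i
    have e2 : (fun j => (-(-Pi.single i 1 : Fin (r + 1) → ℤ) j).toNat) = singleMult i := by
      rw [← toNat_single]
      funext j
      simp
    rw [toWreath_spinFam, e1, e2, Finset.sum_eq_single (Fin.last n)]
    · rw [conv_comm, conv_of_delta hc (grade_isClass (toWreath_isClass _) _), Fin.val_last]
      intro n' g s
      simp only [grade, toWreath_basicFam_zero, Fin.val_last]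
      split_ifs <;> first | rfl | omega
    · intro m _ hm
      have hm' : (m : ℕ) ≠ n := fun h => hm (Fin.ext h)
      have hlt := m.2
      refine mul_eq_zero_of_right _ (Finset.sum_eq_zero fun T _ => ?_)
      rw [evOn_of_eq_zero (fun g s => ?_) _ _ _ rfl, zero_mul]
      simp only [grade, toWreath_basicFam_zero]
      split_ifs <;> first | rfl | omega
    · simp
  rw [spinChar_single]
  exact congrFun (congrArg Subtype.val h) x

theorem fockWreath_Hcreate (k : ℕ) (F : FockR Γ) :
    fockWreath (Hcreate I (Pi.single i 1) k F) =
      conv (grade k (spinWreath I i)) (fockWreath F) := by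
  funext n g s
  change ((Hcreate I (Pi.single i 1) k F) n : SpinGroup Γ n → ℂ) (wElt g s) = _
  by_cases h : k ≤ n
  · obtain ⟨p, rfl⟩ := Nat.exists_eq_add_of_le h
    rw [Hcreate_apply I _ rfl]
    change indProd rfl (spinChar I (Pi.single i 1) k) (F p) (wElt g s) = _
    rw [spinChar_single, ← toWreath_basicFam_singleMult]
    exact indProd_wElt rfl (basicFam I (singleMult i)) (fun n => F n) g s
  · rw [Hcreate_apply_of_lt I _ (by omega)]
    symm
    refine Finset.sum_eq_zero fun T _ => ?_
    have hT : T.card ≤ n := by simpa using Finset.card_le_univ T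
    rw [evOn_grade, if_neg (by omega), zero_mul]

theorem fockWreath_Hannih (l : ℕ) (F : FockR Γ) :
    fockWreath (Hannih I (Pi.single i 1) l F) = annihWreath (irrMat I i) l (fockWreath F) := by
  funext n g s
  change ((Hannih I (Pi.single i 1) l F) n : SpinGroup Γ n → ℂ) (wElt g s) = _
  rw [Hannih_apply I _ rfl]
  change resPair rfl (spinChar I (Pi.single i 1) l) (F (l + n)) (wElt g s) = _
  have h1 : singleMult i i = 1 := if_pos rfl
  have h0 : ∀ j, j ≠ i → singleMult i j = 0 := fun j hj => if_neg hj
  have h2 := resPair_wElt rfl I (singleMult i) (sumSpaceBasis I (singleMult i) i h1 h0)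
    (fun n => F n) (l := l) g s
  simp only [toMatrix_sumSpaceBasis] at h2
  rw [spinChar_single]
  exact h2

theorem createComp_neg_single {l p m : ℕ} (h : l + p = m) (f : SpinFun Γ p) :
    createComp I (-Pi.single i 1) h f = (-1 : ℂ) ^ l • createComp I (Pi.single i 1) h f := by
  have h1 : spinFam I (-Pi.single i 1) l = (-1 : ℂ) ^ l • spinFam I (Pi.single i 1) l :=
    Subtype.ext (funext fun x => spinChar_neg_single I i l x)
  classical
  refine Subtype.ext (funext fun x => ?_)
  change indProd h (spinChar I (-Pi.single i 1) l) f x =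
    (-1) ^ l * indProd h (spinChar I (Pi.single i 1) l) f x
  unfold indProd induced
  rw [mul_left_comm, Finset.mul_sum _ _ ((-1 : ℂ) ^ l)]
  congr 1
  refine Finset.sum_congr rfl fun y _ => ?_
  split_ifs
  · simp only [outerTensor, spinChar_neg_single]
    rw [mul_left_comm, Finset.mul_sum _ _ ((-1 : ℂ) ^ l)]
    congr 1
    refine Finset.sum_congr rfl fun t _ => ?_
    rw [Finset.mul_sum]
    refine Finset.sum_congr rfl fun u _ => ?_
    split_ifs
    · ring
    · simp
  · simp

theorem annihComp_neg_single {l p m : ℕ} (h : l + p = m) (f : SpinFun Γ m) :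
    annihComp I (-Pi.single i 1) h f = (-1 : ℂ) ^ l • annihComp I (Pi.single i 1) h f := by
  refine Subtype.ext (funext fun x => ?_)
  change resPair h (spinChar I (-Pi.single i 1) l) f x =
    (-1) ^ l * resPair h (spinChar I (Pi.single i 1) l) f x
  unfold resPair
  rw [mul_left_comm, Finset.mul_sum _ _ ((-1 : ℂ) ^ l)]
  congr 1
  refine Finset.sum_congr rfl fun y _ => ?_
  rw [spinChar_neg_single, mul_assoc]

theorem Hcreate_neg_single (k : ℕ) (F : FockR Γ) :
    Hcreate I (-Pi.single i 1) k F = (-1 : ℂ) ^ k • Hcreate I (Pi.single i 1) k F := by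
  refine DFinsupp.ext fun n => ?_
  rw [DirectSum.smul_apply]
  by_cases h : k ≤ n
  · obtain ⟨p, rfl⟩ := Nat.exists_eq_add_of_le h
    rw [Hcreate_apply I _ rfl, Hcreate_apply I _ rfl, createComp_neg_single]
  · rw [Hcreate_apply_of_lt I _ (by omega), Hcreate_apply_of_lt I _ (by omega), smul_zero]

theorem Hannih_neg_single (l : ℕ) (F : FockR Γ) :
    Hannih I (-Pi.single i 1) l F = (-1 : ℂ) ^ l • Hannih I (Pi.single i 1) l F := by
  refine DFinsupp.ext fun n => ?_
  rw [DirectSum.smul_apply, Hannih_apply I _ rfl, Hannih_apply I _ rfl, annihComp_neg_single]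

end

end SpinWreath

end

noncomputable section

namespace SpinWreath

/-! ### The relations between the operators on the Fock space -/

section

variable {Γ : Type*} [Group Γ] [Fintype Γ] {r : ℕ} (I : IrrepList Γ r) (i j : Fin (r + 1))

theorem Hcreate_comm (k l : ℕ) (F : FockR Γ) :
    Hcreate I (Pi.single i 1) k (Hcreate I (Pi.single j 1) l F) =
      Hcreate I (Pi.single j 1) l (Hcreate I (Pi.single i 1) k F) := by
  apply fockWreath_injective
  simp only [fockWreath_Hcreate]
  exact conv_left_comm (grade_isClass (spinWreath_isMult I i).isClass k)
    (grade_isClass (spinWreath_isMult I j).isClass l) (fockWreath_isClass F)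

theorem Hannih_comm (k l : ℕ) (F : FockR Γ) :
    Hannih I (Pi.single i 1) k (Hannih I (Pi.single j 1) l F) =
      Hannih I (Pi.single j 1) l (Hannih I (Pi.single i 1) k F) := by
  apply fockWreath_injective
  simp only [fockWreath_Hannih]
  exact annihWreath_comm _ _ (fockWreath_isClass F) k l

theorem Hannih_Hcreate (k l : ℕ) (F : FockR Γ) :
    Hannih I (Pi.single i 1) l (Hcreate I (Pi.single j 1) k F) =
      ∑ p ∈ Finset.HasAntidiagonal.antidiagonal l, if p.1 ≤ k then pairCoeff i j p.1 •
        Hcreate I (Pi.single j 1) (k - p.1) (Hannih I (Pi.single i 1) p.2 F) else 0 := by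
  apply fockWreath_injective
  rw [fockWreath_Hannih, fockWreath_Hcreate, map_sum]
  funext n g s
  rw [annihWreath_conv I i j (fockWreath_isClass F)]
  simp only [Finset.sum_apply]
  refine Finset.sum_congr rfl fun p _ => ?_
  split_ifs
  · rw [map_smul, fockWreath_Hcreate, fockWreath_Hannih]
    rfl
  · rw [map_zero]
    rfl

theorem sum_Hcreate_Hcreate (N : ℕ) (hN : N ≠ 0) (F : FockR Γ) :
    ∑ p ∈ Finset.HasAntidiagonal.antidiagonal N, (-1 : ℂ) ^ p.1 •
      Hcreate I (Pi.single i 1) p.1 (Hcreate I (Pi.single i 1) p.2 F) = 0 := by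
  apply fockWreath_injective
  rw [map_sum, map_zero]
  funext n g s
  simp only [Finset.sum_apply, map_smul, fockWreath_Hcreate]
  exact sum_conv_grade_conv_grade I i (fockWreath_isClass F) N hN n g s

theorem sum_Hannih_Hannih (N : ℕ) (hN : N ≠ 0) (F : FockR Γ) :
    ∑ p ∈ Finset.HasAntidiagonal.antidiagonal N, (-1 : ℂ) ^ p.1 •
      Hannih I (Pi.single i 1) p.2 (Hannih I (Pi.single i 1) p.1 F) = 0 := by
  apply fockWreath_injective
  rw [map_sum, map_zero]
  funext n g s
  simp only [Finset.sum_apply, map_smul, fockWreath_Hannih]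
  exact sum_annihWreath_annihWreath (irrMat I i) (fun n => F n) N hN n g s

theorem Hcreate_zero : Hcreate I (Pi.single i 1) 0 = 1 := by
  refine LinearMap.ext fun F => fockWreath_injective ?_
  have hm := spinWreath_isMult I i
  rw [fockWreath_Hcreate, conv_comm, conv_of_delta (fockWreath_isClass F)
    (grade_isClass hm.isClass 0)]
  · rfl
  · intro n g s
    unfold grade
    split_ifs with h
    · subst h; exact hm.map_zero g s
    · rfl

theorem Hannih_zero : Hannih I (Pi.single i 1) 0 = 1 := by
  refine LinearMap.ext fun F => fockWreath_injective ?_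
  rw [fockWreath_Hannih]
  funext n g s
  have h1 := (tensorInvFun_isMult (irrMat I i)).map_zero
  have h2 : ∀ (g₀ : Fin 0 → Γ) (s₀ : Equiv.Perm (Fin 0)), tensorCharInv (irrMat I i) g₀ s₀ *
      evOn (fockWreath F) (Sum.elim g₀ g) (Equiv.sumCongr s₀ s) Finset.univ =
      fockWreath F n g s := by
    intro g₀ s₀
    rw [show tensorCharInv (irrMat I i) g₀ s₀ = 1 from h1 g₀ s₀, one_mul,
      evOn_univ_equiv (fockWreath_isClass F) (g' := g) (s' := s) (Equiv.emptySum (Fin 0) (Fin n)).symm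
      (fun _ => rfl) (fun _ => rfl), evOn_univ (fockWreath_isClass F)]
  rw [annihWreath]
  simp only [h2]
  simp

/-! ### Vertex operators on vectors of bounded degree -/

/-- The components of degree at least `M` vanish. -/
def BoundedBy (M : ℕ) (F : FockR Γ) : Prop := ∀ m, M ≤ m → F m = 0

omit [Fintype Γ] in
theorem exists_boundedBy (F : FockR Γ) : ∃ M, BoundedBy M F := by
  classical
  refine ⟨(DFinsupp.support F).sup id + 1, fun m hm => ?_⟩
  by_contra h
  have h1 : m ∈ DFinsupp.support F := (DFinsupp.mem_support_toFun F m).mpr h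
  have h2 := Finset.le_sup (f := id) h1
  simp only [id] at h2
  omega

variable (α : Fin (r + 1) → ℤ)

theorem BoundedBy.annih {M : ℕ} {F : FockR Γ} (hF : BoundedBy M F) (l : ℕ) :
    BoundedBy M (Hannih I α l F) := fun m hm => by
  rw [Hannih_apply I α rfl, hF _ (by omega), map_zero]

theorem BoundedBy.annih_eq_zero {M : ℕ} {F : FockR Γ} (hF : BoundedBy M F) {l : ℕ} (hl : M ≤ l) :
    Hannih I α l F = 0 := by
  refine DFinsupp.ext fun m => ?_
  rw [Hannih_apply I α rfl, hF _ (by omega), map_zero]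
  rfl

theorem BoundedBy.create {M : ℕ} {F : FockR Γ} (hF : BoundedBy M F) (k : ℕ) :
    BoundedBy (k + M) (Hcreate I α k F) := fun m hm => by
  obtain ⟨p, rfl⟩ := Nat.exists_eq_add_of_le (show k ≤ m by omega)
  rw [Hcreate_apply I α rfl, hF _ (by omega), map_zero]

omit [Fintype Γ] in
theorem fockR_sum_apply {ι : Type*} (S : Finset ι) (f : ι → FockR Γ) (m : ℕ) :
    (∑ x ∈ S, f x) m = ∑ x ∈ S, f x m :=
  map_sum (DirectSum.component ℂ ℕ (fun n => SpinFun Γ n) m) f S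

/-- Annihilation does not raise the bound, and creation by $l-n$ with $l<M$ raises it by less than
$M+|n|$. -/
theorem BoundedBy.modeSum {M K : ℕ} {F : FockR Γ} (hF : BoundedBy M F) (n : ℤ)
    (hK : 2 * M + n.natAbs ≤ K) :
    BoundedBy K (modeSum (Hcreate I α) (Hannih I α) n M F) := by
  intro m hm
  unfold SpinWreath.modeSum
  rw [fockR_sum_apply]
  refine Finset.sum_eq_zero fun l hl => ?_
  have hl' := Finset.mem_range.mp hl
  rw [DirectSum.smul_apply]
  unfold extendInt
  split_ifs with h
  · rw [(hF.annih I α l).create I α _ m (by omega), smul_zero]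
  · exact smul_zero _

/-- The range of `l` in `Hcoeff` depends on the degree; extending it to a common `M` adds only terms
killed by annihilation. -/
theorem Hcoeff_eq_modeSum {M : ℕ} {F : FockR Γ} (hF : BoundedBy M F) (n : ℤ) :
    Hcoeff I α n F = modeSum (Hcreate I α) (Hannih I α) n M F := by
  have h1 : F = ∑ m ∈ Finset.range M, DirectSum.lof ℂ ℕ (fun k => SpinFun Γ k) m (F m) := by
    refine DFinsupp.ext fun p => ?_
    rw [fockR_sum_apply]
    by_cases hp : p < M
    · rw [Finset.sum_eq_single p]
      · exact (DirectSum.of_eq_same (β := fun k => SpinFun Γ k) p (F p)).symm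
      · intro m _ hm
        exact DirectSum.of_eq_of_ne (β := fun k => SpinFun Γ k) m p (F m) hm.symm
      · intro h
        exact absurd (Finset.mem_range.mpr hp) h
    · rw [hF p (by omega)]
      symm
      refine Finset.sum_eq_zero fun m hm => ?_
      have := Finset.mem_range.mp hm
      exact DirectSum.of_eq_of_ne (β := fun k => SpinFun Γ k) m p (F m) (by omega)
  have h2 : ∀ m f, m < M → Hcoeff I α n (DirectSum.lof ℂ ℕ (fun k => SpinFun Γ k) m f) =
      ∑ l ∈ Finset.range M, (-1 : ℂ) ^ l • extendInt (Hcreate I α) (l - n)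
        (Hannih I α l (DirectSum.lof ℂ ℕ (fun k => SpinFun Γ k) m f)) := by
    intro m f hm
    rw [Hcoeff, DirectSum.toModule_lof, LinearMap.sum_apply]
    have hb : BoundedBy (m + 1) (DirectSum.lof ℂ ℕ (fun k => SpinFun Γ k) m f) := fun p hp =>
      DirectSum.of_eq_of_ne (β := fun k => SpinFun Γ k) m p f (by omega)
    rw [← Finset.sum_subset (Finset.range_subset_range.mpr (show m + 1 ≤ M by omega))]
    · refine Finset.sum_congr rfl fun l _ => ?_
      unfold extendInt
      by_cases h : n ≤ (l : ℤ)
      · rw [if_pos h, if_pos (by omega)]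
        rfl
      · rw [if_neg h, if_neg (by omega), LinearMap.zero_apply, LinearMap.zero_apply, smul_zero]
    · intro l _ hl
      rw [Finset.mem_range, not_lt] at hl
      rw [hb.annih_eq_zero I α hl, map_zero, smul_zero]
  unfold modeSum
  conv_lhs => rw [h1, map_sum, Finset.sum_congr rfl fun m hm => h2 m _ (Finset.mem_range.mp hm),
    Finset.sum_comm]
  refine Finset.sum_congr rfl fun l _ => ?_
  rw [← Finset.smul_sum, ← map_sum, ← map_sum, ← h1]

theorem Hcoeff_anticommutator (n n' : ℤ) (F : FockR Γ) :
    Hcoeff I (Pi.single i 1) n (Hcoeff I (Pi.single i 1) n' F) +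
      Hcoeff I (Pi.single i 1) n' (Hcoeff I (Pi.single i 1) n F) =
      (if n = -n' then 2 * (-1 : ℂ) ^ n else 0) • F := by
  obtain ⟨M, hM⟩ := exists_boundedBy F
  -- This dominates $M-n$ and $M-n'$, and `M + L` bounds the degrees in both inner sums.
  let L := M + n.natAbs + n'.natAbs + 1
  rw [Hcoeff_eq_modeSum I _ hM, Hcoeff_eq_modeSum I _ hM,
    Hcoeff_eq_modeSum I _ (hM.modeSum I _ n' (K := M + L) (by omega)),
    Hcoeff_eq_modeSum I _ (hM.modeSum I _ n (K := M + L) (by omega))]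
  exact modeSum_anticommutator (c := pairCoeff i i) (if_pos rfl)
    (fun a ha => by simp [pairCoeff, ha]) (Hcreate_zero I i) (Hannih_zero I i) (Hcreate_comm I i i)
    (Hannih_comm I i i) (Hannih_Hcreate I i i) (sum_Hcreate_Hcreate I i) (sum_Hannih_Hannih I i)
    (L := L) n n' (by omega) (by omega) (by omega) le_rfl F
    fun u v hu => (hM.annih I _ v).annih_eq_zero I _ hu

theorem Hcoeff_comm {i j : Fin (r + 1)} (hij : i ≠ j) (n n' : ℤ) (F : FockR Γ) :
    Hcoeff I (Pi.single i 1) n (Hcoeff I (Pi.single j 1) n' F) =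
      Hcoeff I (Pi.single j 1) n' (Hcoeff I (Pi.single i 1) n F) := by
  obtain ⟨M, hM⟩ := exists_boundedBy F
  let L := M + n.natAbs + n'.natAbs + 1
  rw [Hcoeff_eq_modeSum I (Pi.single i 1) hM, Hcoeff_eq_modeSum I (Pi.single j 1) hM,
    Hcoeff_eq_modeSum I _ (hM.modeSum I _ n' (K := M + L) (by omega)),
    Hcoeff_eq_modeSum I _ (hM.modeSum I _ n (K := M + L) (by omega))]
  exact modeSum_comm (c := pairCoeff i j) (c' := pairCoeff j i) (if_pos rfl)
    (fun a ha => by simp [pairCoeff, ha, hij]) (if_pos rfl)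
    (fun a ha => by simp [pairCoeff, ha, hij.symm]) (Hcreate_comm I i j) (Hannih_comm I i j)
    (Hannih_Hcreate I i j) (Hannih_Hcreate I j i)
    (L := L) n n' (by omega) (by omega) (by omega) le_rfl F
    (fun u v hu => (hM.annih I _ v).annih_eq_zero I _ hu)
    fun u v hu => (hM.annih I _ v).annih_eq_zero I _ hu

/-- The extra sign of a term is $(-1)^{(l-n)+l}=(-1)^n$, independent of `l`. -/
theorem Hcoeff_neg_single (n : ℤ) :
    Hcoeff I (-Pi.single i 1) n = (-1 : ℂ) ^ n • Hcoeff I (Pi.single i 1) n := by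
  refine DirectSum.linearMap_ext ℂ fun m => LinearMap.ext fun f => ?_
  simp only [LinearMap.comp_apply, LinearMap.smul_apply, Hcoeff, DirectSum.toModule_lof,
    LinearMap.sum_apply, Finset.smul_sum]
  refine Finset.sum_congr rfl fun l _ => ?_
  split_ifs with h
  · simp only [LinearMap.smul_apply, LinearMap.comp_apply]
    rw [Hannih_neg_single, map_smul, Hcreate_neg_single, smul_smul, smul_smul, smul_smul]
    congr 1
    obtain ⟨k, hk⟩ := Int.eq_ofNat_of_zero_le (show 0 ≤ (l : ℤ) - n by omega)
    have hn : n = l - k := by omega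
    rw [hk, hn, zpow_sub₀ (by norm_num), Int.toNat_natCast, zpow_natCast, zpow_natCast,
      div_eq_mul_inv, ← inv_pow]
    norm_num
    ring
  · simp

/-! ### The central extension and the vertex operators -/

theorem eElt_neg (α : Fin (r + 1) → ℤ) : eElt (-α) = eElt α :=
  SignExt.ext rfl (funext fun a => by simp [eElt])

theorem eElt_single_mul_eElt_single :
    eElt (Pi.single i 1 : Fin (r + 1) → ℤ) * eElt (Pi.single j 1) =
      ⟨epsMatrix r i j, fun a => (Pi.single i 1 + Pi.single j 1 : Fin (r + 1) → ZMod 2) a⟩ := by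
  have h : ∀ i : Fin (r + 1), (eElt (Pi.single i 1 : Fin (r + 1) → ℤ)).vec = Pi.single i 1 := by
    intro i
    funext a
    by_cases ha : a = i
    · subst ha; simp [eElt]
    · simp [eElt, ha]
  refine SignExt.ext ?_ ?_
  · rw [SignExt.mul_sgn, h, h]
    simp [eElt, bil, Pi.single_apply]
  · rw [SignExt.mul_vec, h, h]

theorem eElt_single_mul_self :
    eElt (Pi.single i 1 : Fin (r + 1) → ℤ) * eElt (Pi.single i 1) = 1 := by
  rw [eElt_single_mul_eElt_single]
  refine SignExt.ext (by simp [epsMatrix]) (funext fun a => ?_)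
  exact zmod2_add_self _

/-- Exactly one of the two orders has the larger index first, and only that one receives the sign of
$\varepsilon$. -/
theorem eElt_single_anticomm {i j : Fin (r + 1)} (hij : i ≠ j) :
    eElt (Pi.single i 1 : Fin (r + 1) → ℤ) * eElt (Pi.single j 1) =
      negOneElt r * (eElt (Pi.single j 1) * eElt (Pi.single i 1)) := by
  rw [eElt_single_mul_eElt_single, eElt_single_mul_eElt_single]
  refine SignExt.ext ?_ (funext fun a => ?_)
  · rw [SignExt.mul_sgn]
    simp only [negOneElt, bil_zero_left, epsMatrix]
    rcases lt_or_gt_of_ne hij with h | h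
    · rw [if_neg h.not_gt, if_pos h, add_zero]; exact (zmod2_add_self 1).symm
    · rw [if_pos h, if_neg h.not_gt, add_zero, add_zero]
  · simp [negOneElt, add_comm]

variable {Φ : AddSubgroup (Fin (r + 1) → ℤ)}
  (ρ : Representation ℂ (LatticeExt r) (LatticeSpace Φ))

theorem vertexOp_neg_single (n : ℤ) :
    vertexOp I ρ (-Pi.single i 1) n = (-1 : ℂ) ^ n • vertexOp I ρ (Pi.single i 1) n := by
  unfold vertexOp
  rw [Hcoeff_neg_single, eElt_neg, TensorProduct.map_smul_left]

/-- For $i=j$ the lattice factors square to 1 and the Fock factors give the scalar; for $i\ne j$ the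
Fock factors commute and the lattice factors anticommute. -/
theorem vertexOp_anticomm (hneg : ρ (negOneElt r) = -1) (n n' : ℤ) :
    anticomm (vertexOp I ρ (Pi.single i 1) n) (vertexOp I ρ (Pi.single j 1) n') =
      (if i = j ∧ n = -n' then 2 * (-1 : ℂ) ^ n else 0) •
        (1 : Module.End ℂ (FockR Γ ⊗[ℂ] LatticeSpace Φ)) := by
  unfold anticomm vertexOp
  rw [← TensorProduct.map_mul, ← TensorProduct.map_mul, ← map_mul, ← map_mul]
  by_cases hij : i = j
  · subst hij
    have h1 : Hcoeff I (Pi.single i 1) n * Hcoeff I (Pi.single i 1) n' +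
        Hcoeff I (Pi.single i 1) n' * Hcoeff I (Pi.single i 1) n =
        (if n = -n' then 2 * (-1 : ℂ) ^ n else 0) • (1 : Module.End ℂ (FockR Γ)) :=
      LinearMap.ext fun F => Hcoeff_anticommutator I i n n' F
    rw [← TensorProduct.map_add_left, h1, eElt_single_mul_self, map_one,
      TensorProduct.map_smul_left, TensorProduct.map_one]
    simp only [true_and]
  · have h1 : Hcoeff I (Pi.single i 1) n * Hcoeff I (Pi.single j 1) n' =
        Hcoeff I (Pi.single j 1) n' * Hcoeff I (Pi.single i 1) n :=
      LinearMap.ext fun F => Hcoeff_comm I hij n n' F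
    have h2 : ρ (eElt (Pi.single i 1) * eElt (Pi.single j 1)) +
        ρ (eElt (Pi.single j 1) * eElt (Pi.single i 1)) = 0 := by
      rw [eElt_single_anticomm hij, map_mul, hneg]
      exact LinearMap.ext fun v => neg_add_cancel _
    rw [h1, ← TensorProduct.map_add_right, h2, TensorProduct.map_zero_right, if_neg, zero_smul]
    exact fun h => hij h.1

omit [Group Γ] [Fintype Γ] in
theorem anticomm_smul_smul {V : Type*} [AddCommMonoid V] [Module ℂ V] (c d : ℂ)
    (a b : Module.End ℂ V) :
    anticomm (c • a) (d • b) = (c * d) • anticomm a b := by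
  unfold anticomm
  rw [smul_mul_smul_comm, smul_mul_smul_comm, smul_add, mul_comm d]

theorem neg_one_zpow_mul_neg {n n' : ℤ} (h : n = -n') : (-1 : ℂ) ^ n' * (-1) ^ n = 1 := by
  subst h
  rw [← zpow_add₀ (by norm_num), add_neg_cancel, zpow_zero]

theorem vertexOp_neg_anticomm (hneg : ρ (negOneElt r) = -1) (n n' : ℤ) :
    anticomm (vertexOp I ρ (-Pi.single i 1) n) (vertexOp I ρ (-Pi.single j 1) n') =
      (if i = j ∧ n = -n' then 2 * (-1 : ℂ) ^ n else 0) •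
        (1 : Module.End ℂ (FockR Γ ⊗[ℂ] LatticeSpace Φ)) := by
  rw [vertexOp_neg_single, vertexOp_neg_single, anticomm_smul_smul,
    vertexOp_anticomm I i j ρ hneg, smul_smul]
  congr 1
  split_ifs with h
  · linear_combination (2 * (-1) ^ n) * neg_one_zpow_mul_neg h.2
  · rw [mul_zero]

theorem vertexOp_anticomm_neg (hneg : ρ (negOneElt r) = -1) (n n' : ℤ) :
    anticomm (vertexOp I ρ (Pi.single i 1) n) (vertexOp I ρ (-Pi.single j 1) n') =
      (if i = j ∧ n = -n' then (2 : ℂ) else 0) •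
        (1 : Module.End ℂ (FockR Γ ⊗[ℂ] LatticeSpace Φ)) := by
  rw [vertexOp_neg_single, ← one_smul ℂ (vertexOp I ρ (Pi.single i 1) n), anticomm_smul_smul,
    vertexOp_anticomm I i j ρ hneg, smul_smul]
  congr 1
  split_ifs with h
  · linear_combination 2 * neg_one_zpow_mul_neg h.2
  · rw [mul_zero]

end

end SpinWreath

end

theorem mainTheorem12 {Γ : Type*} [Group Γ] [Fintype Γ] {r : ℕ}
    (I : SpinWreath.IrrepList Γ r)
    (Φ : AddSubgroup (Fin (r + 1) → ℤ))
    (hΦ : Maximal (fun Ψ : AddSubgroup (Fin (r + 1) → ℤ) => SpinWreath.IsIsotropic I Ψ) Φ)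
    (ρ : Representation ℂ (SpinWreath.LatticeExt r) (SpinWreath.LatticeSpace Φ))
    (hirr : ρ.IsIrreducible)
    (hneg : ρ (SpinWreath.negOneElt r) = -1)
    (i j : Fin (r + 1)) (n n' : ℤ) :
    SpinWreath.anticomm (SpinWreath.vertexOp I ρ (Pi.single i 1) n)
        (SpinWreath.vertexOp I ρ (Pi.single j 1) n') =
      (if i = j ∧ n = -n' then 2 * (-1 : ℂ) ^ n else 0) •
        (1 : Module.End ℂ (SpinWreath.FockR Γ ⊗[ℂ] SpinWreath.LatticeSpace Φ)) ∧
    SpinWreath.anticomm (SpinWreath.vertexOp I ρ (-Pi.single i 1) n)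
        (SpinWreath.vertexOp I ρ (-Pi.single j 1) n') =
      (if i = j ∧ n = -n' then 2 * (-1 : ℂ) ^ n else 0) •
        (1 : Module.End ℂ (SpinWreath.FockR Γ ⊗[ℂ] SpinWreath.LatticeSpace Φ)) ∧
    SpinWreath.anticomm (SpinWreath.vertexOp I ρ (Pi.single i 1) n)
        (SpinWreath.vertexOp I ρ (-Pi.single j 1) n') =
      (if i = j ∧ n = -n' then (2 : ℂ) else 0) •
        (1 : Module.End ℂ (SpinWreath.FockR Γ ⊗[ℂ] SpinWreath.LatticeSpace Φ)) := by
  exact ⟨SpinWreath.vertexOp_anticomm I i j ρ hneg n n',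
    SpinWreath.vertexOp_neg_anticomm I i j ρ hneg n n',
    SpinWreath.vertexOp_anticomm_neg I i j ρ hneg n n'⟩
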